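/- Let $d\ge 2$, let $\varphi\in C_c^\infty(\mathbb{R}^d)$ be real-valued, and let $Z=(Z_k)_{k\in\mathbb{Z}^d}$ be a bounded sequence in $\mathbb{R}^d$. Write $B_R(x_0)$ for the open Euclidean ball and $B_R(x_0)/\varepsilon=\{x/\varepsilon : x\in B_R(x_0)\}$. Assume that for every continuous $F:\mathbb{R}^d\times\mathbb{R}^d\to\mathbb{R}$ and every $l\in\mathbb{Z}^d$ there is a constant $C_{F,l}\in\mathbb{R}$ such that for all $R>0$ and $x_0\in\mathbb{R}^d$ $$\lim_{\varepsilon\to0^+}\frac{\varepsilon^d}{|B_R|}\sum_{k\in\mathbb{Z}^d\cap B_R(x_0)/\varepsilon}F(Z_k,Z_{k+l})=C_{F,l}.\qquad\text{(A3)}$$ Let $G$ be the Green function of $\Delta$ on $\mathbb{R}^d$ (so $\Delta G=\delta_0$): $G(x)=\frac1{2\pi}\ln|x|$ if $d=2$ and $G(x)=-\frac{|x|^{2-d}}{d(d-2)|B_1|}$ if $d\ge3$. Put $u_{i,j}=G*\partial_i\partial_j\varphi$ for $i,j\in\{1,\dots,d\}$. Then there exists $w_2\in L^1_{loc}(\mathbb{R}^d)$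 which solves, in the sense of distributions on $\mathbb{R}^d$, $$\Delta w_2=\sum_{k\in\mathbb{Z}^d}Z_k^T\left(\int_0^1(1-t)\,D^2\varphi(\cdot-k-tZ_k)\,dt\right)Z_k,$$ and whose distributional gradient is $$\nabla w_2=\sum_{i,j=1}^d\ \sum_{k\in\mathbb{Z}^d}(Z_k)_j(Z_k)_i\int_0^1(1-t)\,\nabla u_{i,j}(\cdot-k-tZ_k)\,dt,$$ where for all $i,j$ the series over $k$ converges normally (hence absolutely and uniformly) on every ball. Moreover $\nabla w_2\in (L^\infty(\mathbb{R}^d))^d$ and, as $\varepsilon\to0^+$: (i) $\nabla w_2(\cdot/\varepsilon)$ tends to $0$ weakly-$*$ in $L^\infty(\mathbb{R}^d)$; (ii) $\varepsilon w_2(\cdot/\varepsilon)$ tends to $0$ strongly in $L^\infty_{loc}(\mathbb{R}^d)$; (iii) there is a constant $\mathcal{M}_2\in\mathbb{R}$ such that $|\nabla w_2(\cdot/\varepsilon)|^2$ tends to $\mathcal{M}_2$ weakly-$*$ in $L^\infty(\mathbb{R}^d)$. -/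

import Mathlib

open MeasureTheory Filter Topology
open scoped ENNReal ContDiff Convolution Gradient Laplacian

noncomputable section

namespace NonlinearCorrector

/-- The Euclidean space `ℝᵈ`. -/
abbrev E (d : ℕ) := EuclideanSpace ℝ (Fin d)

/-- The lattice point `k ∈ ℤᵈ` seen as a vector of `ℝᵈ`. -/
def lat {d : ℕ} (k : Fin d → ℤ) : E d := WithLp.toLp 2 (fun i => (k i : ℝ))

theorem finite_lat_mem_ball {d : ℕ} (c : E d) (r : ℝ) :
    {k : Fin d → ℤ | lat k ∈ Metric.ball c r}.Finite := by
  refine (Set.finite_Icc (fun i => ⌊c i - r⌋) (fun i => ⌈c i + r⌉)).subset ?_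
  intro k hk
  have h : ∀ i, |(k i : ℝ) - c i| < r := by
    intro i
    have h1 : ‖(lat k - c) i‖ ≤ ‖lat k - c‖ := PiLp.norm_apply_le _ i
    have h2 : ‖lat k - c‖ < r := by simpa [dist_eq_norm] using hk
    simpa [lat, Real.norm_eq_abs] using h1.trans_lt h2
  refine ⟨fun i => ?_, fun i => ?_⟩
  · have := (abs_lt.1 (h i)).1
    exact Int.floor_le_iff.2 (by linarith)
  · have := (abs_lt.1 (h i)).2
    exact Int.le_ceil_iff.2 (by linarith)

/-- The finite set of the `k ∈ ℤᵈ` that lie in the open ball of centre `c` and radius `r`. -/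
def latBall {d : ℕ} (c : E d) (r : ℝ) : Finset (Fin d → ℤ) :=
  (finite_lat_mem_ball c r).toFinset

theorem mem_latBall {d : ℕ} (c : E d) (r : ℝ) (k : Fin d → ℤ) :
    k ∈ latBall c r ↔ lat k ∈ Metric.ball c r := by
  simp [latBall]

/-- All second-order correlations of `Z` have averages: for every continuous `F` on `ℝᵈ × ℝᵈ` and
every shift `l`, the averages of `F(Z_k, Z_{k+l})` over `k ∈ B_R(x₀)/ε` tend, as `ε → 0⁺`, to a
constant that depends neither on `R` nor on `x₀`. -/
def HasCorrelationAverages {d : ℕ} (Z : (Fin d → ℤ) → E d) : Prop :=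
  ∀ F : E d × E d → ℝ, Continuous F → ∀ l : Fin d → ℤ, ∃ C : ℝ, ∀ R : ℝ, 0 < R → ∀ x₀ : E d,
    Tendsto
      (fun ε : ℝ => ε ^ d / volume.real (Metric.ball (0 : E d) R) *
        ∑ k ∈ latBall (ε⁻¹ • x₀) (R / ε), F (Z k, Z (k + l)))
      (𝓝[>] 0) (𝓝 C)

/-- The Green function of `Δ` on `ℝᵈ`, `d ≥ 2`, with the sign for which `ΔG = δ₀`:
`(2π)⁻¹ log |x|` for `d = 2` and `-|x|^{2-d} / (d (d-2) |B₁|)` for `d ≥ 3`. -/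
def green (d : ℕ) (x : E d) : ℝ :=
  if d = 2 then Real.log ‖x‖ / (2 * Real.pi)
  else -‖x‖ ^ (2 - (d : ℤ)) / ((d : ℝ) * ((d : ℝ) - 2) * volume.real (Metric.ball (0 : E d) 1))

/-- The second derivative `D²φ(x)(v, w) = vᵀ D²φ(x) w`. -/
def hess {d : ℕ} (φ : E d → ℝ) (x v w : E d) : ℝ := iteratedFDeriv ℝ 2 φ x ![v, w]

/-- `∂ᵢ∂ⱼφ`. -/
def partial₂ {d : ℕ} (φ : E d → ℝ) (i j : Fin d) (x : E d) : ℝ :=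
  hess φ x (EuclideanSpace.single i 1) (EuclideanSpace.single j 1)

/-- `u_{i,j} = G * ∂ᵢ∂ⱼφ`. -/
def uPot {d : ℕ} (φ : E d → ℝ) (i j : Fin d) : E d → ℝ :=
  green d ⋆[ContinuousLinearMap.mul ℝ ℝ, volume] partial₂ φ i j

/-- `∑ₖ Zₖᵀ (∫₀¹ (1-t) D²φ(x-k-tZₖ) dt) Zₖ`; for `φ` compactly supported and `Z` bounded the sum is
locally finite. -/
def taylorRemainder {d : ℕ} (φ : E d → ℝ) (Z : (Fin d → ℤ) → E d) (x : E d) : ℝ :=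
  ∑' k, ∫ t in (0 : ℝ)..1, (1 - t) * hess φ (x - lat k - t • Z k) (Z k) (Z k)

/-- `(Zₖ)ⱼ (Zₖ)ᵢ ∫₀¹ (1-t) ∇u_{i,j}(x-k-tZₖ) dt`. -/
def gradTerm {d : ℕ} (φ : E d → ℝ) (Z : (Fin d → ℤ) → E d) (i j : Fin d) (k : Fin d → ℤ)
    (x : E d) : E d :=
  (Z k j * Z k i) • ∫ t in (0 : ℝ)..1, (1 - t) • ∇ (uPot φ i j) (x - lat k - t • Z k)

/-- `∑_{i,j} ∑ₖ (Zₖ)ⱼ (Zₖ)ᵢ ∫₀¹ (1-t) ∇u_{i,j}(x-k-tZₖ) dt`. -/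
def gradField {d : ℕ} (φ : E d → ℝ) (Z : (Fin d → ℤ) → E d) (x : E d) : E d :=
  ∑ i, ∑ j, ∑' k, gradTerm φ Z i j k x

/-- A series of functions on `ℝᵈ` converges normally (so absolutely and uniformly) on every ball. -/
def NormallyConvergent {d : ℕ} {ι F : Type*} [NormedAddCommGroup F] (f : ι → E d → F) : Prop :=
  ∀ R : ℝ, 0 < R → ∃ b : ι → ℝ, Summable b ∧ ∀ k, ∀ x ∈ Metric.ball (0 : E d) R, ‖f k x‖ ≤ b k

/-- `Δw = f` in the sense of distributions on `ℝᵈ`. -/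
def IsDistribSolution {d : ℕ} (w f : E d → ℝ) : Prop :=
  LocallyIntegrable w volume ∧ LocallyIntegrable f volume ∧
    ∀ ψ : E d → ℝ, ContDiff ℝ ∞ ψ → HasCompactSupport ψ →
      ∫ x, w x * Δ ψ x = ∫ x, f x * ψ x

/-- `g` is the distributional gradient of `w` on `ℝᵈ`. -/
def HasWeakGradient {d : ℕ} (w : E d → ℝ) (g : E d → E d) : Prop :=
  LocallyIntegrable w volume ∧ LocallyIntegrable g volume ∧
    ∀ ψ : E d → ℝ, ContDiff ℝ ∞ ψ → HasCompactSupport ψ →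
      ∫ x, w x • ∇ ψ x = -∫ x, ψ x • g x

/-- `f ε → g` for the weak-* topology of `L^∞(ℝᵈ)` as `ε → 0⁺` (tested against `L¹`; for
vector-valued functions this is the componentwise notion). -/
def TendstoWeakStar {d : ℕ} {F : Type*} [NormedAddCommGroup F] [NormedSpace ℝ F]
    (f : ℝ → E d → F) (g : E d → F) : Prop :=
  (∀ ε : ℝ, 0 < ε → MemLp (f ε) ∞ volume) ∧ MemLp g ∞ volume ∧
    ∀ h : E d → ℝ, Integrable h volume →
      Tendsto (fun ε => ∫ x, h x • f ε x) (𝓝[>] 0) (𝓝 (∫ x, h x • g x))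

/-- `f ε → 0` in `L^∞_loc(ℝᵈ)` as `ε → 0⁺`. -/
def TendstoZeroLocUnif {d : ℕ} (f : ℝ → E d → ℝ) : Prop :=
  ∀ R : ℝ, 0 < R →
    Tendsto (fun ε => eLpNorm (f ε) ∞ (volume.restrict (Metric.ball (0 : E d) R)))
      (𝓝[>] 0) (𝓝 0)

end NonlinearCorrector

end

/-! Write `Ψ_k` for the potential `∑ (Z_k)_j (Z_k)_i ∫₀¹ (1-t) u_{i,j}(· - k - t Z_k) dt`, whose
Laplacian is the `k`-th term of the right-hand side, because `ΔG = δ₀`, and write `Φ_k = ∇Ψ_k`. Far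
from the support of `φ`, all derivatives in `u_{i,j} = G * ∂ᵢ∂ⱼφ` can be moved onto `G`. Since
`∂ᵢ∂ⱼG` is homogeneous of degree `-d`, and one more derivative lowers the degree by one, `u_{i,j}`
decays like `|x|^{-d}` and its gradient like `|x|^{-d-1}`. As `Z` is bounded, `Ψ_k` and `Φ_k`
inherit these rates around `k`, uniformly in `k`.

The rate `d + 1` is summable over the lattice, so `V = ∑ Φ_k` converges normally and is bounded. The
rate `d` just fails to be, so the potentials are renormalised: `w₂ = ∑ (Ψ_k - Ψ_k(0))`. The
subtracted constants are invisible to the equation because `∫ Δψ = 0`. Interpolating between the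
decay of `Ψ_k` and that of `Φ_k` bounds each difference by `(1 + |x|)^{1/2}` times weights of
summable rate `d + 1/2` (`exists_abs_sub_le`). Hence `w₂` grows at most like `|x|^{1/2}`. Sublinear
growth is exactly (ii), and (i) follows by integrating by parts, `V(·/ε)` being the gradient of `ε
w₂(·/ε)`.

For (iii), `|V|² = ∑ Φ_k · V`, and the `k`-th summand is concentrated near `k`. Against a test
function at scale `1/ε` it acts as a point mass at `k` (`tendsto_integral_tsum_sub_sum`). The mass
`∫ Φ_k · V` is the sum over `l` of the correlations `∫ Φ_k · Φ_{k+l}`, each a continuous function of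
`(Z_k, Z_{k+l})`, so (A3) gives its averages over balls. Averages over balls determine averages
against test functions, and dominated summation over `l` yields the limit, which is the sum over `l`
of these averages. -/

namespace NonlinearCorrector

variable {d : ℕ}

/-! ### Decaying weights and lattice sums -/

/-- The decaying weight `(1 + ‖x‖)^(-s)`. -/
noncomputable def wt (s : ℝ) (x : E d) : ℝ := (1 + ‖x‖) ^ (-s)

theorem wt_pos (s : ℝ) (x : E d) : 0 < wt s x := by
  unfold wt; positivity

theorem wt_le_one {s : ℝ} (hs : 0 ≤ s) (x : E d) : wt s x ≤ 1 :=
  Real.rpow_le_one_of_one_le_of_nonpos (by linarith [norm_nonneg x]) (by linarith)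

theorem continuous_wt (s : ℝ) : Continuous (wt (d := d) s) := by
  unfold wt
  exact (continuous_const.add continuous_norm).rpow_const
    fun x => Or.inl (show (0 : ℝ) < 1 + ‖x‖ by positivity).ne'

/-- Comparison of the weights at two points `x`, `y` whose distance is controlled. -/
theorem wt_le_of_le_mul {s c : ℝ} (hs : 0 ≤ s) (hc : 0 < c) {x y : E d}
    (h : 1 + ‖y‖ ≤ c * (1 + ‖x‖)) : wt s x ≤ c ^ s * wt s y := by
  unfold wt
  have hx : 0 < 1 + ‖x‖ := by positivity
  have hy : 0 < 1 + ‖y‖ := by positivity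
  rw [Real.rpow_neg hx.le, Real.rpow_neg hy.le, ← div_eq_mul_inv, inv_eq_one_div,
    div_le_div_iff₀ (by positivity) (by positivity), one_mul, ← Real.mul_rpow hc.le hx.le]
  exact Real.rpow_le_rpow hy.le h hs

theorem wt_le_of_dist_le {s r : ℝ} (hs : 0 ≤ s) {x y : E d} (h : ‖x - y‖ ≤ r) :
    wt s x ≤ (1 + r) ^ s * wt s y := by
  have hr : 0 ≤ r := (norm_nonneg _).trans h
  refine wt_le_of_le_mul hs (by linarith) ?_
  have : ‖y‖ ≤ ‖x‖ + r := by
    have := norm_sub_norm_le y x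
    rw [norm_sub_rev] at this
    linarith
  nlinarith [norm_nonneg x]

/-- The half-open unit cube with lowest corner `k`. -/
def unitCube (k : Fin d → ℤ) : Set (E d) := {y | ∀ i, y i ∈ Set.Ico (k i : ℝ) (k i + 1)}

theorem unitCube_eq_preimage (k : Fin d → ℤ) :
    unitCube k = (WithLp.ofLp : E d → Fin d → ℝ) ⁻¹'
      (Set.univ.pi fun i => Set.Ico (k i : ℝ) (k i + 1)) := by
  ext y; simp [unitCube]

theorem measurableSet_unitCube (k : Fin d → ℤ) : MeasurableSet (unitCube k) := by
  rw [unitCube_eq_preimage]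
  exact (PiLp.volume_preserving_ofLp (Fin d)).measurable
    (MeasurableSet.univ_pi fun _ => measurableSet_Ico)

theorem volume_unitCube (k : Fin d → ℤ) : volume (unitCube k) = 1 := by
  rw [unitCube_eq_preimage, (PiLp.volume_preserving_ofLp (Fin d)).measure_preimage
    (MeasurableSet.univ_pi fun _ => measurableSet_Ico).nullMeasurableSet, Real.volume_pi_Ico]
  simp

theorem pairwise_disjoint_unitCube : Pairwise (Function.onFun Disjoint (unitCube (d := d))) := by
  intro k l hkl
  refine Set.disjoint_left.2 fun y hk hl => hkl ?_
  funext i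
  rw [← Int.floor_eq_iff.2 (hk i), ← Int.floor_eq_iff.2 (hl i)]

theorem norm_sub_lat_le {k : Fin d → ℤ} {y : E d} (hy : y ∈ unitCube k) :
    ‖y - lat k‖ ≤ √d := by
  rw [EuclideanSpace.norm_eq]
  refine Real.sqrt_le_sqrt ?_
  calc ∑ i, ‖(y - lat k) i‖ ^ 2 ≤ ∑ _i : Fin d, (1 : ℝ) := by
        refine Finset.sum_le_sum fun i _ => ?_
        have := hy i
        have h1 : (y - lat k) i = y i - k i := by simp [lat]
        rw [h1, Real.norm_eq_abs, sq_abs]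
        nlinarith [this.1, this.2]
    _ = d := by simp

/-- Sums over the lattice are bounded by integrals. -/
theorem tsum_le_lintegral_of_le_on_unitCube {F : (Fin d → ℤ) → ℝ≥0∞} {g : E d → ℝ≥0∞}
    (h : ∀ k, ∀ y ∈ unitCube k, F k ≤ g y) : ∑' k, F k ≤ ∫⁻ y, g y := by
  calc ∑' k, F k = ∑' k, ∫⁻ _ in unitCube k, F k := by simp [volume_unitCube]
    _ ≤ ∑' k, ∫⁻ y in unitCube k, g y :=
        ENNReal.tsum_le_tsum fun k => setLIntegral_mono' (measurableSet_unitCube k) (h k)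
    _ = ∫⁻ y in ⋃ k, unitCube k, g y :=
        (lintegral_iUnion measurableSet_unitCube pairwise_disjoint_unitCube _).symm
    _ ≤ ∫⁻ y, g y := setLIntegral_le_lintegral _ _

theorem integrable_wt {s : ℝ} (hs : (d : ℝ) < s) : Integrable (wt (d := d) s) :=
  integrable_one_add_norm (by simpa using hs)

/-- The unit cube with corner `k` lies within `√d` of `k`, so each term is at most `(1 + √d)^s`
times the weight anywhere on its cube. The cubes are disjoint, and the integral of the weight is
finite for `s > d` and translation invariant, whence a bound independent of `x`. -/
theorem exists_tsum_wt_le {s : ℝ} (hs : (d : ℝ) < s) :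
    ∃ C : ℝ, 0 < C ∧ ∀ x : E d, Summable (fun k => wt s (x - lat k)) ∧
      ∑' k, wt s (x - lat k) ≤ C := by
  have hs0 : 0 ≤ s := (Nat.cast_nonneg d).trans hs.le
  set A : ℝ := (1 + √d) ^ s * ∫ y : E d, wt s y with hA
  have hA0 : 0 ≤ A := mul_nonneg (by positivity) (integral_nonneg fun y => (wt_pos s y).le)
  have key : ∀ x : E d, ∑' k, ENNReal.ofReal (wt s (x - lat k)) ≤ ENNReal.ofReal A := by
    intro x
    refine (tsum_le_lintegral_of_le_on_unitCube
      (g := fun y => ENNReal.ofReal ((1 + √d) ^ s * wt s (x - y))) ?_).trans ?_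
    · intro k y hy
      refine ENNReal.ofReal_le_ofReal (wt_le_of_dist_le hs0 ?_)
      simpa using norm_sub_lat_le hy
    · rw [hA, ← integral_const_mul, ← integral_sub_left_eq_self
        (fun y => (1 + √d) ^ s * wt s y) volume x]
      rw [ofReal_integral_eq_lintegral_ofReal]
      · exact ((integrable_wt hs).const_mul _).comp_sub_left x
      · exact Eventually.of_forall fun y => mul_nonneg (by positivity) (wt_pos s _).le
  have hsum : ∀ x : E d, Summable (fun k => wt s (x - lat k)) := by
    intro x
    have := ENNReal.summable_toReal ((key x).trans_lt ENNReal.ofReal_lt_top).ne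
    simpa [ENNReal.toReal_ofReal, (wt_pos s _).le] using this
  refine ⟨A + 1, by linarith, fun x => ⟨hsum x, ?_⟩⟩
  have h := key x
  rw [← ENNReal.ofReal_tsum_of_nonneg (fun k => (wt_pos s _).le) (hsum x),
    ENNReal.ofReal_le_ofReal_iff hA0] at h
  linarith

/-- Volume count: the cubes with corners in the ball are disjoint, of volume one, and lie in the
concentric ball of radius `r + √d`. -/
theorem exists_card_latBall_le (d : ℕ) : ∃ C : ℝ, 0 < C ∧ ∀ (c : E d) (r : ℝ), 0 ≤ r →
    ((latBall c r).card : ℝ) ≤ C * (1 + r) ^ d := by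
  set v := volume.real (Metric.ball (0 : E d) 1) with hv
  have hv0 : 0 ≤ v := measureReal_nonneg
  refine ⟨(1 + √d) ^ d * v + 1, by positivity, fun c r hr => ?_⟩
  have h1 : ((latBall c r).card : ℝ≥0∞) ≤ volume (Metric.ball c (r + √d)) + 0 := by
    have := tsum_le_lintegral_of_le_on_unitCube (d := d)
      (F := fun k => if k ∈ latBall c r then 1 else 0)
      (g := (Metric.ball c (r + √d)).indicator 1) ?_
    · rw [tsum_eq_sum (s := latBall c r) (by intro b hb; simp [hb]),
        lintegral_indicator_one Metric.isOpen_ball.measurableSet] at this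
      simpa using this
    · intro k y hy
      split_ifs with hk
      · rw [mem_latBall, Metric.mem_ball, dist_eq_norm] at hk
        rw [Set.indicator_of_mem]
        · simp
        · rw [Metric.mem_ball, dist_eq_norm]
          calc ‖y - c‖ ≤ ‖y - lat k‖ + ‖lat k - c‖ := norm_sub_le_norm_sub_add_norm_sub ..
            _ < r + √d := by linarith [norm_sub_lat_le hy]
      · exact zero_le
  -- The volume formula needs `r + √d > 0`, which could fail for `r = 0` and `d = 0`; the open ball
  -- is then empty anyway.
  rcases hr.eq_or_lt with rfl | hr
  · have h0 : latBall c 0 = ∅ := by ext k; simp [mem_latBall]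
    rw [h0]; simp; positivity
  rw [add_zero, Measure.addHaar_ball_of_pos _ _ (by positivity)] at h1
  have h2 := ENNReal.toReal_mono (by finiteness) h1
  rw [ENNReal.toReal_mul, ENNReal.toReal_ofReal (by positivity)] at h2
  simp only [ENNReal.toReal_natCast, finrank_euclideanSpace, Fintype.card_fin] at h2
  refine h2.trans ?_
  change (r + √d) ^ d * v ≤ _
  have h3 : (r + √d) ^ d ≤ ((1 + √d) * (1 + r)) ^ d := by
    gcongr
    nlinarith [Real.sqrt_nonneg d]
  rw [mul_pow] at h3
  nlinarith [mul_le_mul_of_nonneg_right h3 hv0, pow_nonneg (by linarith : 0 ≤ 1 + r) d]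

/-- At scale `ε`, a ball of radius `R` contains `O(ε^{-d})` lattice points. -/
theorem exists_pow_mul_card_latBall_le (d : ℕ) (R : ℝ) (hR : 0 ≤ R) : ∃ C : ℝ, 0 < C ∧
    ∀ (c : E d) (ε : ℝ), 0 < ε → ε ≤ 1 → ε ^ d * ((latBall c (R / ε)).card : ℝ) ≤ C := by
  obtain ⟨C, hC, h⟩ := exists_card_latBall_le d
  refine ⟨C * (1 + R) ^ d, by positivity, fun c ε hε hε1 => ?_⟩
  calc ε ^ d * ((latBall c (R / ε)).card : ℝ) ≤ ε ^ d * (C * (1 + R / ε) ^ d) := by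
        gcongr; exact h c _ (by positivity)
    _ = C * (ε + R) ^ d := by
        rw [show ε + R = ε * (1 + R / ε) by field_simp, mul_pow]; ring
    _ ≤ C * (1 + R) ^ d := by gcongr

/-! ### The Green function: gradient, singularity, scaling -/

theorem hasFDerivAt_norm_of_ne_zero {x : E d} (hx : x ≠ 0) :
    HasFDerivAt (fun y : E d => ‖y‖) (‖x‖⁻¹ • innerSL ℝ x) x := by
  have h := (hasStrictFDerivAt_norm_sq x).hasFDerivAt.sqrt (by simpa using hx)
  simp only [Real.sqrt_sq (norm_nonneg _)] at h
  refine h.congr_fderiv ?_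
  ext v
  simp
  ring

/-- The factor `1 / (d |B₁|)` of the gradient of the Green function. -/
noncomputable def greenConst (d : ℕ) : ℝ := ((d : ℝ) * volume.real (Metric.ball (0 : E d) 1))⁻¹

theorem volume_real_ball_pos (d : ℕ) {r : ℝ} (hr : 0 < r) :
    0 < volume.real (Metric.ball (0 : E d) r) :=
  ENNReal.toReal_pos (Metric.measure_ball_pos _ _ hr).ne' measure_ball_lt_top.ne

/-- Differentiation merges the logarithmic and the power case into one formula, because `|B₁| = π`
when `d = 2`. -/
theorem hasFDerivAt_green (hd : 2 ≤ d) {x : E d} (hx : x ≠ 0) :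
    HasFDerivAt (green d) ((greenConst d * (‖x‖ ^ d)⁻¹) • innerSL ℝ x) x := by
  have hx' : ‖x‖ ≠ 0 := by simpa using hx
  have hn := hasFDerivAt_norm_of_ne_zero hx
  unfold green
  rcases hd.eq_or_lt with rfl | hd
  · simp only [if_true]
    have h := (hn.log hx').mul_const (2 * Real.pi)⁻¹
    simp only [← div_eq_mul_inv] at h
    refine h.congr_fderiv ?_
    have hv : volume.real (Metric.ball (0 : E 2) 1) = Real.pi := by
      rw [Measure.real, EuclideanSpace.volume_ball_fin_two]
      simp [Real.pi_pos.le]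
    rw [greenConst, hv, smul_smul, smul_smul]
    congr 1
    field_simp
    norm_num
  · have hd2 : d ≠ 2 := by omega
    simp only [hd2, if_false]
    have h := (((hasDerivAt_zpow (2 - (d : ℤ)) ‖x‖ (Or.inl hx')).comp_hasFDerivAt x hn).neg).mul_const
      ((d : ℝ) * ((d : ℝ) - 2) * volume.real (Metric.ball (0 : E d) 1))⁻¹
    refine HasFDerivAt.congr_fderiv h ?_
    rw [smul_smul, ← neg_smul, smul_smul]
    congr 1
    have hv := volume_real_ball_pos d one_pos
    have h3 : (d : ℝ) - 2 ≠ 0 := by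
      rw [sub_ne_zero]; exact_mod_cast hd2
    have h4 : (d : ℝ) ≠ 0 := by
      have : d ≠ 0 := by omega
      exact_mod_cast this
    rw [greenConst, show (2 - (d : ℤ) - 1) = 1 - d by ring, zpow_sub₀ hx', zpow_one, zpow_natCast]
    push_cast
    field_simp
    ring

theorem contDiffAt_green {x : E d} (hx : x ≠ 0) : ContDiffAt ℝ ∞ (green d) x := by
  have hx' : ‖x‖ ≠ 0 := by simpa using hx
  have hn : ContDiffAt ℝ ∞ (fun y : E d => ‖y‖) x := contDiffAt_norm ℝ hx
  unfold green
  split_ifs with h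
  · exact (hn.log hx').div_const _
  · refine ContDiffAt.div_const (ContDiffAt.neg ?_) _
    rcases le_total 0 (2 - (d : ℤ)) with h | h
    · lift 2 - (d : ℤ) to ℕ using h with n
      simpa using hn.pow n
    · obtain ⟨n, hn'⟩ := Int.eq_ofNat_of_zero_le (neg_nonneg.2 h)
      have : 2 - (d : ℤ) = -(n : ℤ) := by omega
      simp only [this, zpow_neg, zpow_natCast]
      exact (hn.pow n).inv (pow_ne_zero _ hx')

/-- The exponent `d - 3/2` is crude but serves both cases: it dominates the logarithm and the power
`2 - d`, and it stays below `d` even after a further division by `‖x‖`. -/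
theorem abs_green_le (hd : 2 ≤ d) : ∃ C : ℝ, ∀ x : E d, x ≠ 0 → ‖x‖ ≤ 1 →
    |green d x| ≤ C * ‖x‖ ^ (-((d : ℝ) - 3 / 2)) := by
  unfold green
  rcases hd.eq_or_lt with rfl | hd
  · refine ⟨2 / (2 * Real.pi), fun x hx hx1 => ?_⟩
    have hp : 0 < ‖x‖ := norm_pos_iff.2 hx
    have h := (Real.abs_log_mul_self_rpow_lt ‖x‖ (1 / 2) hp hx1 (by norm_num)).le
    rw [abs_mul, abs_of_nonneg (Real.rpow_nonneg hp.le _)] at h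
    have h2 : |Real.log ‖x‖| ≤ 2 * ‖x‖ ^ (-(1 / 2) : ℝ) := by
      rw [Real.rpow_neg hp.le, ← div_eq_mul_inv, le_div_iff₀ (by positivity)]
      linarith
    simp only [if_true, Nat.cast_ofNat]
    rw [abs_div, abs_of_pos Real.two_pi_pos, div_mul_eq_mul_div,
      show (-(2 - 3 / 2) : ℝ) = -(1 / 2) by norm_num]
    gcongr
  · have hd2 : d ≠ 2 := by omega
    simp only [hd2, if_false]
    set c := (d : ℝ) * ((d : ℝ) - 2) * volume.real (Metric.ball (0 : E d) 1)
    refine ⟨|c|⁻¹, fun x hx hx1 => ?_⟩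
    have hp : 0 < ‖x‖ := norm_pos_iff.2 hx
    rw [abs_div, abs_neg, abs_of_nonneg (zpow_nonneg hp.le _), div_eq_inv_mul]
    gcongr
    rw [← Real.rpow_intCast]
    refine Real.rpow_le_rpow_of_exponent_ge hp hx1 ?_
    push_cast
    linarith

/-- The additive term `c s` accounts for the logarithm when `d = 2`; it disappears with the first
derivative. -/
theorem green_smul : ∃ c : ℝ → ℝ, ∀ (s : ℝ) (x : E d), 0 < s → x ≠ 0 →
    green d (s • x) = s ^ (2 - (d : ℤ)) * green d x + c s := by
  unfold green
  split_ifs with h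
  · refine ⟨fun s => Real.log s / (2 * Real.pi), fun s x hs hx => ?_⟩
    subst h
    rw [norm_smul, Real.log_mul (by simpa using hs.ne') (by simpa using hx), Real.norm_eq_abs,
      Real.log_abs]
    norm_num
    ring
  · refine ⟨0, fun s x hs hx => ?_⟩
    rw [norm_smul, Real.norm_of_nonneg hs.le, mul_zpow]
    simp
    ring

/-- A function which is continuous off the origin and `O(‖x‖^(-s))`, `s < d`, at the origin is
locally integrable. -/
theorem locallyIntegrable_of_le_rpow {F : Type*} [NormedAddCommGroup F] (hd : 1 ≤ d)
    {h : E d → F} {C s : ℝ} (hs : s < d) (hc : ∀ x, x ≠ 0 → ContinuousAt h x)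
    (hb : ∀ x, x ≠ 0 → ‖x‖ ≤ 1 → ‖h x‖ ≤ C * ‖x‖ ^ (-s)) : LocallyIntegrable h volume := by
  have : Nonempty (Fin d) := ⟨⟨0, hd⟩⟩
  have hcont : ContinuousOn h ({0}ᶜ : Set (E d)) := fun x hx => (hc x hx).continuousWithinAt
  have hmeas : AEStronglyMeasurable h volume := by
    have := hcont.aestronglyMeasurable_of_isSeparable (μ := volume)
      (measurableSet_singleton (0 : E d)).compl (TopologicalSpace.IsSeparable.of_separableSpace _)
    rwa [restrict_compl_singleton] at this
  have h0 : IntegrableOn h (Metric.ball (0 : E d) 1) := by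
    have h1 : IntegrableOn (fun x : E d => C * ‖x‖ ^ (-s)) (Metric.ball (0 : E d) 1) := by
      refine Integrable.const_mul ?_ C
      refine (integrableOn_fun_norm_addHaar volume (f := fun y : ℝ => y ^ (-s))).2 ?_
      -- In polar coordinates the Jacobian raises the exponent to `d - 1 - s`, which exceeds `-1`.
      have h2 : IntegrableOn (fun y : ℝ => y ^ ((d : ℝ) - 1 - s)) (Set.Ioo 0 1) :=
        (intervalIntegral.integrableOn_Ioo_rpow_iff one_pos).2 (by linarith)
      refine h2.congr_fun (fun y hy => ?_) measurableSet_Ioo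
      simp only [finrank_euclideanSpace, Fintype.card_fin, smul_eq_mul]
      rw [← Real.rpow_natCast, ← Real.rpow_add hy.1]
      push_cast [hd]
      ring_nf
    refine Integrable.mono' h1 hmeas.restrict ?_
    have h3 : ∀ᵐ x : E d, x ≠ 0 := by
      simp [ae_iff]
    filter_upwards [ae_restrict_mem measurableSet_ball, ae_restrict_of_ae h3] with x hx hx0
    exact hb x hx0 (by simpa using (mem_ball_zero_iff.1 hx).le)
  intro x
  rcases eq_or_ne x 0 with rfl | hx
  · exact ⟨_, Metric.ball_mem_nhds _ one_pos, h0⟩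
  · exact (hc x hx).integrableAtFilter (hmeas.stronglyMeasurableAtFilter) (Measure.finiteAt_nhds _ _)

/-! ### Integration by parts across the singularity and `ΔG = δ₀` -/

theorem integral_fderiv_eq_zero_of_hasCompactSupport {F : E d → ℝ} (hF : ContDiff ℝ 1 F)
    (hc : HasCompactSupport F) (v : E d) : ∫ x, fderiv ℝ F x v = 0 := by
  have h1 : Continuous fun x => fderiv ℝ F x v :=
    (hF.continuous_fderiv one_ne_zero).clm_apply continuous_const
  have h2 : HasCompactSupport fun x => fderiv ℝ F x v := hc.fderiv_apply (𝕜 := ℝ) v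
  have := integral_mul_fderiv_eq_neg_fderiv_mul_of_integrable (μ := volume) (v := v)
    (f := fun _ : E d => (1 : ℝ)) (g := F) (by simp)
    (by simpa using h1.integrable_of_hasCompactSupport h2)
    (by simpa using hF.continuous.integrable_of_hasCompactSupport hc)
    (fun x _ => differentiableAt_const _) (fun x _ => hF.differentiable one_ne_zero x)
  simpa using this

theorem hasFDerivAt_contDiffBump_smul (b : ContDiffBump (0 : E d)) (n : ℝ) (x : E d) :
    HasFDerivAt (fun y => b (n • y)) (n • fderiv ℝ b (n • x)) x := by
  have h1 : HasFDerivAt b (fderiv ℝ b (n • x)) (n • x) :=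
    (b.contDiff.differentiable (n := 1) one_ne_zero (n • x)).hasFDerivAt
  have h2 : HasFDerivAt (fun y : E d => n • y) (n • ContinuousLinearMap.id ℝ (E d)) x :=
    (hasFDerivAt_id x).const_smul n
  refine (h1.comp x h2).congr_fderiv ?_
  ext v
  simp

/-- Integration by parts against a test function, for a function with an integrable singularity
at the origin. -/
theorem integral_mul_fderiv_eq_neg_of_singular (hd : 1 ≤ d) {h f : E d → ℝ} (v : E d)
    (hs : ∀ x, x ≠ 0 → ContDiffAt ℝ 1 h x) (h0 : LocallyIntegrable h volume)
    (h1 : LocallyIntegrable (fun x => ‖x‖⁻¹ * h x) volume)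
    (h2 : LocallyIntegrable (fun x => fderiv ℝ h x v) volume)
    (hf : ContDiff ℝ 1 f) (hfc : HasCompactSupport f) :
    ∫ x, h x * fderiv ℝ f x v = -∫ x, fderiv ℝ h x v * f x := by
  have : Nonempty (Fin d) := ⟨⟨0, hd⟩⟩
  let b : ContDiffBump (0 : E d) := ⟨1, 2, one_pos, one_lt_two⟩
  have hb1 : ContDiff ℝ 1 b := b.contDiff
  have hbs : HasCompactSupport (fderiv ℝ b) := b.hasCompactSupport.fderiv (𝕜 := ℝ)
  obtain ⟨M, hM⟩ := (hb1.continuous_fderiv one_ne_zero).bounded_above_of_compact_support hbs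
  have hM0 : 0 ≤ M := (norm_nonneg _).trans (hM 0)
  have hfv : Continuous fun x => fderiv ℝ f x v :=
    (hf.continuous_fderiv one_ne_zero).clm_apply continuous_const
  have hfvc : HasCompactSupport fun x => fderiv ℝ f x v := hfc.fderiv_apply (𝕜 := ℝ) v
  have hi1 : Integrable fun x => h x * fderiv ℝ f x v := by
    simpa using h0.integrable_smul_right_of_hasCompactSupport hfv hfvc
  have hi2 : Integrable fun x => fderiv ℝ h x v * f x := by
    simpa using h2.integrable_smul_right_of_hasCompactSupport hf.continuous hfc
  have hi3 : Integrable fun x => (‖x‖⁻¹ * h x) * f x := by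
    simpa using h1.integrable_smul_right_of_hasCompactSupport hf.continuous hfc
  -- The cutoff vanishes near the origin and equals `1` for `‖x‖ ≥ 2 / (n + 1)`. So `η n * (h * f)`
  -- is `C¹` with compact support, its derivative has zero integral, and the identity is the limit
  -- `n → ∞` of this.
  let η : ℕ → E d → ℝ := fun n x => 1 - b ((n + 1 : ℝ) • x)
  let F : ℕ → E d → ℝ := fun n x => η n x * (h x * f x)
  have hη0 : ∀ n : ℕ, ∀ᶠ x in 𝓝 (0 : E d), η n x = 0 := by
    intro n
    have hcont : Tendsto (fun x : E d => (n + 1 : ℝ) • x) (𝓝 0) (𝓝 0) := by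
      have : Continuous fun x : E d => (n + 1 : ℝ) • x := by fun_prop
      simpa using this.tendsto 0
    filter_upwards [hcont.eventually (b.eventuallyEq_one)] with x hx
    simp only [η]
    rw [hx]; simp
  have hηs : ∀ n, ContDiff ℝ 1 (η n) := fun n =>
    contDiff_const.sub (hb1.comp (contDiff_id.const_smul (n + 1 : ℝ)))
  have hF : ∀ n, ContDiff ℝ 1 (F n) := by
    intro n
    rw [contDiff_iff_contDiffAt]
    intro x
    rcases eq_or_ne x 0 with rfl | hx
    · refine (contDiffAt_const (c := (0 : ℝ))).congr_of_eventuallyEq ?_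
      filter_upwards [hη0 n] with x hx
      simp [F, hx]
    · exact (hηs n).contDiffAt.mul ((hs x hx).mul hf.contDiffAt)
  have hFc : ∀ n, HasCompactSupport (F n) := fun n => (hfc.mul_left).mul_left
  have hFd : ∀ n : ℕ, ∀ x, x ≠ 0 → fderiv ℝ (F n) x v =
      η n x * (h x * fderiv ℝ f x v + fderiv ℝ h x v * f x) -
        (n + 1 : ℝ) * fderiv ℝ b ((n + 1 : ℝ) • x) v * (h x * f x) := by
    intro n x hx
    have e1 : HasFDerivAt (η n) (-((n + 1 : ℝ) • fderiv ℝ b ((n + 1 : ℝ) • x))) x := by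
      simpa using (hasFDerivAt_contDiffBump_smul b (n + 1) x).const_sub 1
    have e2 := ((hs x hx).differentiableAt one_ne_zero).hasFDerivAt.mul
      (hf.differentiable one_ne_zero x).hasFDerivAt
    have e3 := (e1.mul e2).fderiv
    change fderiv ℝ (F n) x = _ at e3
    rw [e3]
    simp
    ring
  have hlim : Tendsto (fun n => ∫ x, fderiv ℝ (F n) x v) atTop
      (𝓝 (∫ x, (h x * fderiv ℝ f x v + fderiv ℝ h x v * f x))) := by
    refine tendsto_integral_of_dominated_convergence
      (fun x => ‖h x * fderiv ℝ f x v + fderiv ℝ h x v * f x‖ +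
        2 * (M * ‖v‖) * ‖(‖x‖⁻¹ * h x) * f x‖) ?_ ?_ ?_ ?_
    · intro n
      exact (((hF n).continuous_fderiv one_ne_zero).clm_apply continuous_const).aestronglyMeasurable
    · exact (hi1.add hi2).norm.add (hi3.norm.const_mul _)
    · intro n
      have h3 : ∀ᵐ x : E d, x ≠ 0 := by simp [ae_iff]
      filter_upwards [h3] with x hx
      rw [hFd n x hx]
      have hp : 0 < ‖x‖ := norm_pos_iff.2 hx
      refine (norm_sub_le _ _).trans (add_le_add ?_ ?_)
      · rw [norm_mul]
        refine mul_le_of_le_one_left (norm_nonneg _) ?_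
        rw [Real.norm_eq_abs, abs_le]
        have h4 := b.nonneg (x := (n + 1 : ℝ) • x)
        have h5 := b.le_one (x := (n + 1 : ℝ) • x)
        constructor <;> simp only [η] <;> linarith
      · rw [norm_mul, norm_mul, norm_mul (‖x‖⁻¹ * h x), norm_mul, norm_mul ‖x‖⁻¹, norm_inv,
          norm_norm]
        -- The derivative of the cutoff lives where `(n + 1) ‖x‖ ≤ 2`, so its size `n + 1` is at
        -- most `2 / ‖x‖` there. This is where the local integrability of `‖x‖⁻¹ * h x` enters.
        have h6 : ‖(n + 1 : ℝ)‖ * ‖fderiv ℝ b ((n + 1 : ℝ) • x) v‖ ≤ 2 * (M * ‖v‖) * ‖x‖⁻¹ := by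
          by_cases hx2 : ‖(n + 1 : ℝ) • x‖ ≤ 2
          · have h7 : ‖fderiv ℝ b ((n + 1 : ℝ) • x) v‖ ≤ M * ‖v‖ :=
              (ContinuousLinearMap.le_opNorm _ _).trans (by gcongr; exact hM _)
            rw [norm_smul] at hx2
            rw [← div_eq_mul_inv, le_div_iff₀ hp]
            calc ‖(n + 1 : ℝ)‖ * ‖fderiv ℝ b ((n + 1 : ℝ) • x) v‖ * ‖x‖
                = (‖(n + 1 : ℝ)‖ * ‖x‖) * ‖fderiv ℝ b ((n + 1 : ℝ) • x) v‖ := by ring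
              _ ≤ 2 * (M * ‖v‖) := by gcongr
          · have h8 : fderiv ℝ b ((n + 1 : ℝ) • x) = 0 := by
              refine image_eq_zero_of_notMem_tsupport fun hmem => hx2 ?_
              have h9 := tsupport_fderiv_subset ℝ hmem
              rw [b.tsupport_eq] at h9
              simpa using h9
            rw [h8]; simp; positivity
        calc _ ≤ (2 * (M * ‖v‖) * ‖x‖⁻¹) * (‖h x‖ * ‖f x‖) := by gcongr
          _ = _ := by ring
    · have h3 : ∀ᵐ x : E d, x ≠ 0 := by simp [ae_iff]
      filter_upwards [h3] with x hx
      have hp : 0 < ‖x‖ := norm_pos_iff.2 hx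
      refine tendsto_const_nhds.congr' ?_
      have hev : ∀ᶠ n : ℕ in atTop, 2 / ‖x‖ < (n : ℝ) :=
        (tendsto_natCast_atTop_atTop (R := ℝ)).eventually (eventually_gt_atTop _)
      filter_upwards [hev] with n hn
      rw [hFd n x hx]
      have hgt : 2 < ‖(n + 1 : ℝ) • x‖ := by
        rw [div_lt_iff₀ hp] at hn
        rw [norm_smul, Real.norm_of_nonneg (by positivity)]
        linarith
      have h8 : fderiv ℝ b ((n + 1 : ℝ) • x) = 0 := by
        refine image_eq_zero_of_notMem_tsupport fun hmem => ?_
        have h9 := tsupport_fderiv_subset ℝ hmem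
        rw [b.tsupport_eq] at h9
        have : ‖(n + 1 : ℝ) • x‖ ≤ 2 := by simpa using h9
        linarith
      have h10 : b ((n + 1 : ℝ) • x) = 0 := b.zero_of_le_dist (by simpa using hgt.le)
      simp [h8, η, h10]
  simp only [integral_fderiv_eq_zero_of_hasCompactSupport (hF _) (hFc _)] at hlim
  have := tendsto_nhds_unique hlim tendsto_const_nhds
  rw [integral_add hi1 hi2] at this
  linarith

/-- `∫ x·∇f(x) |x|^{-d} dx = -d |B₁| f(0)`, by integration along rays. -/
theorem integral_inv_pow_mul_fderiv_self (hd : 1 ≤ d) {f : E d → ℝ} (hf : ContDiff ℝ 1 f)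
    (hfc : HasCompactSupport f)
    (hi : Integrable fun x => (‖x‖ ^ d)⁻¹ * fderiv ℝ f x x) :
    ∫ x, (‖x‖ ^ d)⁻¹ * fderiv ℝ f x x =
      -(d * volume.real (Metric.ball (0 : E d) 1)) * f 0 := by
  have : Nonempty (Fin d) := ⟨⟨0, hd⟩⟩
  have hray : ∀ σ : E d, ‖σ‖ = 1 → ∫ r in Set.Ioi (0 : ℝ), fderiv ℝ f (r • σ) σ = - f 0 := by
    intro σ hσ
    have hder : ∀ r : ℝ, HasDerivAt (fun r : ℝ => f (r • σ)) (fderiv ℝ f (r • σ) σ) r := by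
      intro r
      have h1 := (hf.differentiable one_ne_zero (r • σ)).hasFDerivAt
      have h2 : HasDerivAt (fun r : ℝ => r • σ) σ r := by
        simpa using (hasDerivAt_id r).smul_const σ
      exact h1.comp_hasDerivAt r h2
    have hemb : IsClosedEmbedding fun r : ℝ => r • σ := by
      have hiso : Isometry fun r : ℝ => r • σ := by
        refine Isometry.of_dist_eq fun r s => ?_
        rw [dist_eq_norm, ← sub_smul, norm_smul, hσ, mul_one, dist_eq_norm]
      exact hiso.isClosedEmbedding
    have hsupp : HasCompactSupport fun r : ℝ => f (r • σ) := hfc.comp_isClosedEmbedding hemb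
    have hC1 : ContDiff ℝ 1 fun r : ℝ => f (r • σ) := hf.comp (contDiff_id.smul contDiff_const)
    have := hsupp.integral_Ioi_deriv_eq hC1 0
    simp only [(hder _).deriv] at this
    simpa using this
  set G : E d → ℝ := fun x => (‖x‖ ^ d)⁻¹ * fderiv ℝ f x x with hG
  let e := homeomorphUnitSphereProd (E d)
  have hmp := (volume : Measure (E d)).measurePreserving_homeomorphUnitSphereProd
  let H : Metric.sphere (0 : E d) 1 × Set.Ioi (0 : ℝ) → ℝ := fun p => G (p.2.1 • p.1.1)
  have hHe : ∀ x, H (e x) = G x.1 := by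
    intro x
    have hx : ‖x.1‖ ≠ 0 := norm_ne_zero_iff.2 x.2
    simp [H, e, smul_smul, hx]
  have hcomap : ∫ x, G x = ∫ x : ({(0 : E d)}ᶜ : Set (E d)), G x ∂(volume.comap Subtype.val) := by
    rw [integral_subtype_comap (measurableSet_singleton _).compl G, restrict_compl_singleton]
  have hGi : Integrable H ((volume : Measure (E d)).toSphere.prod
      (.volumeIoiPow (Module.finrank ℝ (E d) - 1))) := by
    rw [← hmp.integrable_comp_emb (Homeomorph.measurableEmbedding _)]
    have h3 : Integrable (fun x : ({(0 : E d)}ᶜ : Set (E d)) => G x) (volume.comap Subtype.val) := by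
      have := (integrableOn_iff_comap_subtypeVal (f := G) (μ := volume)
        (measurableSet_singleton (0 : E d)).compl).1 hi.integrableOn
      exact this
    refine h3.congr (Eventually.of_forall fun x => ?_)
    exact (hHe x).symm
  have hstep : ∫ x, G x = ∫ σ : Metric.sphere (0 : E d) 1,
      (∫ r : Set.Ioi (0 : ℝ), H (σ, r) ∂(.volumeIoiPow (Module.finrank ℝ (E d) - 1)))
        ∂(volume : Measure (E d)).toSphere := by
    rw [hcomap, ← integral_prod _ hGi, ← hmp.integral_comp (Homeomorph.measurableEmbedding _)]
    exact integral_congr_ae (Eventually.of_forall fun x => (hHe x).symm)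
  -- On the ray through `σ`, the Jacobian `r^(d-1)` and the factor `r` from the argument `x = r σ`
  -- of the derivative cancel `‖x‖^(-d)`. What remains is the integral of a derivative; the sphere
  -- then contributes its mass `d |B₁|`.
  have hinner : ∀ σ : Metric.sphere (0 : E d) 1,
      ∫ r : Set.Ioi (0 : ℝ), H (σ, r) ∂(.volumeIoiPow (Module.finrank ℝ (E d) - 1)) = - f 0 := by
    intro σ
    have hσ : ‖σ.1‖ = 1 := by simp
    rw [← hray σ.1 hσ]
    simp only [Measure.volumeIoiPow, ENNReal.ofReal]
    rw [integral_withDensity_eq_integral_smul,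
      integral_subtype_comap measurableSet_Ioi
        fun a => Real.toNNReal (a ^ (Module.finrank ℝ (E d) - 1)) • G (a • σ.1),
      setIntegral_congr_fun measurableSet_Ioi fun r hr => ?_]
    · have hr0 : (0 : ℝ) < r := hr
      simp only [hG]
      rw [NNReal.smul_def, Real.coe_toNNReal _ (pow_nonneg hr0.le _), norm_smul, hσ, mul_one,
        Real.norm_of_nonneg hr0.le, map_smul, smul_eq_mul, smul_eq_mul, finrank_euclideanSpace,
        Fintype.card_fin]
      have : r ^ d = r ^ (d - 1) * r := by rw [← pow_succ, Nat.sub_add_cancel hd]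
      rw [this]
      field_simp
    · exact (measurable_subtype_coe.pow_const _).real_toNNReal
  rw [hstep, integral_congr_ae (Eventually.of_forall hinner), integral_const,
    Measure.toSphere_real_apply_univ, finrank_euclideanSpace, Fintype.card_fin, smul_eq_mul]
  ring

/-- The directional derivative `∂_v g`. -/
noncomputable def dirDeriv (v : E d) (g : E d → ℝ) : E d → ℝ := fun x => fderiv ℝ g x v

theorem contDiff_dirDeriv {g : E d → ℝ} (hg : ContDiff ℝ ∞ g) (v : E d) :
    ContDiff ℝ ∞ (dirDeriv v g) :=
  (hg.fderiv_right (m := ∞) le_rfl).clm_apply contDiff_const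

theorem hasCompactSupport_dirDeriv {g : E d → ℝ} (hg : HasCompactSupport g) (v : E d) :
    HasCompactSupport (dirDeriv v g) :=
  hg.fderiv_apply (𝕜 := ℝ) v

theorem hess_eq_dirDeriv {g : E d → ℝ} (hg : ContDiff ℝ ∞ g) (x v w : E d) :
    hess g x v w = dirDeriv v (dirDeriv w g) x := by
  have h1 : DifferentiableAt ℝ (fderiv ℝ g) x :=
    ((hg.fderiv_right (m := 1) (by norm_cast)).differentiable one_ne_zero) x
  rw [hess, iteratedFDeriv_two_apply]
  have h2 : fderiv ℝ (dirDeriv w g) x = _ := fderiv_clm_apply h1 (differentiableAt_const w)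
  simp [dirDeriv, h2]

theorem laplacian_eq_sum_dirDeriv {g : E d → ℝ} (hg : ContDiff ℝ ∞ g) (x : E d) :
    Δ g x = ∑ i : Fin d, dirDeriv (EuclideanSpace.single i 1)
      (dirDeriv (EuclideanSpace.single i 1) g) x := by
  rw [InnerProductSpace.laplacian_eq_iteratedFDeriv_orthonormalBasis g
    (EuclideanSpace.basisFun (Fin d) ℝ)]
  simp only [EuclideanSpace.basisFun_apply]
  exact Finset.sum_congr rfl fun i _ => hess_eq_dirDeriv hg x _ _

theorem fderiv_green_apply (hd : 2 ≤ d) {x : E d} (hx : x ≠ 0) (v : E d) :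
    fderiv ℝ (green d) x v = greenConst d * (‖x‖ ^ d)⁻¹ * inner ℝ x v := by
  rw [(hasFDerivAt_green hd hx).fderiv]; simp

theorem continuousAt_fderiv_green {x : E d} (hx : x ≠ 0) :
    ContinuousAt (fderiv ℝ (green d)) x :=
  ((contDiffAt_green hx).fderiv_right (m := 0) (by norm_cast)).continuousAt

theorem locallyIntegrable_green (hd : 2 ≤ d) : LocallyIntegrable (green d) volume := by
  obtain ⟨C, hC⟩ := abs_green_le hd
  exact locallyIntegrable_of_le_rpow (by omega) (by linarith)
    (fun x hx => (contDiffAt_green hx).continuousAt) hC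

/-- Required by the cutoff argument: division by `‖x‖` raises the exponent from `d - 3/2` to `d -
1/2`, still below `d`. -/
theorem locallyIntegrable_inv_norm_mul_green (hd : 2 ≤ d) :
    LocallyIntegrable (fun x => ‖x‖⁻¹ * green d x) volume := by
  obtain ⟨C, hC⟩ := abs_green_le hd
  refine locallyIntegrable_of_le_rpow (C := C) (s := d - 1 / 2) (by omega) (by linarith)
    (fun x hx => ?_) fun x hx hx1 => ?_
  · exact (continuous_norm.continuousAt.inv₀ (norm_ne_zero_iff.2 hx)).mul
      (contDiffAt_green hx).continuousAt
  · have hp : 0 < ‖x‖ := norm_pos_iff.2 hx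
    rw [norm_mul, norm_inv, norm_norm]
    calc ‖x‖⁻¹ * ‖green d x‖ ≤ ‖x‖⁻¹ * (C * ‖x‖ ^ (-((d : ℝ) - 3 / 2))) := by
          gcongr; exact hC x hx hx1
      _ = C * ‖x‖ ^ (-((d : ℝ) - 1 / 2)) := by
          rw [← Real.rpow_neg_one, mul_left_comm, ← Real.rpow_add hp]
          ring_nf

theorem locallyIntegrable_fderiv_green (hd : 2 ≤ d) (v : E d) :
    LocallyIntegrable (fun x => fderiv ℝ (green d) x v) volume := by
  refine locallyIntegrable_of_le_rpow (C := greenConst d * ‖v‖) (s := d - 1) (by omega)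
    (by linarith) (fun x hx => (continuousAt_fderiv_green hx).clm_apply continuousAt_const)
    fun x hx hx1 => ?_
  have hp : 0 < ‖x‖ := norm_pos_iff.2 hx
  have hg : 0 ≤ greenConst d := by unfold greenConst; positivity
  rw [fderiv_green_apply hd hx, norm_mul, norm_mul, norm_inv, norm_pow, norm_norm,
    Real.norm_of_nonneg hg]
  calc greenConst d * (‖x‖ ^ d)⁻¹ * ‖inner ℝ x v‖
      ≤ greenConst d * (‖x‖ ^ d)⁻¹ * (‖x‖ * ‖v‖) := by gcongr; exact norm_inner_le_norm x v
    _ = greenConst d * ‖v‖ * ‖x‖ ^ (-((d : ℝ) - 1)) := by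
        rw [neg_sub, Real.rpow_sub hp, Real.rpow_one, Real.rpow_natCast]
        ring

theorem integral_green_mul_dirDeriv (hd : 2 ≤ d) {f : E d → ℝ} (hf : ContDiff ℝ ∞ f)
    (hfc : HasCompactSupport f) (v : E d) :
    ∫ x, green d x * dirDeriv v f x = -∫ x, fderiv ℝ (green d) x v * f x :=
  integral_mul_fderiv_eq_neg_of_singular (by omega) v
    (fun x hx => (contDiffAt_green hx).of_le (by norm_cast))
    (locallyIntegrable_green hd)
    (locallyIntegrable_inv_norm_mul_green hd) (locallyIntegrable_fderiv_green hd v)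
    (hf.of_le (by norm_cast)) hfc

theorem integrable_green_mul (hd : 2 ≤ d) {f : E d → ℝ} (hf : Continuous f)
    (hfc : HasCompactSupport f) : Integrable fun x => green d x * f x := by
  simpa using (locallyIntegrable_green hd).integrable_smul_right_of_hasCompactSupport hf hfc

/-- `ΔG = δ₀` in the sense of distributions. -/
theorem integral_green_mul_laplacian (hd : 2 ≤ d) {f : E d → ℝ} (hf : ContDiff ℝ ∞ f)
    (hfc : HasCompactSupport f) : ∫ x, green d x * Δ f x = f 0 := by
  have : Nonempty (Fin d) := ⟨⟨0, by omega⟩⟩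
  let e : Fin d → E d := fun i => EuclideanSpace.single i 1
  have hK : ∀ i, Integrable fun x => fderiv ℝ (green d) x (e i) * dirDeriv (e i) f x := fun i => by
    simpa using (locallyIntegrable_fderiv_green hd (e i)).integrable_smul_right_of_hasCompactSupport
      (contDiff_dirDeriv hf (e i)).continuous (hasCompactSupport_dirDeriv hfc (e i))
  -- `∇G` is radial, so `∇G · ∇f` involves only the radial derivative of `f`, and the integral along
  -- rays applies.
  have hsum : ∀ᵐ x : E d, ∑ i, fderiv ℝ (green d) x (e i) * dirDeriv (e i) f x =
      greenConst d * ((‖x‖ ^ d)⁻¹ * fderiv ℝ f x x) := by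
    have h3 : ∀ᵐ x : E d, x ≠ 0 := by simp [ae_iff]
    filter_upwards [h3] with x hx
    have hx2 : fderiv ℝ f x x = ∑ i, x i * dirDeriv (e i) f x := by
      have h4 : x = ∑ i, x i • e i := by
        conv_lhs => rw [← (EuclideanSpace.basisFun (Fin d) ℝ).sum_repr x]
        simp [e]
      conv_lhs => rw [h4, map_sum]
      rw [← h4]
      simp [dirDeriv]
    rw [hx2, Finset.mul_sum, Finset.mul_sum]
    refine Finset.sum_congr rfl fun i _ => ?_
    rw [fderiv_green_apply hd hx]
    simp [e, EuclideanSpace.inner_single_right]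
    ring
  have hc : greenConst d ≠ 0 := by
    have := volume_real_ball_pos d one_pos
    have h5 : (d : ℝ) ≠ 0 := by
      have : d ≠ 0 := by omega
      exact_mod_cast this
    unfold greenConst
    positivity
  have hint : Integrable fun x => (‖x‖ ^ d)⁻¹ * fderiv ℝ f x x := by
    have h6 : Integrable fun x => greenConst d * ((‖x‖ ^ d)⁻¹ * fderiv ℝ f x x) :=
      (integrable_finsetSum Finset.univ fun i _ => hK i).congr hsum
    simpa [hc] using h6.const_mul (greenConst d)⁻¹
  calc ∫ x, green d x * Δ f x
      = ∫ x, ∑ i, green d x * dirDeriv (e i) (dirDeriv (e i) f) x := by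
        simp only [laplacian_eq_sum_dirDeriv hf, Finset.mul_sum, e]
    _ = ∑ i, ∫ x, green d x * dirDeriv (e i) (dirDeriv (e i) f) x := by
        refine integral_finsetSum _ fun i _ => integrable_green_mul hd ?_ ?_
        · exact (contDiff_dirDeriv (contDiff_dirDeriv hf _) _).continuous
        · exact hasCompactSupport_dirDeriv (hasCompactSupport_dirDeriv hfc _) _
    _ = -∑ i, ∫ x, fderiv ℝ (green d) x (e i) * dirDeriv (e i) f x := by
        rw [← Finset.sum_neg_distrib]
        exact Finset.sum_congr rfl fun i _ => integral_green_mul_dirDeriv hd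
          (contDiff_dirDeriv hf _) (hasCompactSupport_dirDeriv hfc _) _
    _ = -∫ x, greenConst d * ((‖x‖ ^ d)⁻¹ * fderiv ℝ f x x) := by
        rw [← integral_finsetSum _ fun i _ => hK i, integral_congr_ae hsum]
    _ = f 0 := by
        rw [integral_const_mul, integral_inv_pow_mul_fderiv_self (by omega)
          (hf.of_le (by norm_cast)) hfc hint]
        rw [← mul_assoc, mul_neg, greenConst, inv_mul_cancel₀]
        · ring
        · rw [greenConst] at hc
          exact fun h => hc (by rw [h, inv_zero])

/-- This is what allows constants to be subtracted from the potentials without changing the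
equation. -/
theorem integral_laplacian_eq_zero {f : E d → ℝ} (hf : ContDiff ℝ ∞ f)
    (hfc : HasCompactSupport f) : ∫ x, Δ f x = 0 := by
  simp only [laplacian_eq_sum_dirDeriv hf]
  rw [integral_finsetSum]
  · refine Finset.sum_eq_zero fun i _ => ?_
    exact integral_fderiv_eq_zero_of_hasCompactSupport
      ((contDiff_dirDeriv hf _).of_le (by norm_cast))
      (hasCompactSupport_dirDeriv hfc _) _
  · intro i _
    exact (contDiff_dirDeriv (contDiff_dirDeriv hf _) _).continuous.integrable_of_hasCompactSupport
      (hasCompactSupport_dirDeriv (hasCompactSupport_dirDeriv hfc _) _)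

theorem continuous_laplacian {f : E d → ℝ} (hf : ContDiff ℝ ∞ f) : Continuous (Δ f) := by
  rw [funext (laplacian_eq_sum_dirDeriv hf)]
  exact continuous_finsetSum _ fun i _ =>
    (contDiff_dirDeriv (contDiff_dirDeriv hf _) _).continuous

theorem hasCompactSupport_laplacian {f : E d → ℝ} (hf : ContDiff ℝ ∞ f)
    (hfc : HasCompactSupport f) : HasCompactSupport (Δ f) := by
  refine hfc.mono' fun x hx => ?_
  by_contra hxs
  refine hx ?_
  rw [laplacian_eq_sum_dirDeriv hf]
  refine Finset.sum_eq_zero fun i _ => ?_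
  refine image_eq_zero_of_notMem_tsupport fun h => hxs ?_
  exact (tsupport_fderiv_apply_subset ℝ _).trans (tsupport_fderiv_apply_subset ℝ _) h

/-! ### Decay of convolutions with homogeneous kernels -/

theorem exists_tsupport_subset_closedBall {g : E d → ℝ} (hg : HasCompactSupport g) :
    ∃ ρ : ℝ, 0 < ρ ∧ tsupport g ⊆ Metric.closedBall 0 ρ := by
  obtain ⟨ρ, hρ⟩ := hg.isCompact.isBounded.subset_closedBall 0
  exact ⟨max ρ 1, by positivity, hρ.trans (Metric.closedBall_subset_closedBall (le_max_left _ _))⟩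

theorem tsupport_dirDeriv_subset (v : E d) (g : E d → ℝ) : tsupport (dirDeriv v g) ⊆ tsupport g :=
  tsupport_fderiv_apply_subset ℝ v

theorem hasCompactSupport_comp_sub_left {g : E d → ℝ} (hg : HasCompactSupport g) (x : E d) :
    HasCompactSupport fun y => g (x - y) :=
  hg.comp_homeomorph (Homeomorph.subLeft x)

theorem eventually_comp_sub_eq_zero {g : E d → ℝ} {x : E d} (hx : x ∉ tsupport g) :
    ∀ᶠ y in 𝓝 (0 : E d), g (x - y) = 0 := by
  have h1 : ∀ᶠ z in 𝓝 x, g z = 0 :=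
    notMem_tsupport_iff_eventuallyEq.1 hx
  have h2 : Tendsto (fun y : E d => x - y) (𝓝 0) (𝓝 x) := by
    have : Continuous fun y : E d => x - y := by fun_prop
    simpa using this.tendsto 0
  exact h2.eventually h1

/-- With `x` off the support of `g`, the factor `g (x - ·)` vanishes near the origin and removes any
singularity of `H`, however strong. -/
theorem integrable_mul_comp_sub {H g : E d → ℝ} (hH : ∀ y, y ≠ 0 → ContinuousAt H y)
    (hg : Continuous g) (hgc : HasCompactSupport g) {x : E d} (hx : x ∉ tsupport g) :
    Integrable fun y => H y * g (x - y) := by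
  refine Continuous.integrable_of_hasCompactSupport ?_
    (hasCompactSupport_comp_sub_left hgc x).mul_left
  rw [continuous_iff_continuousAt]
  intro y
  rcases eq_or_ne y 0 with rfl | hy
  · refine (continuousAt_const (y := (0 : ℝ))).congr ?_
    filter_upwards [eventually_comp_sub_eq_zero hx] with y hy
    simp [hy]
  · exact (hH y hy).mul (by fun_prop)

/-- Integration by parts in a convolution, away from the singularity. -/
theorem integral_mul_dirDeriv_comp_sub {H g : E d → ℝ} (hH : ∀ y, y ≠ 0 → ContDiffAt ℝ 1 H y)
    (hg : ContDiff ℝ 1 g) (hgc : HasCompactSupport g) {x : E d} (hx : x ∉ tsupport g) (v : E d) :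
    ∫ y, H y * dirDeriv v g (x - y) = ∫ y, dirDeriv v H y * g (x - y) := by
  set F : E d → ℝ := fun y => H y * g (x - y) with hFdef
  have hF0 : ∀ᶠ y in 𝓝 (0 : E d), F y = 0 := by
    filter_upwards [eventually_comp_sub_eq_zero hx] with y hy
    simp [F, hy]
  have hF : ContDiff ℝ 1 F := by
    rw [contDiff_iff_contDiffAt]
    intro y
    rcases eq_or_ne y 0 with rfl | hy
    · exact (contDiffAt_const (c := (0 : ℝ))).congr_of_eventuallyEq hF0
    · exact (hH y hy).mul (hg.comp (contDiff_const.sub contDiff_id)).contDiffAt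
  have hFc : HasCompactSupport F := (hasCompactSupport_comp_sub_left hgc x).mul_left
  have hx' : x ∉ tsupport (dirDeriv v g) := fun h => hx (tsupport_dirDeriv_subset v g h)
  have hder : ∀ y, fderiv ℝ F y v = dirDeriv v H y * g (x - y) - H y * dirDeriv v g (x - y) := by
    intro y
    rcases eq_or_ne y 0 with rfl | hy
    · have h1 : F =ᶠ[𝓝 0] fun _ => (0 : ℝ) := hF0
      rw [h1.fderiv_eq]
      simp [image_eq_zero_of_notMem_tsupport hx, image_eq_zero_of_notMem_tsupport hx']
    · have e1 : HasFDerivAt (fun y => g (x - y)) (-fderiv ℝ g (x - y)) y := by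
        have := (hg.differentiable one_ne_zero (x - y)).hasFDerivAt.comp y
          ((hasFDerivAt_id y).const_sub x)
        refine this.congr_fderiv ?_
        ext; simp
      have e2 := (((hH y hy).differentiableAt one_ne_zero).hasFDerivAt.mul e1).fderiv
      change fderiv ℝ F y = _ at e2
      rw [e2]
      simp [dirDeriv]
      ring
  have h0 := integral_fderiv_eq_zero_of_hasCompactSupport hF hFc v
  simp only [hder] at h0
  rw [integral_sub] at h0
  · linarith
  · refine integrable_mul_comp_sub (fun y hy => ?_) hg.continuous hgc hx
    exact (((hH y hy).fderiv_right (m := 0) (by norm_cast)).continuousAt).clm_apply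
      continuousAt_const
  · refine integrable_mul_comp_sub (fun y hy => (hH y hy).continuousAt) ?_
      (hasCompactSupport_dirDeriv hgc v) hx'
    exact (hg.continuous_fderiv one_ne_zero).clm_apply continuous_const

/-- Both sides of the scaling relation are differentiated in `x`. The term `c s` drops out, so that
the logarithm is covered too. -/
theorem dirDeriv_smul_of_homogeneous {H : E d → ℝ} {m : ℤ} {c : ℝ → ℝ}
    (hH : ∀ (s : ℝ) (x : E d), 0 < s → x ≠ 0 → H (s • x) = s ^ m * H x + c s)
    (hd : ∀ x, x ≠ 0 → DifferentiableAt ℝ H x) (v : E d) (s : ℝ) (x : E d) (hs : 0 < s)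
    (hx : x ≠ 0) : dirDeriv v H (s • x) = s ^ (m - 1) * dirDeriv v H x := by
  have hsx : s • x ≠ 0 := smul_ne_zero hs.ne' hx
  have h1 : HasFDerivAt (fun y => H (s • y)) (s • fderiv ℝ H (s • x)) x := by
    refine ((hd _ hsx).hasFDerivAt.comp x ((hasFDerivAt_id x).const_smul s)).congr_fderiv ?_
    ext; simp
  have h2 : HasFDerivAt (fun y => H (s • y)) (s ^ m • fderiv ℝ H x) x := by
    refine (((hd x hx).hasFDerivAt.const_mul (s ^ m)).add_const (c s)).congr_of_eventuallyEq ?_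
    filter_upwards [isOpen_ne.mem_nhds hx] with y hy
    exact hH s y hs hy
  have h3 := congrArg (fun L => L v) (h1.unique h2)
  simp only [smul_apply, smul_eq_mul] at h3
  simp only [dirDeriv]
  rw [zpow_sub_one₀ hs.ne', mul_right_comm, ← h3]
  field_simp

/-- Compactness gives the bound on the unit sphere, and scaling carries it to every other point. -/
theorem exists_abs_le_of_homogeneous {H : E d → ℝ} {m : ℤ}
    (hH : ∀ (s : ℝ) (x : E d), 0 < s → x ≠ 0 → H (s • x) = s ^ m * H x)
    (hc : ∀ x, x ≠ 0 → ContinuousAt H x) : ∃ C : ℝ, 0 ≤ C ∧ ∀ x, x ≠ 0 → |H x| ≤ C * ‖x‖ ^ m := by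
  have hc' : ContinuousOn H (Metric.sphere (0 : E d) 1) := fun x hx =>
    (hc x (by rintro rfl; simp at hx)).continuousWithinAt
  obtain ⟨C, hC⟩ := (isCompact_sphere (0 : E d) 1).exists_bound_of_continuousOn hc'
  refine ⟨max C 0, le_max_right _ _, fun x hx => ?_⟩
  have hp : 0 < ‖x‖ := norm_pos_iff.2 hx
  have h1 : x = ‖x‖ • (‖x‖⁻¹ • x) := by rw [smul_smul, mul_inv_cancel₀ hp.ne', one_smul]
  have h2 : ‖x‖⁻¹ • x ≠ 0 := smul_ne_zero (inv_ne_zero hp.ne') hx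
  have h3 : |H (‖x‖⁻¹ • x)| ≤ max C 0 := by
    refine (hC _ ?_).trans (le_max_left _ _)
    simp [norm_smul, hp.ne']
  conv_lhs => rw [h1, hH _ _ hp h2, abs_mul, abs_of_nonneg (zpow_nonneg hp.le m)]
  rw [mul_comm]
  gcongr

/-- Convolution of a function of homogeneity `-n` with a compactly supported one decays like
`‖x‖^{-n}`. -/
theorem exists_abs_integral_mul_comp_sub_le {H g : E d → ℝ} {n : ℕ} {C : ℝ}
    (hC : 0 ≤ C) (hH : ∀ x, x ≠ 0 → |H x| ≤ C * ‖x‖ ^ (-(n : ℤ)))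
    (hg : Continuous g) (hgc : HasCompactSupport g) :
    ∃ R C' : ℝ, ∀ x, R ≤ ‖x‖ → x ∉ tsupport g ∧ |∫ y, H y * g (x - y)| ≤ C' * wt n x := by
  obtain ⟨ρ, hρ, hs⟩ := exists_tsupport_subset_closedBall hgc
  -- For `‖x‖ ≥ 2ρ + 1` and `‖x - y‖ ≤ ρ` one has `‖y‖ ≥ ‖x‖ - ρ ≥ (1 + ‖x‖) / 4`; hence the factor
  -- `4 ^ n`.
  refine ⟨2 * ρ + 1, C * 4 ^ n * ∫ y, ‖g y‖, fun x hx => ⟨fun h => ?_, ?_⟩⟩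
  · have := mem_closedBall_zero_iff.1 (hs h)
    linarith
  have hgi : Integrable fun y => ‖g y‖ := (hg.integrable_of_hasCompactSupport hgc).norm
  have hle : ∀ y, ‖H y * g (x - y)‖ ≤ (C * 4 ^ n * wt n x) * ‖g (x - y)‖ := by
    intro y
    rw [norm_mul]
    by_cases h0 : g (x - y) = 0
    · simp [h0]
    gcongr
    have h1 : ‖x - y‖ ≤ ρ := by
      simpa using mem_closedBall_zero_iff.1 (hs (subset_tsupport g h0))
    have h2 : (1 + ‖x‖) / 4 ≤ ‖y‖ := by
      have := norm_sub_norm_le x y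
      linarith
    have hxp : 0 < (1 + ‖x‖) / 4 := by positivity
    have hy : y ≠ 0 := by
      rintro rfl
      simp at h2
      linarith
    refine (hH y hy).trans ?_
    rw [mul_assoc]
    gcongr
    unfold wt
    rw [zpow_neg, zpow_natCast, Real.rpow_neg (by positivity), Real.rpow_natCast]
    calc (‖y‖ ^ n)⁻¹ ≤ (((1 + ‖x‖) / 4) ^ n)⁻¹ := by gcongr
      _ = 4 ^ n * ((1 + ‖x‖) ^ n)⁻¹ := by rw [div_pow]; field_simp
  calc |∫ y, H y * g (x - y)| ≤ ∫ y, (C * 4 ^ n * wt n x) * ‖g (x - y)‖ :=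
        norm_integral_le_of_norm_le ((hgi.comp_sub_left x).const_mul _)
          (Eventually.of_forall hle)
    _ = C * 4 ^ n * (∫ y, ‖g y‖) * wt n x := by
        rw [integral_const_mul, integral_sub_left_eq_self (fun y => ‖g y‖) volume x]
        ring

/-- On the ball of radius `R` a continuous function is bounded and the weight is bounded below, so
only the behaviour at infinity matters. -/
theorem exists_le_wt_of_continuous {F : Type*} [NormedAddCommGroup F] {w : E d → F}
    (hw : Continuous w) {s R C : ℝ} (hs : 0 ≤ s)
    (h : ∀ x, R ≤ ‖x‖ → ‖w x‖ ≤ C * wt s x) : ∃ C', 0 < C' ∧ ∀ x, ‖w x‖ ≤ C' * wt s x := by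
  obtain ⟨M, hM⟩ := (isCompact_closedBall (0 : E d) R).exists_bound_of_continuousOn hw.continuousOn
  refine ⟨max C (|M| * (1 + |R|) ^ s) + 1, ?_, fun x => ?_⟩
  · have : 0 ≤ |M| * (1 + |R|) ^ s := by positivity
    linarith [le_max_right C (|M| * (1 + |R|) ^ s)]
  have hp := wt_pos s x
  rcases le_total R ‖x‖ with hR | hR
  · refine (h x hR).trans ?_
    gcongr
    linarith [le_max_left C (|M| * (1 + |R|) ^ s)]
  · have h1 : 1 ≤ (1 + |R|) ^ s * wt s x := by
      have := wt_le_of_le_mul (d := d) hs (c := 1 + |R|) (by positivity) (x := 0) (y := x)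
        (by simp only [norm_zero]; linarith [le_abs_self R])
      simpa [wt] using this
    calc ‖w x‖ ≤ M := hM x (by simpa using hR)
      _ ≤ |M| * 1 := by rw [mul_one]; exact le_abs_self M
      _ ≤ |M| * ((1 + |R|) ^ s * wt s x) := by gcongr
      _ = (|M| * (1 + |R|) ^ s) * wt s x := by ring
      _ ≤ _ := by
        gcongr
        linarith [le_max_right C (|M| * (1 + |R|) ^ s)]

/-! ### Decay of the potentials `u_{i,j}` and of their gradients -/

/-- The `i`-th coordinate vector. -/
noncomputable abbrev coordVec (i : Fin d) : E d := EuclideanSpace.single i 1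

theorem partial₂_eq_dirDeriv {φ : E d → ℝ} (hφ : ContDiff ℝ ∞ φ) (i j : Fin d) :
    partial₂ φ i j = dirDeriv (coordVec i) (dirDeriv (coordVec j) φ) :=
  funext fun x => hess_eq_dirDeriv hφ x _ _

theorem contDiff_partial₂ {φ : E d → ℝ} (hφ : ContDiff ℝ ∞ φ) (i j : Fin d) :
    ContDiff ℝ ∞ (partial₂ φ i j) := by
  rw [partial₂_eq_dirDeriv hφ]
  exact contDiff_dirDeriv (contDiff_dirDeriv hφ _) _

theorem hasCompactSupport_partial₂ {φ : E d → ℝ} (hφ : ContDiff ℝ ∞ φ) (hφc : HasCompactSupport φ)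
    (i j : Fin d) : HasCompactSupport (partial₂ φ i j) := by
  rw [partial₂_eq_dirDeriv hφ]
  exact hasCompactSupport_dirDeriv (hasCompactSupport_dirDeriv hφc _) _

theorem uPot_apply (φ : E d → ℝ) (i j : Fin d) (x : E d) :
    uPot φ i j x = ∫ y, green d y * partial₂ φ i j (x - y) := rfl

theorem contDiff_uPot (hd : 2 ≤ d) {φ : E d → ℝ} (hφ : ContDiff ℝ ∞ φ)
    (hφc : HasCompactSupport φ) (i j : Fin d) : ContDiff ℝ 1 (uPot φ i j) :=
  (hasCompactSupport_partial₂ hφ hφc i j).contDiff_convolution_right _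
    (locallyIntegrable_green hd) ((contDiff_partial₂ hφ i j).of_le (by norm_cast))

theorem dirDeriv_uPot (hd : 2 ≤ d) {φ : E d → ℝ} (hφ : ContDiff ℝ ∞ φ)
    (hφc : HasCompactSupport φ) (i j : Fin d) (v x : E d) :
    dirDeriv v (uPot φ i j) x = ∫ y, green d y * dirDeriv v (partial₂ φ i j) (x - y) := by
  have hc := hasCompactSupport_partial₂ hφ hφc i j
  have h1 : ContDiff ℝ 1 (partial₂ φ i j) := (contDiff_partial₂ hφ i j).of_le (by norm_cast)
  have h := (hc.hasFDerivAt_convolution_right (ContinuousLinearMap.mul ℝ ℝ)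
    (locallyIntegrable_green hd) h1 x).fderiv
  change fderiv ℝ (uPot φ i j) x = _ at h
  rw [dirDeriv, h, convolution_precompR_apply _ (locallyIntegrable_green hd)
    (hc.fderiv (𝕜 := ℝ)) (h1.continuous_fderiv one_ne_zero)]
  rfl

/-- Differentiable off the origin to all orders, and homogeneous of degree `m`. -/
structure IsHomogeneousKernel (H : E d → ℝ) (m : ℤ) : Prop where
  contDiffAt : ∀ x, x ≠ 0 → ContDiffAt ℝ ∞ H x
  smul : ∀ (s : ℝ) (x : E d), 0 < s → x ≠ 0 → H (s • x) = s ^ m * H x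

theorem contDiffAt_dirDeriv {H : E d → ℝ} {x : E d} (h : ContDiffAt ℝ ∞ H x) (v : E d) :
    ContDiffAt ℝ ∞ (dirDeriv v H) x :=
  (h.fderiv_right (m := ∞) le_rfl).clm_apply contDiffAt_const

theorem IsHomogeneousKernel.dirDeriv {H : E d → ℝ} {m : ℤ} (h : IsHomogeneousKernel H m)
    (v : E d) : IsHomogeneousKernel (dirDeriv v H) (m - 1) where
  contDiffAt x hx := contDiffAt_dirDeriv (h.contDiffAt x hx) v
  smul s x hs hx := dirDeriv_smul_of_homogeneous (c := 0)
    (fun s x hs hx => by simpa using h.smul s x hs hx)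
    (fun x hx => (h.contDiffAt x hx).differentiableAt (by simp)) v s x hs hx

theorem isHomogeneousKernel_dirDeriv_green (v : E d) :
    IsHomogeneousKernel (dirDeriv v (green d)) (1 - d) where
  contDiffAt x hx := contDiffAt_dirDeriv (contDiffAt_green hx) v
  smul s x hs hx := by
    obtain ⟨c, hc⟩ := green_smul (d := d)
    have := dirDeriv_smul_of_homogeneous hc
      (fun x hx => (contDiffAt_green hx).differentiableAt (by simp)) v s x hs hx
    rwa [show 2 - (d : ℤ) - 1 = 1 - d by ring] at this

theorem IsHomogeneousKernel.exists_abs_integral_le {H g : E d → ℝ} {n : ℕ}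
    (h : IsHomogeneousKernel H (-(n : ℤ))) (hg : Continuous g) (hgc : HasCompactSupport g) :
    ∃ R C' : ℝ, ∀ x, R ≤ ‖x‖ → x ∉ tsupport g ∧ |∫ y, H y * g (x - y)| ≤ C' * wt n x := by
  obtain ⟨C, hC, hH⟩ := exists_abs_le_of_homogeneous h.smul
    fun x hx => (h.contDiffAt x hx).continuousAt
  exact exists_abs_integral_mul_comp_sub_le hC hH hg hgc

theorem integral_mul_dirDeriv_of_contDiffAt {H g : E d → ℝ}
    (hH : ∀ y, y ≠ 0 → ContDiffAt ℝ ∞ H y)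
    (hg : ContDiff ℝ ∞ g) (hgc : HasCompactSupport g) {x : E d} (hx : x ∉ tsupport g) (v : E d) :
    ∫ y, H y * dirDeriv v g (x - y) = ∫ y, dirDeriv v H y * g (x - y) :=
  integral_mul_dirDeriv_comp_sub (fun y hy => (hH y hy).of_le (by norm_cast))
    (hg.of_le (by norm_cast)) hgc hx v

/-- Far out, both derivatives are moved from `φ` to `G`, one at a time, which leaves a kernel of
degree `-d`. This rate is borderline: its sum over the lattice diverges. -/
theorem exists_abs_uPot_le (hd : 2 ≤ d) {φ : E d → ℝ} (hφ : ContDiff ℝ ∞ φ)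
    (hφc : HasCompactSupport φ) (i j : Fin d) :
    ∃ C, 0 < C ∧ ∀ x, |uPot φ i j x| ≤ C * wt d x := by
  have hK := (isHomogeneousKernel_dirDeriv_green (coordVec i)).dirDeriv (coordVec j)
  rw [show (1 - (d : ℤ) - 1) = -(d : ℤ) by ring] at hK
  obtain ⟨R, C, h⟩ := hK.exists_abs_integral_le hφ.continuous hφc
  refine exists_le_wt_of_continuous (contDiff_uPot hd hφ hφc i j).continuous (R := R) (C := C)
    (by positivity) fun x hx => ?_
  obtain ⟨h1, h2⟩ := h x hx
  have h1' : x ∉ tsupport (dirDeriv (coordVec j) φ) := fun h => h1 (tsupport_dirDeriv_subset _ _ h)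
  rw [uPot_apply, partial₂_eq_dirDeriv hφ,
    integral_mul_dirDeriv_of_contDiffAt (fun _ => contDiffAt_green) (contDiff_dirDeriv hφ _)
      (hasCompactSupport_dirDeriv hφc _) h1',
    integral_mul_dirDeriv_of_contDiffAt
      (isHomogeneousKernel_dirDeriv_green (coordVec i)).contDiffAt hφ hφc h1]
  exact h2

/-- The third derivative lowers the degree of the kernel to `-(d + 1)`, a rate that is summable over
the lattice. -/
theorem exists_abs_dirDeriv_uPot_le (hd : 2 ≤ d) {φ : E d → ℝ} (hφ : ContDiff ℝ ∞ φ)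
    (hφc : HasCompactSupport φ) (i j : Fin d) (v : E d) :
    ∃ C, 0 < C ∧ ∀ x, |dirDeriv v (uPot φ i j) x| ≤ C * wt (d + 1) x := by
  have hK1 := (isHomogeneousKernel_dirDeriv_green v).dirDeriv (coordVec i)
  have hK := hK1.dirDeriv (coordVec j)
  rw [show (1 - (d : ℤ) - 1 - 1) = -((d + 1 : ℕ) : ℤ) by push_cast; ring] at hK
  obtain ⟨R, C, h⟩ := hK.exists_abs_integral_le hφ.continuous hφc
  push_cast at h
  refine exists_le_wt_of_continuous (((contDiff_uPot hd hφ hφc i j).continuous_fderiv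
    one_ne_zero).clm_apply continuous_const) (R := R) (C := C) (by positivity) fun x hx => ?_
  obtain ⟨h1, h2⟩ := h x hx
  have h1' : x ∉ tsupport (dirDeriv (coordVec j) φ) := fun h => h1 (tsupport_dirDeriv_subset _ _ h)
  have h1'' : x ∉ tsupport (dirDeriv (coordVec i) (dirDeriv (coordVec j) φ)) :=
    fun h => h1' (tsupport_dirDeriv_subset _ _ h)
  change ‖dirDeriv v (uPot φ i j) x‖ ≤ _
  rw [dirDeriv_uPot hd hφ hφc, partial₂_eq_dirDeriv hφ,
    integral_mul_dirDeriv_of_contDiffAt (fun _ => contDiffAt_green)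
      (contDiff_dirDeriv (contDiff_dirDeriv hφ _) _)
      (hasCompactSupport_dirDeriv (hasCompactSupport_dirDeriv hφc _) _) h1'',
    integral_mul_dirDeriv_of_contDiffAt (isHomogeneousKernel_dirDeriv_green v).contDiffAt
      (contDiff_dirDeriv hφ _) (hasCompactSupport_dirDeriv hφc _) h1',
    integral_mul_dirDeriv_of_contDiffAt hK1.contDiffAt hφ hφc h1]
  exact h2

theorem inner_gradient_eq_dirDeriv (g : E d → ℝ) (x v : E d) :
    inner ℝ (∇ g x) v = dirDeriv v g x := by
  simp [gradient, dirDeriv]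

theorem norm_le_sum_abs_inner (x : E d) : ‖x‖ ≤ ∑ i, |inner ℝ x (coordVec i)| := by
  have h1 : x = ∑ i, x i • coordVec i := by
    conv_lhs => rw [← (EuclideanSpace.basisFun (Fin d) ℝ).sum_repr x]
    simp
  conv_lhs => rw [h1]
  refine (norm_sum_le _ _).trans (Finset.sum_le_sum fun i _ => ?_)
  simp [norm_smul, EuclideanSpace.inner_single_right]

theorem exists_norm_gradient_uPot_le (hd : 2 ≤ d) {φ : E d → ℝ} (hφ : ContDiff ℝ ∞ φ)
    (hφc : HasCompactSupport φ) (i j : Fin d) :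
    ∃ C, 0 < C ∧ ∀ x, ‖∇ (uPot φ i j) x‖ ≤ C * wt (d + 1) x := by
  choose C hC h using fun l : Fin d => exists_abs_dirDeriv_uPot_le hd hφ hφc i j (coordVec l)
  have : Nonempty (Fin d) := ⟨⟨0, by omega⟩⟩
  refine ⟨∑ l, C l, Finset.sum_pos (fun l _ => hC l) Finset.univ_nonempty, fun x => ?_⟩
  refine (norm_le_sum_abs_inner _).trans ?_
  rw [Finset.sum_mul]
  refine Finset.sum_le_sum fun l _ => ?_
  rw [inner_gradient_eq_dirDeriv]
  exact h l x

theorem continuous_gradient {g : E d → ℝ} (hg : ContDiff ℝ 1 g) : Continuous (∇ g) :=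
  (InnerProductSpace.toDual ℝ (E d)).symm.continuous.comp (hg.continuous_fderiv one_ne_zero)

/-! ### The Poisson equation for convolutions with `G` -/

theorem laplacian_comp_add_right {g : E d → ℝ} (a x : E d) :
    Δ (fun y => g (y + a)) x = Δ g (x + a) := by
  rw [InnerProductSpace.laplacian_eq_iteratedFDeriv_stdOrthonormalBasis,
    InnerProductSpace.laplacian_eq_iteratedFDeriv_stdOrthonormalBasis]
  simp only [iteratedFDeriv_comp_add_right]

theorem integral_green_mul_laplacian_add (hd : 2 ≤ d) {ψ : E d → ℝ} (hψ : ContDiff ℝ ∞ ψ)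
    (hψc : HasCompactSupport ψ) (a : E d) : ∫ x, green d x * Δ ψ (x + a) = ψ a := by
  have h := integral_green_mul_laplacian hd (f := fun y => ψ (y + a))
    (hψ.comp (contDiff_id.add contDiff_const)) (hψc.comp_homeomorph (Homeomorph.addRight a))
  simpa only [laplacian_comp_add_right, zero_add] using h

/-- Convolution with the Green function inverts the Laplacian, in the sense of distributions. -/
theorem integral_convolution_green_mul_laplacian (hd : 2 ≤ d) {f ψ : E d → ℝ} (hf : Continuous f)
    (hfc : HasCompactSupport f) (hψ : ContDiff ℝ ∞ ψ) (hψc : HasCompactSupport ψ) :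
    ∫ x, (∫ y, green d y * f (x - y)) * Δ ψ x = ∫ x, f x * ψ x := by
  have hLc := continuous_laplacian hψ
  have hLs := hasCompactSupport_laplacian hψ hψc
  obtain ⟨ρ, hρ, hfs⟩ := exists_tsupport_subset_closedBall hfc
  obtain ⟨σ, hσ, hLs'⟩ := exists_tsupport_subset_closedBall hLs
  -- Only arguments of `G` in this ball occur, as differences of points of the two supports.
  -- Truncating `G` there makes it integrable, which gives the joint integrability for Fubini.
  set B := Metric.closedBall (0 : E d) (ρ + σ)
  have hGi : Integrable (B.indicator (green d)) :=
    (integrable_indicator_iff measurableSet_closedBall).2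
      ((locallyIntegrable_green hd).integrableOn_isCompact (isCompact_closedBall _ _))
  have hfi : Integrable f := hf.integrable_of_hasCompactSupport hfc
  have hprod : Integrable (fun p : E d × E d => (f p.2 * green d (p.1 - p.2)) * Δ ψ p.1)
      (volume.prod volume) := by
    have h1 := hfi.convolution_integrand (ContinuousLinearMap.mul ℝ ℝ) hGi
    obtain ⟨M, hM⟩ := hLc.bounded_above_of_compact_support hLs
    have h2 := h1.mul_bdd (c := M) (g := fun p : E d × E d => Δ ψ p.1)
      (hLc.comp continuous_fst).aestronglyMeasurable (Eventually.of_forall fun p => hM p.1)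
    refine h2.congr (Eventually.of_forall fun p => ?_)
    simp only [ContinuousLinearMap.mul_apply']
    by_cases hp : p.1 - p.2 ∈ B
    · rw [Set.indicator_of_mem hp]
    · by_cases h3 : f p.2 = 0
      · simp [h3]
      by_cases h4 : Δ ψ p.1 = 0
      · simp [h4]
      refine absurd ?_ hp
      have h5 := mem_closedBall_zero_iff.1 (hfs (subset_tsupport f h3))
      have h6 := mem_closedBall_zero_iff.1 (hLs' (subset_tsupport _ h4))
      rw [mem_closedBall_zero_iff]
      exact (norm_sub_le _ _).trans (by linarith)
  calc ∫ x, (∫ y, green d y * f (x - y)) * Δ ψ x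
      = ∫ x, ∫ z, (f z * green d (x - z)) * Δ ψ x := by
        refine integral_congr_ae (Eventually.of_forall fun x => ?_)
        simp only
        rw [integral_mul_const, ← integral_sub_left_eq_self
          (fun y => green d y * f (x - y)) volume x]
        simp [mul_comm]
    _ = ∫ z, ∫ x, (f z * green d (x - z)) * Δ ψ x := integral_integral_swap hprod
    _ = ∫ z, f z * ψ z := by
        refine integral_congr_ae (Eventually.of_forall fun z => ?_)
        simp only
        rw [← integral_green_mul_laplacian_add hd hψ hψc z, ← integral_const_mul,
          ← integral_add_right_eq_self (fun x => (f z * green d (x - z)) * Δ ψ x) z]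
        simp [mul_assoc]

theorem integral_uPot_comp_sub_mul_laplacian (hd : 2 ≤ d) {φ ψ : E d → ℝ} (hφ : ContDiff ℝ ∞ φ)
    (hφc : HasCompactSupport φ) (hψ : ContDiff ℝ ∞ ψ) (hψc : HasCompactSupport ψ) (i j : Fin d)
    (a : E d) :
    ∫ x, uPot φ i j (x - a) * Δ ψ x = ∫ x, partial₂ φ i j (x - a) * ψ x := by
  have h := integral_convolution_green_mul_laplacian hd (contDiff_partial₂ hφ i j).continuous
    (hasCompactSupport_partial₂ hφ hφc i j) (ψ := fun y => ψ (y + a))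
    (hψ.comp (contDiff_id.add contDiff_const)) (hψc.comp_homeomorph (Homeomorph.addRight a))
  simp only [laplacian_comp_add_right] at h
  rw [← integral_add_right_eq_self (fun x => uPot φ i j (x - a) * Δ ψ x) a,
    ← integral_add_right_eq_self (fun x => partial₂ φ i j (x - a) * ψ x) a]
  simpa [uPot_apply] using h

/-! ### Weighted averages along the segments from `y` to `y - z` -/

section RayAverage

variable {F : Type*} [NormedAddCommGroup F] [NormedSpace ℝ F]

/-- The weighted average `∫₀¹ (1-t) W(y - t z) dt`. -/
noncomputable def rayAvg (W : E d → F) (z y : E d) : F :=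
  ∫ t in (0 : ℝ)..1, (1 - t) • W (y - t • z)

theorem continuous_rayAvg {W : E d → F} (hW : Continuous W) :
    Continuous fun p : E d × E d => rayAvg W p.1 p.2 := by
  unfold rayAvg
  refine intervalIntegral.continuous_parametric_intervalIntegral_of_continuous' ?_ 0 1
  fun_prop

/-- The segment stays within `ρ` of `y`, so the weight varies along it by at most the factor `(1 +
ρ) ^ s`. -/
theorem norm_rayAvg_le {W : E d → F} {C s ρ : ℝ} (hC : 0 ≤ C) (hs : 0 ≤ s)
    (hW : ∀ y, ‖W y‖ ≤ C * wt s y) {z : E d} (hz : ‖z‖ ≤ ρ) (y : E d) :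
    ‖rayAvg W z y‖ ≤ C * (1 + ρ) ^ s * wt s y := by
  have := intervalIntegral.norm_integral_le_of_norm_le_const (a := 0) (b := 1)
    (f := fun t : ℝ => (1 - t) • W (y - t • z)) (C := C * (1 + ρ) ^ s * wt s y) ?_
  · simpa [rayAvg] using this
  · intro t ht
    rw [Set.uIoc_of_le zero_le_one] at ht
    have h1 : ‖(y - t • z) - y‖ ≤ ρ := by
      rw [sub_sub_cancel_left, norm_neg, norm_smul, Real.norm_of_nonneg ht.1.le]
      exact (mul_le_of_le_one_left (norm_nonneg z) ht.2).trans hz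
    rw [norm_smul, Real.norm_of_nonneg (by linarith [ht.2])]
    calc (1 - t) * ‖W (y - t • z)‖ ≤ 1 * (C * ((1 + ρ) ^ s * wt s y)) := by
          gcongr
          · linarith [ht.1]
          · exact (hW _).trans (by gcongr; exact wt_le_of_dist_le hs h1)
      _ = _ := by ring

theorem rayAvg_clm_comp {F' : Type*} [NormedAddCommGroup F'] [NormedSpace ℝ F'] [CompleteSpace F]
    [CompleteSpace F'] (L : F →L[ℝ] F') {W : E d → F} (hW : Continuous W) (z y : E d) :
    rayAvg (fun x => L (W x)) z y = L (rayAvg W z y) := by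
  unfold rayAvg
  rw [← ContinuousLinearMap.intervalIntegral_comp_comm]
  · simp
  · exact Continuous.intervalIntegrable (by fun_prop) _ _

end RayAverage

theorem hasFDerivAt_rayAvg {u : E d → ℝ} (hu : ContDiff ℝ 1 u) {M : ℝ}
    (hM : ∀ x, ‖fderiv ℝ u x‖ ≤ M) (z y : E d) :
    HasFDerivAt (rayAvg u z) (rayAvg (fderiv ℝ u) z y) y := by
  have hc := hu.continuous
  have hc' := hu.continuous_fderiv one_ne_zero
  unfold rayAvg
  refine (intervalIntegral.hasFDerivAt_integral_of_dominated_of_fderiv_le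
    (F := fun y t => (1 - t) • u (y - t • z))
    (F' := fun y t => (1 - t) • fderiv ℝ u (y - t • z)) (bound := fun _ => M)
    (s := Set.univ) univ_mem ?_ ?_ ?_ ?_ ?_ ?_)
  · exact Eventually.of_forall fun x => Continuous.aestronglyMeasurable (by fun_prop)
  · exact Continuous.intervalIntegrable (by fun_prop) _ _
  · exact Continuous.aestronglyMeasurable (by fun_prop)
  · refine Eventually.of_forall fun t ht x _ => ?_
    rw [Set.uIoc_of_le zero_le_one] at ht
    rw [norm_smul, Real.norm_of_nonneg (by linarith [ht.2])]
    refine (mul_le_of_le_one_left (norm_nonneg _) (by linarith [ht.1])).trans (hM _)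
  · exact intervalIntegrable_const
  · refine Eventually.of_forall fun t _ x _ => ?_
    have h1 := (hu.differentiable one_ne_zero (x - t • z)).hasFDerivAt.comp x
      ((hasFDerivAt_id x).sub_const (t • z))
    have h2 : HasFDerivAt (fun x => u (x - t • z)) (fderiv ℝ u (x - t • z)) x :=
      h1.congr_fderiv (by ext; simp)
    exact h2.const_smul (1 - t)

theorem hasGradientAt_rayAvg {u : E d → ℝ} (hu : ContDiff ℝ 1 u) {M : ℝ}
    (hM : ∀ x, ‖∇ u x‖ ≤ M) (z y : E d) :
    HasGradientAt (rayAvg u z) (rayAvg (∇ u) z y) y := by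
  have hM' : ∀ x, ‖fderiv ℝ u x‖ ≤ M := fun x => by
    simpa [gradient] using hM x
  rw [hasGradientAt_iff_hasFDerivAt]
  refine (hasFDerivAt_rayAvg hu hM' z y).congr_fderiv ?_
  ext v
  have h1 := rayAvg_clm_comp (ContinuousLinearMap.apply ℝ ℝ v) (hu.continuous_fderiv one_ne_zero)
    z y
  have h2 := rayAvg_clm_comp (innerSL ℝ v) (continuous_gradient hu) z y
  simp only [ContinuousLinearMap.apply_apply, innerSL_apply_apply] at h1 h2
  rw [← h1, InnerProductSpace.toDual_apply_apply, real_inner_comm, ← h2]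
  congr 1
  funext x
  rw [real_inner_comm, inner_gradient_eq_dirDeriv, dirDeriv]

/-- Fubini, for an integrand that is continuous and vanishes off `tsupport χ × [0, 1]`. It reduces
the equation for ray averages to the one for translates. -/
theorem integral_rayAvg_mul {u χ : E d → ℝ} (hu : Continuous u) (hχ : Continuous χ)
    (hχc : HasCompactSupport χ) (z a : E d) :
    ∫ x, rayAvg u z (x - a) * χ x =
      ∫ t in (0 : ℝ)..1, (1 - t) * ∫ x, u (x - (a + t • z)) * χ x := by
  have hcont : Continuous fun p : E d × ℝ => ((1 - p.2) * u (p.1 - a - p.2 • z)) * χ p.1 := by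
    fun_prop
  have hint : Integrable (fun p : E d × ℝ => ((1 - p.2) * u (p.1 - a - p.2 • z)) * χ p.1)
      (volume.prod (volume.restrict (Set.Ioc 0 1))) := by
    have h1 : IntegrableOn (fun p : E d × ℝ => ((1 - p.2) * u (p.1 - a - p.2 • z)) * χ p.1)
        (tsupport χ ×ˢ Set.Icc 0 1) (volume.prod volume) :=
      hcont.continuousOn.integrableOn_compact (hχc.isCompact.prod isCompact_Icc)
    have h2 : (volume : Measure (E d)).prod (volume.restrict (Set.Ioc (0 : ℝ) 1)) =
        (volume.prod volume).restrict (Set.univ ×ˢ Set.Ioc (0 : ℝ) 1) := by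
      rw [← Measure.prod_restrict, Measure.restrict_univ]
    rw [h2]
    refine IntegrableOn.of_forall_sdiff_eq_zero h1 (MeasurableSet.univ.prod measurableSet_Ioc) ?_
    rintro ⟨x, t⟩ ⟨⟨_, ht⟩, hn⟩
    have hx : x ∉ tsupport χ := fun hx => hn ⟨hx, Set.Ioc_subset_Icc_self ht⟩
    simp [image_eq_zero_of_notMem_tsupport hx]
  simp only [rayAvg, intervalIntegral.integral_of_le zero_le_one, smul_eq_mul,
    ← integral_mul_const, ← integral_const_mul]
  rw [integral_integral_swap hint]
  simp only [sub_sub, mul_assoc]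

theorem integral_rayAvg_uPot_mul_laplacian (hd : 2 ≤ d) {φ ψ : E d → ℝ} (hφ : ContDiff ℝ ∞ φ)
    (hφc : HasCompactSupport φ) (hψ : ContDiff ℝ ∞ ψ) (hψc : HasCompactSupport ψ) (i j : Fin d)
    (z a : E d) :
    ∫ x, rayAvg (uPot φ i j) z (x - a) * Δ ψ x =
      ∫ x, rayAvg (partial₂ φ i j) z (x - a) * ψ x := by
  rw [integral_rayAvg_mul (contDiff_uPot hd hφ hφc i j).continuous (continuous_laplacian hψ)
      (hasCompactSupport_laplacian hψ hψc),
    integral_rayAvg_mul (contDiff_partial₂ hφ i j).continuous hψ.continuous hψc]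
  simp only [integral_uPot_comp_sub_mul_laplacian hd hφ hφc hψ hψc]

/-! ### Normally convergent series over the lattice -/

section Series

variable {F : Type*} [NormedAddCommGroup F]

/-- Moving the evaluation point from `x` to the origin costs only the factor `(1 + R) ^ s` on the
ball of radius `R`. -/
theorem normallyConvergent_of_le_wt {f : (Fin d → ℤ) → E d → F} {C s : ℝ} (hC : 0 ≤ C)
    (hs : (d : ℝ) < s) (h : ∀ k x, ‖f k x‖ ≤ C * wt s (x - lat k)) : NormallyConvergent f := by
  have hs0 : 0 ≤ s := (Nat.cast_nonneg d).trans hs.le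
  intro R hR
  obtain ⟨A, hA, hsum⟩ := exists_tsum_wt_le hs
  refine ⟨fun k => C * ((1 + R) ^ s * wt s (0 - lat k)),
    ((hsum 0).1.mul_left _).mul_left _, fun k x hx => (h k x).trans ?_⟩
  beta_reduce
  gcongr
  refine wt_le_of_dist_le hs0 ?_
  simpa using (mem_ball_zero_iff.1 hx).le

theorem NormallyConvergent.summable_norm {ι : Type*} {f : ι → E d → F}
    (hf : NormallyConvergent f) (x : E d) : Summable fun k => ‖f k x‖ := by
  obtain ⟨b, hb, h⟩ := hf (‖x‖ + 1) (by positivity)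
  exact hb.of_nonneg_of_le (fun _ => norm_nonneg _) fun k => h k x (by simp)

theorem NormallyConvergent.continuous_tsum {ι : Type*} [CompleteSpace F] {f : ι → E d → F}
    (hf : NormallyConvergent f) (hc : ∀ k, Continuous (f k)) :
    Continuous fun x => ∑' k, f k x := by
  rw [continuous_iff_continuousAt]
  intro x
  obtain ⟨b, hb, h⟩ := hf (‖x‖ + 1) (by positivity)
  exact (_root_.continuousOn_tsum (fun k => (hc k).continuousOn) hb h).continuousAt
    (Metric.isOpen_ball.mem_nhds (by simp))

theorem exists_norm_tsum_le_of_le_wt {f : (Fin d → ℤ) → E d → F} {C s : ℝ} (hC : 0 ≤ C)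
    (hs : (d : ℝ) < s) (h : ∀ k x, ‖f k x‖ ≤ C * wt s (x - lat k)) :
    ∃ M, 0 < M ∧ ∀ x, ∑' k, ‖f k x‖ ≤ M := by
  obtain ⟨A, hA, hsum⟩ := exists_tsum_wt_le hs
  refine ⟨C * A + 1, by positivity, fun x => ?_⟩
  calc ∑' k, ‖f k x‖ ≤ ∑' k, C * wt s (x - lat k) :=
        ((normallyConvergent_of_le_wt hC hs h).summable_norm x).tsum_le_tsum (fun k => h k x)
          ((hsum x).1.mul_left C)
    _ = C * ∑' k, wt s (x - lat k) := tsum_mul_left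
    _ ≤ C * A := by gcongr; exact (hsum x).2
    _ ≤ C * A + 1 := by linarith

/-- Termwise integration of a normally convergent series against a compactly supported function. -/
theorem NormallyConvergent.hasSum_integral_mul {ι : Type*} [Countable ι] {f : ι → E d → ℝ}
    (hf : NormallyConvergent f) (hc : ∀ k, Continuous (f k)) {χ : E d → ℝ} (hχ : Continuous χ)
    (hχc : HasCompactSupport χ) :
    HasSum (fun k => ∫ x, f k x * χ x) (∫ x, (∑' k, f k x) * χ x) := by
  obtain ⟨ρ, hρ, hs⟩ := exists_tsupport_subset_closedBall hχc
  obtain ⟨b, hb, h⟩ := hf (ρ + 1) (by positivity)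
  have hle : ∀ k x, ‖f k x * χ x‖ ≤ b k * ‖χ x‖ := by
    intro k x
    rw [norm_mul]
    by_cases h0 : χ x = 0
    · simp [h0]
    have := mem_closedBall_zero_iff.1 (hs (subset_tsupport χ h0))
    gcongr
    exact h k x (by rw [mem_ball_zero_iff]; linarith)
  have hχi : Integrable fun x => ‖χ x‖ := (hχ.integrable_of_hasCompactSupport hχc).norm
  refine hasSum_integral_of_dominated_convergence (fun k x => b k * ‖χ x‖) ?_ ?_ ?_ ?_ ?_
  · exact fun k => ((hc k).mul hχ).aestronglyMeasurable
  · exact fun k => Eventually.of_forall (hle k)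
  · exact Eventually.of_forall fun x => hb.mul_right _
  · simp only [tsum_mul_right]
    exact hχi.const_mul _
  · refine Eventually.of_forall fun x => ?_
    exact (hf.summable_norm x).of_norm.hasSum.mul_right _

end Series

/-! ### The renormalised sum of the potentials and its growth -/

/-- A family of potentials centred at the points of the lattice, with their gradients. -/
structure IsDecayingFamily (Ψ : (Fin d → ℤ) → E d → ℝ) (Φ : (Fin d → ℤ) → E d → E d) (C : ℝ) :
    Prop where
  pos : 0 < C
  hasGradientAt : ∀ k x, HasGradientAt (Ψ k) (Φ k x) x
  continuous : ∀ k, Continuous (Φ k)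
  abs_le : ∀ k x, |Ψ k x| ≤ C * wt d (x - lat k)
  norm_le : ∀ k x, ‖Φ k x‖ ≤ C * wt (d + 1) (x - lat k)

namespace IsDecayingFamily

variable {Ψ : (Fin d → ℤ) → E d → ℝ} {Φ : (Fin d → ℤ) → E d → E d} {C : ℝ}

theorem normallyConvergent (h : IsDecayingFamily Ψ Φ C) : NormallyConvergent Φ :=
  normallyConvergent_of_le_wt h.pos.le (by linarith) h.norm_le

theorem continuous_tsum (h : IsDecayingFamily Ψ Φ C) : Continuous fun x => ∑' k, Φ k x :=
  h.normallyConvergent.continuous_tsum h.continuous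

theorem exists_norm_tsum_le (h : IsDecayingFamily Ψ Φ C) :
    ∃ M, 0 < M ∧ ∀ x, ‖∑' k, Φ k x‖ ≤ M := by
  obtain ⟨M, hM, hb⟩ := exists_norm_tsum_le_of_le_wt h.pos.le (by linarith) h.norm_le
  exact ⟨M, hM, fun x =>
    (norm_tsum_le_tsum_norm (h.normallyConvergent.summable_norm x)).trans (hb x)⟩

theorem continuous_potential (h : IsDecayingFamily Ψ Φ C) (k : Fin d → ℤ) : Continuous (Ψ k) :=
  continuous_iff_continuousAt.2 fun x => (h.hasGradientAt k x).continuousAt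

/-- Half a power of growth is traded for half a power of decay, which turns the borderline rate `d`
into the summable rate `d + 1/2`. -/
theorem wt_mul_le (s : ℝ) (x : E d) {r : ℝ} (hr : 1 + ‖x‖ ≤ r) :
    wt s x ≤ r ^ (1 / 2 : ℝ) * wt (s + 1 / 2) x := by
  have h1 : 0 < 1 + ‖x‖ := by positivity
  calc wt s x = (1 + ‖x‖) ^ (1 / 2 : ℝ) * wt (s + 1 / 2) x := by
        unfold wt
        rw [← Real.rpow_add h1]
        ring_nf
    _ ≤ _ := by
        gcongr
        exact (wt_pos _ _).le

/-- The central estimate. It pays for summability in `k` with growth in `x`; any growth exponent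
strictly between `0` and `1` would serve, and `1/2` is a convenient choice. Centres near `x` or `0`
are handled by the size of the potentials, distant ones by the mean value inequality. -/
theorem exists_abs_sub_le (h : IsDecayingFamily Ψ Φ C) : ∃ C', 0 < C' ∧ ∀ k x,
    |Ψ k x - Ψ k 0| ≤ C' * (1 + ‖x‖) ^ (1 / 2 : ℝ) *
      (wt (d + 1 / 2) (x - lat k) + wt (d + 1 / 2) (0 - lat k)) := by
  have hC := h.pos
  refine ⟨C * 2 ^ ((d : ℝ) + 1) * 4, by positivity, fun k x => ?_⟩
  have h2 : (1 : ℝ) ≤ 2 ^ ((d : ℝ) + 1) := Real.one_le_rpow one_le_two (by positivity)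
  have hw1 := wt_pos ((d : ℝ) + 1 / 2) (x - lat k)
  have hw2 := wt_pos ((d : ℝ) + 1 / 2) (0 - lat k)
  have hroot : (4 * (1 + ‖x‖)) ^ (1 / 2 : ℝ) = 2 * (1 + ‖x‖) ^ (1 / 2 : ℝ) := by
    rw [Real.mul_rpow (by norm_num) (by positivity), show (4 : ℝ) = 2 ^ (2 : ℝ) by norm_num,
      ← Real.rpow_mul (by norm_num)]
    norm_num
  have hx0 := norm_nonneg x
  rcases le_total ‖lat k‖ (2 * ‖x‖) with hk | hk
  -- Near centres: `‖x - k‖ ≤ 3 ‖x‖` and `‖k‖ ≤ 2 ‖x‖`, so both distances are controlled by `4 (1 +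
  -- ‖x‖)`, whose root is `hroot`.
  · have e1 := wt_mul_le (d : ℝ) (x - lat k) (r := 4 * (1 + ‖x‖))
      (by linarith [norm_sub_le x (lat k)])
    have e2 := wt_mul_le (d : ℝ) (0 - lat k) (r := 4 * (1 + ‖x‖))
      (by rw [zero_sub, norm_neg]; linarith)
    rw [hroot] at e1 e2
    calc |Ψ k x - Ψ k 0| ≤ |Ψ k x| + |Ψ k 0| := abs_sub _ _
      _ ≤ C * wt d (x - lat k) + C * wt d (0 - lat k) := add_le_add (h.abs_le k x) (h.abs_le k 0)
      _ ≤ C * (2 * (1 + ‖x‖) ^ (1 / 2 : ℝ) * wt (d + 1 / 2) (x - lat k)) +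
          C * (2 * (1 + ‖x‖) ^ (1 / 2 : ℝ) * wt (d + 1 / 2) (0 - lat k)) := by gcongr
      _ = (C * 1 * 2) * (1 + ‖x‖) ^ (1 / 2 : ℝ) *
          (wt (d + 1 / 2) (x - lat k) + wt (d + 1 / 2) (0 - lat k)) := by ring
      _ ≤ C * 2 ^ ((d : ℝ) + 1) * 4 * (1 + ‖x‖) ^ (1 / 2 : ℝ) *
          (wt (d + 1 / 2) (x - lat k) + wt (d + 1 / 2) (0 - lat k)) := by
          gcongr; norm_num
  -- Distant centres: `‖y - k‖ ≥ ‖k‖ / 2` for all `‖y‖ ≤ ‖x‖`. The mean value inequality gives `‖x‖`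
  -- times a weight of rate `d + 1`, and half a power of `‖x‖` is absorbed using `‖x‖ ≤ ‖k‖`.
  · have hder : ∀ y ∈ Metric.closedBall (0 : E d) ‖x‖,
        ‖Φ k y‖ ≤ C * (2 ^ ((d : ℝ) + 1) * wt (d + 1) (0 - lat k)) := by
      intro y hy
      refine (h.norm_le k y).trans ?_
      gcongr
      refine wt_le_of_le_mul (by positivity) two_pos ?_
      have h3 := mem_closedBall_zero_iff.1 hy
      have h4 := norm_sub_norm_le (lat k) y
      rw [norm_sub_rev] at h4
      rw [zero_sub, norm_neg]
      linarith
    have hmv := (convex_closedBall (0 : E d) ‖x‖).norm_image_sub_le_of_norm_hasFDerivWithin_le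
      (𝕜 := ℝ) (f := Ψ k) (f' := fun y => InnerProductSpace.toDual ℝ (E d) (Φ k y))
      (fun y _ => (h.hasGradientAt k y).hasFDerivAt.hasFDerivWithinAt)
      (C := C * (2 ^ ((d : ℝ) + 1) * wt (d + 1) (0 - lat k)))
      (fun y hy => by rw [LinearIsometryEquiv.norm_map]; exact hder y hy) (x := 0) (y := x) (by simp) (by simp)
    rw [sub_zero, Real.norm_eq_abs] at hmv
    have e3 : ‖x‖ * wt (d + 1) (0 - lat k) ≤
        (1 + ‖x‖) ^ (1 / 2 : ℝ) * wt (d + 1 / 2) (0 - lat k) := by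
      have h5 : (0 : ℝ) < 1 + ‖0 - lat k‖ := by positivity
      have h6 : wt ((d : ℝ) + 1) (0 - lat k) =
          (1 + ‖0 - lat k‖) ^ (-(1 / 2) : ℝ) * wt (d + 1 / 2) (0 - lat k) := by
        unfold wt
        rw [← Real.rpow_add h5]
        ring_nf
      rw [h6, ← mul_assoc]
      gcongr
      have h7 : (1 + ‖0 - lat k‖) ^ (-(1 / 2) : ℝ) ≤ (1 + ‖x‖) ^ (-(1 / 2) : ℝ) := by
        refine Real.rpow_le_rpow_of_nonpos (by positivity) ?_ (by norm_num)
        rw [zero_sub, norm_neg]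
        linarith
      calc ‖x‖ * (1 + ‖0 - lat k‖) ^ (-(1 / 2) : ℝ)
          ≤ (1 + ‖x‖) * (1 + ‖x‖) ^ (-(1 / 2) : ℝ) := by gcongr; linarith
        _ = (1 + ‖x‖) ^ (1 / 2 : ℝ) := by
          nth_rw 1 [← Real.rpow_one (1 + ‖x‖)]
          rw [← Real.rpow_add (by positivity)]
          norm_num
    calc |Ψ k x - Ψ k 0| ≤ C * (2 ^ ((d : ℝ) + 1) * wt (d + 1) (0 - lat k)) * ‖x‖ := hmv
      _ = C * 2 ^ ((d : ℝ) + 1) * (‖x‖ * wt (d + 1) (0 - lat k)) := by ring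
      _ ≤ C * 2 ^ ((d : ℝ) + 1) * ((1 + ‖x‖) ^ (1 / 2 : ℝ) * wt (d + 1 / 2) (0 - lat k)) := by
          gcongr
      _ = C * 2 ^ ((d : ℝ) + 1) * 1 * (1 + ‖x‖) ^ (1 / 2 : ℝ) *
          (0 + wt (d + 1 / 2) (0 - lat k)) := by ring
      _ ≤ _ := by gcongr; norm_num

/-- The renormalised sum of the potentials. -/
noncomputable def _root_.NonlinearCorrector.renormSum (Ψ : (Fin d → ℤ) → E d → ℝ) (x : E d) : ℝ :=
  ∑' k, (Ψ k x - Ψ k 0)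

theorem normallyConvergent_sub (h : IsDecayingFamily Ψ Φ C) :
    NormallyConvergent fun k x => Ψ k x - Ψ k 0 := by
  obtain ⟨C', hC', hb⟩ := h.exists_abs_sub_le
  have hs : (d : ℝ) < d + 1 / 2 := by linarith
  obtain ⟨A, hA, hsum⟩ := exists_tsum_wt_le hs
  intro R hR
  refine ⟨fun k => C' * (1 + R) ^ (1 / 2 : ℝ) *
      ((1 + R) ^ ((d : ℝ) + 1 / 2) * wt (d + 1 / 2) (0 - lat k) + wt (d + 1 / 2) (0 - lat k)),
    (((hsum 0).1.mul_left _).add (hsum 0).1).mul_left _, fun k x hx => (hb k x).trans ?_⟩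
  have hx' := (mem_ball_zero_iff.1 hx).le
  have h1 := wt_pos ((d : ℝ) + 1 / 2) (x - lat k)
  have h2 := wt_pos ((d : ℝ) + 1 / 2) (0 - lat k)
  beta_reduce
  gcongr
  exact wt_le_of_dist_le (by positivity) (by simpa using hx')

theorem exists_abs_renormSum_le (h : IsDecayingFamily Ψ Φ C) :
    ∃ C', 0 < C' ∧ ∀ x, |renormSum Ψ x| ≤ C' * (1 + ‖x‖) ^ (1 / 2 : ℝ) := by
  obtain ⟨C', hC', hb⟩ := h.exists_abs_sub_le
  have hs : (d : ℝ) < d + 1 / 2 := by linarith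
  obtain ⟨A, hA, hsum⟩ := exists_tsum_wt_le hs
  refine ⟨C' * (A + A), by positivity, fun x => ?_⟩
  calc |renormSum Ψ x| ≤ ∑' k, |Ψ k x - Ψ k 0| :=
        norm_tsum_le_tsum_norm (h.normallyConvergent_sub.summable_norm x)
    _ ≤ ∑' k, C' * (1 + ‖x‖) ^ (1 / 2 : ℝ) *
          (wt (d + 1 / 2) (x - lat k) + wt (d + 1 / 2) (0 - lat k)) :=
        (h.normallyConvergent_sub.summable_norm x).tsum_le_tsum (fun k => hb k x)
          (((hsum x).1.add (hsum 0).1).mul_left _)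
    _ = C' * (1 + ‖x‖) ^ (1 / 2 : ℝ) * (∑' k, wt (d + 1 / 2) (x - lat k) +
          ∑' k, wt (d + 1 / 2) (0 - lat k)) := by
        rw [tsum_mul_left, (hsum x).1.tsum_add (hsum 0).1]
    _ ≤ C' * (1 + ‖x‖) ^ (1 / 2 : ℝ) * (A + A) := by
        gcongr
        · exact (hsum x).2
        · exact (hsum 0).2
    _ = _ := by ring

/-- Termwise differentiation: the gradients converge normally on a ball containing `0` and `x`, and
at `0` every term of the renormalised series vanishes. -/
theorem hasGradientAt_renormSum (h : IsDecayingFamily Ψ Φ C) (x : E d) :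
    HasGradientAt (renormSum Ψ) (∑' k, Φ k x) x := by
  obtain ⟨b, hb, hle⟩ := h.normallyConvergent (‖x‖ + 1) (by positivity)
  rw [hasGradientAt_iff_hasFDerivAt]
  have := hasFDerivAt_tsum_of_isPreconnected (𝕜 := ℝ) hb (Metric.isOpen_ball)
    (convex_ball (0 : E d) (‖x‖ + 1)).isPreconnected
    (f := fun k x => Ψ k x - Ψ k 0)
    (f' := fun k y => InnerProductSpace.toDual ℝ (E d) (Φ k y))
    (fun k y _ => (h.hasGradientAt k y).hasFDerivAt.sub_const _)
    (fun k y hy => by simpa using hle k y hy) (x₀ := 0) (by simp; positivity)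
    (by simp) (x := x) (by simp)
  refine this.congr_fderiv ?_
  exact ((InnerProductSpace.toDual ℝ (E d)).toContinuousLinearEquiv.map_tsum).symm

theorem continuous_renormSum (h : IsDecayingFamily Ψ Φ C) : Continuous (renormSum Ψ) :=
  continuous_iff_continuousAt.2 fun x => (h.hasGradientAt_renormSum x).continuousAt

/-- Normal convergence permits testing term by term, and the constants `Ψ k 0` integrate to zero
against `Δ ψ`. -/
theorem isDistribSolution (h : IsDecayingFamily Ψ Φ C) {f : (Fin d → ℤ) → E d → ℝ}
    (hf : NormallyConvergent f) (hc : ∀ k, Continuous (f k))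
    (heq : ∀ k, ∀ ψ : E d → ℝ, ContDiff ℝ ∞ ψ → HasCompactSupport ψ →
      ∫ x, Ψ k x * Δ ψ x = ∫ x, f k x * ψ x) :
    IsDistribSolution (renormSum Ψ) fun x => ∑' k, f k x := by
  refine ⟨h.continuous_renormSum.locallyIntegrable, (hf.continuous_tsum hc).locallyIntegrable,
    fun ψ hψ hψc => ?_⟩
  have hLc := continuous_laplacian hψ
  have hLs := hasCompactSupport_laplacian hψ hψc
  have h1 := h.normallyConvergent_sub.hasSum_integral_mul
    (fun k => (h.continuous_potential k).sub continuous_const) hLc hLs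
  have h2 := hf.hasSum_integral_mul hc hψ.continuous hψc
  have h3 : ∀ k, ∫ x, (Ψ k x - Ψ k 0) * Δ ψ x = ∫ x, f k x * ψ x := by
    intro k
    simp only [sub_mul]
    rw [integral_sub, integral_const_mul, integral_laplacian_eq_zero hψ hψc, mul_zero, sub_zero,
      heq k ψ hψ hψc]
    · exact ((h.continuous_potential k).mul hLc).integrable_of_hasCompactSupport hLs.mul_left
    · exact (continuous_const.mul hLc).integrable_of_hasCompactSupport hLs.mul_left
  simp only [h3] at h1
  exact h1.unique h2

end IsDecayingFamily

/-! ### Weak-* convergence and sublinear growth -/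

/-- For bounded families, weak-* convergence can be tested on smooth compactly supported
functions. -/
theorem tendstoWeakStar_of_contDiff {F : Type*} [NormedAddCommGroup F] [NormedSpace ℝ F]
    {f : ℝ → E d → F} {g : E d → F} {M : ℝ}
    (hfm : ∀ ε, 0 < ε → AEStronglyMeasurable (f ε) volume)
    (hfb : ∀ ε, 0 < ε → ∀ x, ‖f ε x‖ ≤ M)
    (hgm : AEStronglyMeasurable g volume) (hgb : ∀ x, ‖g x‖ ≤ M)
    (h : ∀ ψ : E d → ℝ, ContDiff ℝ ∞ ψ → HasCompactSupport ψ →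
      Tendsto (fun ε => ∫ x, ψ x • f ε x) (𝓝[>] 0) (𝓝 (∫ x, ψ x • g x))) :
    TendstoWeakStar f g := by
  refine ⟨fun ε hε => memLp_top_of_bound (hfm ε hε) M (Eventually.of_forall (hfb ε hε)),
    memLp_top_of_bound hgm M (Eventually.of_forall hgb), fun χ hχ => ?_⟩
  have hM : 0 ≤ M := (norm_nonneg _).trans (hgb 0)
  rw [Metric.tendsto_nhds]
  intro η hη
  -- With this `L¹` accuracy, replacing `χ` by `ψ` costs at most `η / 4` on each side. Together with
  -- `η / 4` from the convergence for `ψ` the total stays below `η`; `M + 1` avoids dividing by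
  -- zero.
  have hη' : 0 < η / (4 * (M + 1)) := by positivity
  obtain ⟨ψ, hψc, hψ, hle⟩ := MemLp.exist_eLpNorm_sub_le ENNReal.one_ne_top le_rfl
    (memLp_one_iff_integrable.2 hχ) hη'
  have hψi : Integrable ψ := hψ.continuous.integrable_of_hasCompactSupport hψc
  have hdiff : Integrable (χ - ψ) := hχ.sub hψi
  have hL1 : ∫ x, ‖(χ - ψ) x‖ ≤ η / (4 * (M + 1)) := by
    rw [integral_norm_eq_lintegral_enorm hdiff.aestronglyMeasurable, ← eLpNorm_one_eq_lintegral_enorm]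
    exact ENNReal.toReal_le_of_le_ofReal hη'.le hle
  have hsmall : ∀ F' : E d → F, AEStronglyMeasurable F' volume → (∀ x, ‖F' x‖ ≤ M) →
      ‖(∫ x, χ x • F' x) - ∫ x, ψ x • F' x‖ ≤ η / 4 := by
    intro F' hm hb
    have i1 : Integrable fun x => χ x • F' x :=
      (hχ.norm.mul_const M).mono' (hχ.aestronglyMeasurable.smul hm) (Eventually.of_forall fun x => by
        rw [norm_smul]; exact mul_le_mul_of_nonneg_left (hb x) (norm_nonneg _))
    have i2 : Integrable fun x => ψ x • F' x :=
      (hψi.norm.mul_const M).mono' (hψi.aestronglyMeasurable.smul hm) (Eventually.of_forall fun x => by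
        rw [norm_smul]; exact mul_le_mul_of_nonneg_left (hb x) (norm_nonneg _))
    rw [← integral_sub i1 i2]
    calc ‖∫ x, (χ x • F' x - ψ x • F' x)‖ ≤ ∫ x, ‖(χ - ψ) x‖ * M := by
          refine norm_integral_le_of_norm_le (hdiff.norm.mul_const M)
            (Eventually.of_forall fun x => ?_)
          rw [← sub_smul, norm_smul]
          exact mul_le_mul_of_nonneg_left (hb x) (norm_nonneg _)
      _ = (∫ x, ‖(χ - ψ) x‖) * M := integral_mul_const _ _
      _ ≤ η / (4 * (M + 1)) * (M + 1) := by gcongr; linarith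
      _ = η / 4 := by field_simp
  filter_upwards [(Metric.tendsto_nhds.1 (h ψ hψ hψc)) (η / 4) (by positivity),
    self_mem_nhdsWithin] with ε hε hε0
  have e1 := hsmall (f ε) (hfm ε hε0) (hfb ε hε0)
  have e2 := hsmall g hgm hgb
  rw [dist_eq_norm] at hε ⊢
  calc ‖(∫ x, χ x • f ε x) - ∫ x, χ x • g x‖
      = ‖((∫ x, χ x • f ε x) - ∫ x, ψ x • f ε x) + ((∫ x, ψ x • f ε x) - ∫ x, ψ x • g x) -
          ((∫ x, χ x • g x) - ∫ x, ψ x • g x)‖ := by congr 1; abel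
    _ ≤ ‖(∫ x, χ x • f ε x) - ∫ x, ψ x • f ε x‖ + ‖(∫ x, ψ x • f ε x) - ∫ x, ψ x • g x‖ +
          ‖(∫ x, χ x • g x) - ∫ x, ψ x • g x‖ := norm_sub_le_of_le (norm_add_le _ _) le_rfl
    _ < η := by linarith

theorem contDiff_one_of_hasGradientAt {w : E d → ℝ} {V : E d → E d}
    (hw : ∀ x, HasGradientAt w (V x) x) (hV : Continuous V) : ContDiff ℝ 1 w := by
  rw [contDiff_one_iff_fderiv]
  refine ⟨fun x => (hw x).differentiableAt, ?_⟩
  have : fderiv ℝ w = fun x => InnerProductSpace.toDual ℝ (E d) (V x) :=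
    funext fun x => (hw x).hasFDerivAt.fderiv
  rw [this]
  exact (InnerProductSpace.toDual ℝ (E d)).continuous.comp hV

theorem integral_smul_gradient_eq_neg {w : E d → ℝ} {V : E d → E d}
    (hw : ∀ x, HasGradientAt w (V x) x) (hV : Continuous V) {ψ : E d → ℝ} (hψ : ContDiff ℝ ∞ ψ)
    (hψc : HasCompactSupport ψ) : ∫ x, w x • ∇ ψ x = -∫ x, ψ x • V x := by
  have hw1 := contDiff_one_of_hasGradientAt hw hV
  have hψ1 : ContDiff ℝ 1 ψ := hψ.of_le (by norm_cast)
  have hgc : HasCompactSupport (∇ ψ) :=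
    (hψc.fderiv (𝕜 := ℝ)).comp_left (g := (InnerProductSpace.toDual ℝ (E d)).symm) (map_zero _)
  have i1 : Integrable fun x => w x • ∇ ψ x :=
    (hw1.continuous.smul (continuous_gradient hψ1)).integrable_of_hasCompactSupport hgc.smul_left
  have i2 : Integrable fun x => ψ x • V x :=
    (hψ1.continuous.smul hV).integrable_of_hasCompactSupport hψc.smul_right
  refine ext_inner_left ℝ fun v => ?_
  rw [inner_neg_right, ← integral_inner i1, ← integral_inner i2]
  have h0 := integral_fderiv_eq_zero_of_hasCompactSupport (hw1.mul hψ1) hψc.mul_left v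
  have hder : ∀ x, fderiv ℝ (fun y => w y * ψ y) x v =
      inner ℝ v (w x • ∇ ψ x) + inner ℝ v (ψ x • V x) := by
    intro x
    have e := ((hw x).hasFDerivAt.mul (hψ1.differentiable one_ne_zero x).hasFDerivAt).fderiv
    change fderiv ℝ (fun y => w y * ψ y) x = _ at e
    rw [e, inner_smul_right, inner_smul_right, real_inner_comm, inner_gradient_eq_dirDeriv]
    simp [dirDeriv, real_inner_comm]
  simp only [hder] at h0
  rw [integral_add (i1.const_inner v) (i2.const_inner v)] at h0
  linarith

theorem hasWeakGradient_of_hasGradientAt {w : E d → ℝ} {V : E d → E d}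
    (hw : ∀ x, HasGradientAt w (V x) x) (hV : Continuous V) : HasWeakGradient w V :=
  ⟨(contDiff_one_of_hasGradientAt hw hV).continuous.locallyIntegrable, hV.locallyIntegrable,
    fun _ hψ hψc => integral_smul_gradient_eq_neg hw hV hψ hψc⟩

theorem tendsto_mul_rpow_half (C R : ℝ) (hR : 0 ≤ R) :
    Tendsto (fun ε : ℝ => ε * (C * (1 + R / ε) ^ (1 / 2 : ℝ))) (𝓝[>] 0) (𝓝 0) := by
  -- With `ε` moved under the root, the expression extends continuously to `ε = 0`.
  have h1 : Tendsto (fun ε : ℝ => C * (ε ^ 2 + R * ε) ^ (1 / 2 : ℝ)) (𝓝[>] 0) (𝓝 0) := by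
    have : Continuous fun ε : ℝ => C * (ε ^ 2 + R * ε) ^ (1 / 2 : ℝ) := by
      refine continuous_const.mul (Continuous.rpow_const (by fun_prop) fun _ => Or.inr (by norm_num))
    have h := this.tendsto 0
    simp only [ne_eq, OfNat.ofNat_ne_zero, not_false_eq_true, zero_pow, mul_zero, add_zero] at h
    rw [Real.zero_rpow (by norm_num), mul_zero] at h
    exact h.mono_left nhdsWithin_le_nhds
  refine h1.congr' ?_
  filter_upwards [self_mem_nhdsWithin] with ε hε
  have hε' : (0 : ℝ) < ε := hε
  have : ε ^ 2 + R * ε = ε ^ 2 * (1 + R / ε) := by field_simp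
  rw [this, Real.mul_rpow (by positivity) (by positivity), ← Real.sqrt_eq_rpow,
    Real.sqrt_sq hε'.le]
  ring

theorem abs_rescaled_le {w : E d → ℝ} {C : ℝ} (hC : 0 ≤ C)
    (hw : ∀ x, |w x| ≤ C * (1 + ‖x‖) ^ (1 / 2 : ℝ)) {ε R : ℝ} (hε : 0 < ε) {x : E d}
    (hx : ‖x‖ ≤ R) : |ε * w (ε⁻¹ • x)| ≤ ε * (C * (1 + R / ε) ^ (1 / 2 : ℝ)) := by
  rw [abs_mul, abs_of_pos hε]
  gcongr
  refine (hw _).trans ?_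
  rw [norm_smul, norm_inv, Real.norm_of_nonneg hε.le, inv_mul_eq_div]
  gcongr

theorem tendstoZeroLocUnif_of_abs_le {w : E d → ℝ} {C : ℝ} (hC : 0 ≤ C)
    (hw : ∀ x, |w x| ≤ C * (1 + ‖x‖) ^ (1 / 2 : ℝ)) :
    TendstoZeroLocUnif fun ε x => ε * w (ε⁻¹ • x) := by
  intro R hR
  have h1 := ENNReal.tendsto_ofReal (tendsto_mul_rpow_half C R hR.le)
  rw [ENNReal.ofReal_zero] at h1
  refine tendsto_of_tendsto_of_tendsto_of_le_of_le' tendsto_const_nhds h1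
    (Eventually.of_forall fun _ => zero_le) ?_
  filter_upwards [self_mem_nhdsWithin] with ε hε
  rw [eLpNorm_exponent_top]
  refine eLpNormEssSup_le_of_ae_bound ?_
  filter_upwards [ae_restrict_mem measurableSet_ball] with x hx
  exact abs_rescaled_le hC hw hε (by simpa using (mem_ball_zero_iff.1 hx).le)

theorem hasGradientAt_rescaled {w : E d → ℝ} {V : E d → E d}
    (hw : ∀ x, HasGradientAt w (V x) x) {ε : ℝ} (hε : 0 < ε) (x : E d) :
    HasGradientAt (fun x => ε * w (ε⁻¹ • x)) (V (ε⁻¹ • x)) x := by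
  rw [hasGradientAt_iff_hasFDerivAt]
  have h := (((hw (ε⁻¹ • x)).hasFDerivAt).comp x ((hasFDerivAt_id x).const_smul ε⁻¹)).const_mul ε
  refine h.congr_fderiv ?_
  ext v
  simp [hε.ne']

/-- The rescaled gradients of a function of sublinear growth tend weakly-* to zero. -/
theorem tendstoWeakStar_gradient_zero {w : E d → ℝ} {V : E d → E d} {C M : ℝ} (hC : 0 ≤ C)
    (hw : ∀ x, HasGradientAt w (V x) x) (hV : Continuous V) (hM : ∀ x, ‖V x‖ ≤ M)
    (hwb : ∀ x, |w x| ≤ C * (1 + ‖x‖) ^ (1 / 2 : ℝ)) :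
    TendstoWeakStar (fun ε x => V (ε⁻¹ • x)) fun _ => 0 := by
  refine tendstoWeakStar_of_contDiff (M := M) (fun ε _ => ?_) (fun ε _ x => hM _)
    aestronglyMeasurable_const (fun x => by simpa using (norm_nonneg _).trans (hM x))
    fun ψ hψ hψc => ?_
  · exact (hV.comp (continuous_const_smul _)).aestronglyMeasurable
  simp only [smul_zero, integral_zero]
  obtain ⟨ρ, hρ, hs⟩ := exists_tsupport_subset_closedBall hψc
  have hψ1 : ContDiff ℝ 1 ψ := hψ.of_le (by norm_cast)
  have hgc : HasCompactSupport (∇ ψ) :=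
    (hψc.fderiv (𝕜 := ℝ)).comp_left (g := (InnerProductSpace.toDual ℝ (E d)).symm) (map_zero _)
  have hgi : Integrable fun x => ‖∇ ψ x‖ :=
    ((continuous_gradient hψ1).integrable_of_hasCompactSupport hgc).norm
  have hlim := (tendsto_mul_rpow_half C ρ hρ.le).mul_const (∫ x, ‖∇ ψ x‖)
  rw [zero_mul] at hlim
  refine squeeze_zero_norm' ?_ hlim
  filter_upwards [self_mem_nhdsWithin] with ε hε
  -- The rescaled field is the gradient of `ε w(·/ε)`. Moving the derivative onto `ψ` leaves a
  -- function that tends to zero uniformly on the support of `ψ`.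
  have h1 := integral_smul_gradient_eq_neg (hasGradientAt_rescaled hw hε)
    (hV.comp (continuous_const_smul _)) hψ hψc
  rw [← norm_neg]
  change ‖-∫ x, ψ x • V (ε⁻¹ • x)‖ ≤ _
  rw [← h1, ← integral_const_mul]
  refine norm_integral_le_of_norm_le (hgi.const_mul _) (Eventually.of_forall fun x => ?_)
  rw [norm_smul]
  by_cases h0 : ∇ ψ x = 0
  · simp [h0]
  gcongr
  refine abs_rescaled_le hC hwb hε ?_
  have h2 : fderiv ℝ ψ x ≠ 0 := fun h => h0 (by simp [gradient, h])
  exact mem_closedBall_zero_iff.1 (hs (support_fderiv_subset ℝ h2))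

/-! ### From averages over balls to averages against test functions -/

/-- The averages of `c` over the rescaled balls `B_R(x₀)/ε` tend to `a`. -/
def HasBallAverages (c : (Fin d → ℤ) → ℝ) (a : ℝ) : Prop :=
  ∀ R : ℝ, 0 < R → ∀ x₀ : E d,
    Tendsto (fun ε : ℝ => ε ^ d / volume.real (Metric.ball (0 : E d) R) *
      ∑ k ∈ latBall (ε⁻¹ • x₀) (R / ε), c k) (𝓝[>] 0) (𝓝 a)

theorem mem_latBall_iff_norm_smul {ε r : ℝ} (hε : 0 < ε) (y : E d) (k : Fin d → ℤ) :
    k ∈ latBall (ε⁻¹ • y) (r / ε) ↔ ‖ε • lat k - y‖ < r := by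
  rw [mem_latBall, mem_ball_iff_norm, lt_div_iff₀ hε]
  have : ε • lat k - y = ε • (lat k - ε⁻¹ • y) := by
    rw [smul_sub, smul_smul, mul_inv_cancel₀ hε.ne', one_smul]
  rw [this, norm_smul, Real.norm_of_nonneg hε.le, mul_comm]

theorem mem_latBall_zero_iff {ε r : ℝ} (hε : 0 < ε) (k : Fin d → ℤ) :
    k ∈ latBall (0 : E d) (r / ε) ↔ ‖ε • lat k‖ < r := by
  simpa using mem_latBall_iff_norm_smul (r := r) hε (0 : E d) k

theorem abs_pow_mul_sum_le {s : Finset (Fin d → ℤ)} {f : (Fin d → ℤ) → ℝ} {ε C M : ℝ}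
    (hε : 0 < ε) (hM : 0 ≤ M) (hs : ε ^ d * (s.card : ℝ) ≤ C) (hf : ∀ k ∈ s, |f k| ≤ M) :
    |ε ^ d * ∑ k ∈ s, f k| ≤ C * M := by
  rw [abs_mul, abs_of_pos (by positivity)]
  calc ε ^ d * |∑ k ∈ s, f k| ≤ ε ^ d * (s.card * M) := by
        gcongr
        refine (Finset.abs_sum_le_sum_abs _ _).trans ?_
        simpa using Finset.sum_le_sum hf
    _ = ε ^ d * s.card * M := by ring
    _ ≤ C * M := by gcongr

section

variable {h : E d → ℝ} {ρ : ℝ}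

/-- `ε k` lies in the ball of radius `r` about `y` exactly when `y` lies in the one about `ε k`. The
margin in `ρ - 1`, with `r ≤ 1`, confines the relevant `k` to an index set independent of `y`, so
that integration in `y` commutes with the sum. -/
theorem mul_sum_latBall_eq {r ε : ℝ} (hε : 0 < ε) (hr1 : r ≤ 1)
    (hρ : ∀ x, ρ - 1 ≤ ‖x‖ → h x = 0) (c : (Fin d → ℤ) → ℝ) (y : E d) :
    h y * ∑ k ∈ latBall (ε⁻¹ • y) (r / ε), c k =
      ∑ k ∈ latBall 0 (ρ / ε), c k * (Metric.ball (ε • lat k) r).indicator h y := by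
  by_cases h0 : h y = 0
  · rw [h0, zero_mul]
    refine (Finset.sum_eq_zero fun k _ => ?_).symm
    by_cases hy : y ∈ Metric.ball (ε • lat k) r
    · rw [Set.indicator_of_mem hy, h0, mul_zero]
    · rw [Set.indicator_of_notMem hy, mul_zero]
  have hy : ‖y‖ < ρ - 1 := not_le.1 fun hle => h0 (hρ y hle)
  rw [Finset.mul_sum]
  have hsub : latBall (ε⁻¹ • y) (r / ε) ⊆ latBall 0 (ρ / ε) := by
    intro k hk
    rw [mem_latBall_iff_norm_smul hε] at hk
    rw [mem_latBall_zero_iff hε]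
    have := norm_sub_norm_le (ε • lat k) y
    linarith
  rw [← Finset.sum_subset hsub]
  · refine Finset.sum_congr rfl fun k hk => ?_
    rw [mem_latBall_iff_norm_smul hε] at hk
    rw [Set.indicator_of_mem (by rwa [mem_ball_iff_norm, norm_sub_rev]), mul_comm]
  · intro k _ hk
    rw [mem_latBall_iff_norm_smul hε] at hk
    rw [Set.indicator_of_notMem (by rwa [mem_ball_iff_norm, norm_sub_rev]), mul_zero]

/-- The average of `h` over the ball of centre `x` and radius `r`. -/
noncomputable def ballAvg (h : E d → ℝ) (r : ℝ) (x : E d) : ℝ :=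
  (volume.real (Metric.ball (0 : E d) r))⁻¹ * ∫ y in Metric.ball x r, h y

theorem abs_ballAvg_sub_le (hh : Continuous h) (hhc : HasCompactSupport h) {r τ : ℝ} (hr : 0 < r)
    (hτ : ∀ x y, dist x y < r → |h x - h y| ≤ τ) (x : E d) : |ballAvg h r x - h x| ≤ τ := by
  have hv := volume_real_ball_pos d hr
  have hvx : volume.real (Metric.ball x r) = volume.real (Metric.ball (0 : E d) r) :=
    Measure.addHaar_real_ball_center _ _ _
  have hi : IntegrableOn h (Metric.ball x r) := (hh.integrable_of_hasCompactSupport hhc).integrableOn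
  have h1 : ballAvg h r x - h x = (volume.real (Metric.ball (0 : E d) r))⁻¹ *
      ∫ y in Metric.ball x r, (h y - h x) := by
    rw [integral_sub hi (integrableOn_const (by finiteness)), setIntegral_const, hvx, ballAvg,
      smul_eq_mul]
    field_simp
  have h2 : ‖∫ y in Metric.ball x r, (h y - h x)‖ ≤ τ * volume.real (Metric.ball x r) :=
    norm_setIntegral_le_of_norm_le_const measure_ball_lt_top fun y hy => hτ y x hy
  rw [h1, abs_mul, abs_of_pos (inv_pos.2 hv), inv_mul_le_iff₀ hv, ← hvx, mul_comm]
  exact h2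

/-- By the exchange above, the sum equals the integral over `y` of `h y` times the average of `c`
over `B_r(y)/ε`. These averages converge for each `y` and are uniformly bounded. -/
theorem tendsto_sum_ballAvg_mul {c : (Fin d → ℤ) → ℝ} {a M : ℝ} (hc : ∀ k, |c k| ≤ M)
    (ha : HasBallAverages c a) (hh : Continuous h) (hhc : HasCompactSupport h)
    (hρ : ∀ x, ρ - 1 ≤ ‖x‖ → h x = 0) {r : ℝ} (hr : 0 < r) (hr1 : r ≤ 1) :
    Tendsto (fun ε : ℝ => ε ^ d * ∑ k ∈ latBall 0 (ρ / ε), ballAvg h r (ε • lat k) * c k)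
      (𝓝[>] 0) (𝓝 (a * ∫ x, h x)) := by
  have hM : 0 ≤ M := (abs_nonneg _).trans (hc 0)
  set v := volume.real (Metric.ball (0 : E d) r) with hvdef
  have hv : 0 < v := volume_real_ball_pos d hr
  have hhi : Integrable h := hh.integrable_of_hasCompactSupport hhc
  obtain ⟨C, hC, hcard⟩ := exists_pow_mul_card_latBall_le d r hr.le
  have hlim : Tendsto (fun ε : ℝ => ∫ y, ε ^ d / v *
      (h y * ∑ k ∈ latBall (ε⁻¹ • y) (r / ε), c k)) (𝓝[>] 0) (𝓝 (∫ y, h y * a)) := by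
    refine tendsto_integral_filter_of_dominated_convergence (fun y => ‖h y‖ * (v⁻¹ * (C * M)))
      ?_ ?_ (hhi.norm.mul_const _) ?_
    · filter_upwards [self_mem_nhdsWithin] with ε hε
      simp only [mul_sum_latBall_eq hε hr1 hρ]
      refine ((Finset.measurable_fun_sum _ fun k _ => ?_).const_mul _).aestronglyMeasurable
      exact (hh.measurable.indicator measurableSet_ball).const_mul _
    · filter_upwards [Ioc_mem_nhdsGT one_pos] with ε hε
      refine Eventually.of_forall fun y => ?_
      have h1 := abs_pow_mul_sum_le hε.1 hM (hcard (ε⁻¹ • y) ε hε.1 hε.2) (f := c)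
        fun k _ => hc k
      calc ‖ε ^ d / v * (h y * ∑ k ∈ latBall (ε⁻¹ • y) (r / ε), c k)‖
          = ‖h y‖ * (v⁻¹ * |ε ^ d * ∑ k ∈ latBall (ε⁻¹ • y) (r / ε), c k|) := by
            simp only [Real.norm_eq_abs, abs_mul, abs_div, abs_of_pos hv]
            ring
        _ ≤ _ := by gcongr
    · refine Eventually.of_forall fun y => ?_
      refine ((ha r hr y).const_mul (h y)).congr fun ε => ?_
      ring
  have h3 : ∫ y, h y * a = a * ∫ x, h x := by rw [integral_mul_const, mul_comm]
  rw [h3] at hlim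
  refine hlim.congr' ?_
  filter_upwards [self_mem_nhdsWithin] with ε hε
  simp only [mul_sum_latBall_eq hε hr1 hρ]
  rw [integral_const_mul, integral_finsetSum]
  · rw [div_mul_eq_mul_div, mul_div_assoc, Finset.sum_div]
    congr 1
    refine Finset.sum_congr rfl fun k _ => ?_
    rw [integral_const_mul, integral_indicator measurableSet_ball, ballAvg]
    ring
  · intro k _
    exact (hhi.indicator measurableSet_ball).const_mul _

/-- Averages over balls determine averages against continuous compactly supported functions. -/
theorem tendsto_sum_mul_of_hasBallAverages {c : (Fin d → ℤ) → ℝ} {a M : ℝ} (hc : ∀ k, |c k| ≤ M)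
    (ha : HasBallAverages c a) (hh : Continuous h) (hhc : HasCompactSupport h) (hρ0 : 0 ≤ ρ)
    (hρ : ∀ x, ρ - 1 ≤ ‖x‖ → h x = 0) :
    Tendsto (fun ε : ℝ => ε ^ d * ∑ k ∈ latBall 0 (ρ / ε), h (ε • lat k) * c k)
      (𝓝[>] 0) (𝓝 (a * ∫ x, h x)) := by
  have hM : 0 ≤ M := (abs_nonneg _).trans (hc 0)
  obtain ⟨C, hC, hcard⟩ := exists_pow_mul_card_latBall_le d ρ hρ0
  rw [Metric.tendsto_nhds]
  intro η hη
  -- On balls of radius `r` the oscillation of `h` is at most `τ`, so passing from `ballAvg h r` to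
  -- `h` changes the sum by at most `C * M * τ`, below `η / 2`.
  set τ := η / (2 * (C * M + 1)) with hτ
  have hτ0 : 0 < τ := by positivity
  obtain ⟨δ, hδ, hu⟩ := Metric.uniformContinuous_iff.1 (hhc.uniformContinuous_of_continuous hh) τ hτ0
  set r := min δ 1
  have hr : 0 < r := lt_min hδ one_pos
  have hu' : ∀ x y, dist x y < r → |h x - h y| ≤ τ := fun x y hxy =>
    (hu (hxy.trans_le (min_le_left _ _))).le
  filter_upwards [(Metric.tendsto_nhds.1 (tendsto_sum_ballAvg_mul hc ha hh hhc hρ hr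
    (min_le_right _ _))) (η / 2) (by positivity), Ioc_mem_nhdsGT one_pos] with ε h1 hε
  have h2 : |ε ^ d * ∑ k ∈ latBall (0 : E d) (ρ / ε),
      (ballAvg h r (ε • lat k) - h (ε • lat k)) * c k| ≤ C * (τ * M) := by
    refine abs_pow_mul_sum_le hε.1 (by positivity) (hcard 0 ε hε.1 hε.2) fun k _ => ?_
    rw [abs_mul]
    exact mul_le_mul (abs_ballAvg_sub_le hh hhc hr hu' _) (hc k) (abs_nonneg _) hτ0.le
  have h3 : C * (τ * M) < η / 2 := by
    have : (C * M + 1) * τ = η / 2 := by rw [hτ]; field_simp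
    nlinarith
  simp only [sub_mul, Finset.sum_sub_distrib, mul_sub] at h2
  rw [Real.dist_eq] at h1 ⊢
  rw [abs_lt] at h1 ⊢
  rw [abs_le] at h2
  constructor <;> linarith [h1.1, h1.2, h2.1, h2.2]

/-- A summable family of bounded sequences with averages can be averaged termwise. -/
theorem tendsto_sum_mul_tsum_of_hasBallAverages {ι : Type*} {c : ι → (Fin d → ℤ) → ℝ}
    {a β : ι → ℝ} (hβ : Summable β) (hc : ∀ l k, |c l k| ≤ β l)
    (ha : ∀ l, HasBallAverages (c l) (a l)) (hh : Continuous h) (hhc : HasCompactSupport h)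
    (hρ0 : 0 ≤ ρ) (hρ : ∀ x, ρ - 1 ≤ ‖x‖ → h x = 0) :
    Tendsto (fun ε : ℝ => ε ^ d * ∑ k ∈ latBall 0 (ρ / ε), h (ε • lat k) * ∑' l, c l k)
      (𝓝[>] 0) (𝓝 ((∑' l, a l) * ∫ x, h x)) := by
  obtain ⟨C, hC, hcard⟩ := exists_pow_mul_card_latBall_le d ρ hρ0
  obtain ⟨H, hH⟩ := hh.bounded_above_of_compact_support hhc
  have hH0 : 0 ≤ H := (norm_nonneg _).trans (hH 0)
  have hβ0 : ∀ l, 0 ≤ β l := fun l => (abs_nonneg _).trans (hc l 0)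
  have hlim := tendsto_tsum_of_dominated_convergence (𝓕 := 𝓝[>] (0 : ℝ))
    (f := fun ε l => ε ^ d * ∑ k ∈ latBall 0 (ρ / ε), h (ε • lat k) * c l k)
    (g := fun l => a l * ∫ x, h x) (bound := fun l => C * H * β l) (hβ.mul_left _)
    (fun l => tendsto_sum_mul_of_hasBallAverages (hc l) (ha l) hh hhc hρ0 hρ) ?_
  · rw [tsum_mul_right] at hlim
    refine hlim.congr fun ε => ?_
    rw [tsum_mul_left]
    congr 1
    rw [Summable.tsum_finsetSum]
    · simp only [tsum_mul_left]
    · intro k _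
      have hs : Summable fun l => c l k := Summable.of_norm_bounded hβ fun l => hc l k
      exact hs.mul_left _
  · filter_upwards [Ioc_mem_nhdsGT one_pos] with ε hε l
    rw [mul_assoc]
    refine abs_pow_mul_sum_le hε.1 (mul_nonneg hH0 (hβ0 l)) (hcard 0 ε hε.1 hε.2) fun k _ => ?_
    rw [abs_mul]
    exact mul_le_mul (hH _) (hc l k) (abs_nonneg _) hH0

end

/-! ### Replacing concentrated functions by point masses -/

theorem lat_add (k l : Fin d → ℤ) : lat (k + l) = lat k + lat l := by
  ext i; simp [lat]

theorem ofReal_pow_mul_tsum_enorm_le {s : Finset (Fin d → ℤ)} {f : (Fin d → ℤ) → ℝ} {ε C M : ℝ}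
    (hε : 0 < ε) (hM : 0 ≤ M) (hs : ε ^ d * (s.card : ℝ) ≤ C) (hf : ∀ k ∈ s, |f k| ≤ M)
    (h0 : ∀ k, k ∉ s → f k = 0) :
    ENNReal.ofReal (ε ^ d) * ∑' k, ‖f k‖ₑ ≤ ENNReal.ofReal (C * M) := by
  have h1 : ∑' k, ‖f k‖ₑ ≤ ENNReal.ofReal (s.card * M) := by
    rw [tsum_eq_sum (s := s) fun k hk => by simp [h0 k hk]]
    calc ∑ k ∈ s, ‖f k‖ₑ ≤ ∑ _k ∈ s, ENNReal.ofReal M := by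
          refine Finset.sum_le_sum fun k hk => ?_
          rw [← ofReal_norm]
          exact ENNReal.ofReal_le_ofReal (hf k hk)
      _ = ENNReal.ofReal (s.card * M) := by
          rw [Finset.sum_const, nsmul_eq_mul, ENNReal.ofReal_mul (by positivity)]
          simp
  calc ENNReal.ofReal (ε ^ d) * ∑' k, ‖f k‖ₑ
      ≤ ENNReal.ofReal (ε ^ d) * ENNReal.ofReal (s.card * M) := by gcongr
    _ = ENNReal.ofReal (ε ^ d * s.card * M) := by
        rw [← ENNReal.ofReal_mul (by positivity), mul_assoc]
    _ ≤ ENNReal.ofReal (C * M) := by gcongr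

section Oscillation

variable {h : E d → ℝ} {ρ : ℝ}

/-- The averaged oscillation of `h` between the points `ε k` and `ε (y + k)`. -/
noncomputable def latOsc (h : E d → ℝ) (ε : ℝ) (y : E d) : ℝ≥0∞ :=
  ENNReal.ofReal (ε ^ d) * ∑' k, ‖h (ε • (y + lat k)) - h (ε • lat k)‖ₑ

theorem measurable_latOsc (hh : Continuous h) (ε : ℝ) : Measurable (latOsc h ε) := by
  unfold latOsc
  refine Measurable.const_mul (Measurable.tsum fun k => ?_) _
  have : Continuous fun y => h (ε • (y + lat k)) - h (ε • lat k) := by fun_prop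
  exact this.measurable.enorm

/-- The bound is uniform in `y`, as domination requires: every translate of the scaled lattice meets
the support of `h` in `O(ε^{-d})` points. -/
theorem exists_latOsc_le (hh : Continuous h) (hhc : HasCompactSupport h) (hρ0 : 0 ≤ ρ)
    (hρ : ∀ x, ρ - 1 ≤ ‖x‖ → h x = 0) :
    ∃ C : ℝ, ∀ (ε : ℝ) (y : E d), 0 < ε → ε ≤ 1 → latOsc h ε y ≤ ENNReal.ofReal C := by
  obtain ⟨C, hC, hcard⟩ := exists_pow_mul_card_latBall_le d ρ hρ0
  obtain ⟨H, hH⟩ := hh.bounded_above_of_compact_support hhc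
  have hH0 : 0 ≤ H := (norm_nonneg _).trans (hH 0)
  have key : ∀ (ε : ℝ) (y : E d), 0 < ε → ε ≤ 1 →
      ENNReal.ofReal (ε ^ d) * ∑' k, ‖h (ε • (y + lat k))‖ₑ ≤ ENNReal.ofReal (C * H) := by
    intro ε y hε hε1
    refine ofReal_pow_mul_tsum_enorm_le hε hH0 (hcard (-y) ε hε hε1) (fun k _ => hH _) fun k hk => ?_
    rw [mem_latBall, mem_ball_iff_norm, sub_neg_eq_add, not_lt, div_le_iff₀ hε] at hk
    refine hρ _ ?_
    rw [norm_smul, Real.norm_of_nonneg hε.le, add_comm y, mul_comm]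
    linarith
  refine ⟨C * H + C * H, fun ε y hε hε1 => ?_⟩
  have h0 := key ε 0 hε hε1
  simp only [zero_add] at h0
  calc latOsc h ε y
      ≤ ENNReal.ofReal (ε ^ d) * ∑' k, (‖h (ε • (y + lat k))‖ₑ + ‖h (ε • lat k)‖ₑ) := by
        unfold latOsc
        gcongr
        exact enorm_sub_le
    _ ≤ ENNReal.ofReal (C * H) + ENNReal.ofReal (C * H) := by
        rw [ENNReal.tsum_add, mul_add]
        exact add_le_add (key ε y hε hε1) h0
    _ = _ := (ENNReal.ofReal_add (by positivity) (by positivity)).symm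

/-- For fixed `y` the two points differ by `ε y`, so uniform continuity of `h` makes each of the
`O(ε^{-d})` nonzero terms small. -/
theorem tendsto_latOsc (hh : Continuous h) (hhc : HasCompactSupport h) (hρ0 : 0 ≤ ρ)
    (hρ : ∀ x, ρ - 1 ≤ ‖x‖ → h x = 0) (y : E d) :
    Tendsto (fun ε => latOsc h ε y) (𝓝[>] 0) (𝓝 0) := by
  obtain ⟨C, hC, hcard⟩ := exists_pow_mul_card_latBall_le d ρ hρ0
  rw [ENNReal.tendsto_nhds_zero]
  intro e he
  -- The tolerance may be infinite; capping it at `1` makes it a real number.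
  set e' := min e 1
  have he' : 0 < e' := lt_min he one_pos
  have hfin : e' ≠ ⊤ := ((min_le_right e 1).trans_lt ENNReal.one_lt_top).ne
  have hτ : 0 < e'.toReal / C := div_pos (ENNReal.toReal_pos he'.ne' hfin) hC
  obtain ⟨δ, hδ, hu⟩ := Metric.uniformContinuous_iff.1 (hhc.uniformContinuous_of_continuous hh) _ hτ
  have hsmall : ∀ᶠ ε in 𝓝[>] (0 : ℝ), ε * ‖y‖ < min δ 1 := by
    have h1 : Tendsto (fun ε : ℝ => ε * ‖y‖) (𝓝[>] 0) (𝓝 0) := by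
      have : Continuous fun ε : ℝ => ε * ‖y‖ := by fun_prop
      have h2 := this.tendsto 0
      rw [zero_mul] at h2
      exact h2.mono_left nhdsWithin_le_nhds
    exact h1.eventually (gt_mem_nhds (lt_min hδ one_pos))
  filter_upwards [hsmall, Ioc_mem_nhdsGT one_pos] with ε hy hε
  have hnorm : ∀ k : Fin d → ℤ, ‖ε • (y + lat k) - ε • lat k‖ = ε * ‖y‖ := by
    intro k
    rw [← smul_sub, add_sub_cancel_right, norm_smul, Real.norm_of_nonneg hε.1.le]
  have hle : latOsc h ε y ≤ ENNReal.ofReal (C * (e'.toReal / C)) := by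
    refine ofReal_pow_mul_tsum_enorm_le hε.1 hτ.le (hcard 0 ε hε.1 hε.2) (fun k _ => ?_)
      fun k hk => ?_
    · refine (hu ?_).le
      rw [dist_eq_norm, hnorm]
      exact hy.trans_le (min_le_left _ _)
    · rw [mem_latBall_zero_iff hε.1, not_lt] at hk
      have h3 := norm_sub_norm_le (ε • lat k) (ε • (y + lat k))
      rw [norm_sub_rev, hnorm] at h3
      have h4 := hy.trans_le (min_le_right _ _)
      rw [hρ _ (by linarith), hρ _ (by linarith), sub_zero]
  refine hle.trans ?_
  rw [mul_div_cancel₀ _ hC.ne', ENNReal.ofReal_toReal hfin]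
  exact min_le_left _ _

/-- A sum of functions concentrated near the lattice points can be replaced, when tested against
a function varying at scale `ε⁻¹`, by the sum of its masses at the lattice points. -/
theorem tendsto_integral_tsum_sub_sum {Q : (Fin d → ℤ) → E d → ℝ} {K s : ℝ} (hK : 0 ≤ K)
    (hs : (d : ℝ) < s) (hQc : ∀ k, Continuous (Q k)) (hQ : ∀ k y, |Q k y| ≤ K * wt s (y - lat k))
    (hh : Continuous h) (hhc : HasCompactSupport h) (hρ0 : 0 ≤ ρ)
    (hρ : ∀ x, ρ - 1 ≤ ‖x‖ → h x = 0) :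
    Tendsto (fun ε : ℝ => (∫ x, h x * ∑' k, Q k (ε⁻¹ • x)) -
      ε ^ d * ∑ k ∈ latBall 0 (ρ / ε), h (ε • lat k) * ∫ y, Q k y) (𝓝[>] 0) (𝓝 0) := by
  -- After the substitution `x = ε y` and a translation by `k` in each term, all `Q k` share the
  -- profile `K * wt s`. This integral therefore bounds the whole error.
  have hlim : Tendsto (fun ε => ∫⁻ y, ENNReal.ofReal (K * wt s y) * latOsc h ε y)
      (𝓝[>] 0) (𝓝 0) := by
    obtain ⟨C, hC⟩ := exists_latOsc_le hh hhc hρ0 hρ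
    have hwm : Measurable fun y : E d => ENNReal.ofReal (K * wt s y) :=
      ((continuous_wt s).measurable.const_mul K).ennreal_ofReal
    have := tendsto_lintegral_filter_of_dominated_convergence (l := 𝓝[>] (0 : ℝ))
      (F := fun ε y => ENNReal.ofReal (K * wt s y) * latOsc h ε y) (f := fun _ => 0)
      (μ := (volume : Measure (E d)))
      (fun y => ENNReal.ofReal (K * wt s y) * ENNReal.ofReal C) ?_ ?_ ?_ ?_
    · simpa using this
    · exact Eventually.of_forall fun ε => hwm.mul (measurable_latOsc hh ε)
    · filter_upwards [Ioc_mem_nhdsGT one_pos] with ε hε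
      refine Eventually.of_forall fun y => ?_
      gcongr
      exact hC ε y hε.1 hε.2
    · rw [lintegral_mul_const _ hwm]
      exact ENNReal.mul_ne_top ((integrable_wt hs).const_mul K).lintegral_lt_top.ne
        ENNReal.ofReal_ne_top
    · refine Eventually.of_forall fun y => ?_
      have h1 := ENNReal.Tendsto.const_mul (a := ENNReal.ofReal (K * wt s y))
        (tendsto_latOsc hh hhc hρ0 hρ y) (Or.inr ENNReal.ofReal_ne_top)
      simpa using h1
  have hQi : ∀ k, Integrable (Q k) := fun k =>
    (((integrable_wt hs).const_mul K).comp_sub_right (lat k)).mono' (hQc k).aestronglyMeasurable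
      (Eventually.of_forall (hQ k))
  refine tendsto_iff_enorm_sub_tendsto_zero.2 ?_
  refine tendsto_of_tendsto_of_tendsto_of_le_of_le' tendsto_const_nhds hlim
    (Eventually.of_forall fun _ => zero_le) ?_
  filter_upwards [self_mem_nhdsWithin] with ε hε
  have hε' : (0 : ℝ) < ε := hε
  have hemb : IsClosedEmbedding fun y : E d => ε • y :=
    (Homeomorph.smulOfNeZero ε hε'.ne').isClosedEmbedding
  have hhε : Continuous fun y => h (ε • y) := by fun_prop
  have hhεc : HasCompactSupport fun y => h (ε • y) := hhc.comp_isClosedEmbedding hemb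
  have e1 : ∫ x, h x * ∑' k, Q k (ε⁻¹ • x) = ε ^ d * ∫ y, (∑' k, Q k y) * h (ε • y) := by
    have := Measure.integral_comp_smul (volume : Measure (E d))
      (fun x => h x * ∑' k, Q k (ε⁻¹ • x)) ε
    simp only [smul_smul, inv_mul_cancel₀ hε'.ne', one_smul, finrank_euclideanSpace,
      Fintype.card_fin, smul_eq_mul] at this
    rw [abs_of_pos (by positivity)] at this
    simp only [mul_comm (∑' k, Q k _)]
    rw [this]
    field_simp
  have s1 := (normallyConvergent_of_le_wt hK hs hQ).hasSum_integral_mul hQc hhε hhεc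
  have s2 : HasSum (fun k => h (ε • lat k) * ∫ y, Q k y)
      (∑ k ∈ latBall 0 (ρ / ε), h (ε • lat k) * ∫ y, Q k y) := by
    refine hasSum_sum_of_ne_finset_zero fun k hk => ?_
    rw [mem_latBall_zero_iff hε', not_lt] at hk
    rw [hρ _ (by linarith), zero_mul]
  have s3 := s1.sub s2
  have e2 : ∀ k, (∫ y, Q k y * h (ε • y)) - h (ε • lat k) * ∫ y, Q k y =
      ∫ y, Q k y * (h (ε • y) - h (ε • lat k)) := by
    intro k
    have i1 : Integrable fun y => Q k y * h (ε • y) :=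
      ((hQc k).mul hhε).integrable_of_hasCompactSupport hhεc.mul_left
    simp only [mul_sub]
    rw [integral_sub i1 ((hQi k).mul_const _), integral_mul_const, mul_comm (h _)]
  simp only [e2] at s3
  rw [e1, sub_zero, ← mul_sub, ← s3.tsum_eq, enorm_mul]
  have e3 : ‖ε ^ d‖ₑ = ENNReal.ofReal (ε ^ d) := Real.enorm_of_nonneg (by positivity)
  rw [e3]
  calc ENNReal.ofReal (ε ^ d) * ‖∑' k, ∫ y, Q k y * (h (ε • y) - h (ε • lat k))‖ₑ
      ≤ ENNReal.ofReal (ε ^ d) * ∑' k, ∫⁻ y, ENNReal.ofReal (K * wt s y) *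
          ‖h (ε • (y + lat k)) - h (ε • lat k)‖ₑ := by
        gcongr
        refine enorm_tsum_le_tsum_enorm.trans (ENNReal.tsum_le_tsum fun k => ?_)
        refine (enorm_integral_le_lintegral_enorm _).trans ?_
        rw [← lintegral_add_right_eq_self (fun y => ‖Q k y * (h (ε • y) - h (ε • lat k))‖ₑ) (lat k)]
        refine lintegral_mono fun y => ?_
        rw [enorm_mul]
        gcongr
        rw [← ofReal_norm]
        refine ENNReal.ofReal_le_ofReal ?_
        simpa using hQ k (y + lat k)
    _ = ∫⁻ y, ENNReal.ofReal (K * wt s y) * latOsc h ε y := by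
        rw [← lintegral_tsum, ← lintegral_const_mul' _ _ ENNReal.ofReal_ne_top]
        · refine lintegral_congr fun y => ?_
          rw [ENNReal.tsum_mul_left, latOsc]
          ring
        · intro k
          have hw : Measurable fun y : E d => ENNReal.ofReal (K * wt s y) :=
            ((continuous_wt s).measurable.const_mul K).ennreal_ofReal
          have hc : Continuous fun y => h (ε • (y + lat k)) - h (ε • lat k) := by fun_prop
          exact (hw.mul hc.measurable.enorm).aemeasurable

end Oscillation

/-! ### Correlations of the fields and the limit of the squared norm -/

section Correlations

variable {Φ : (Fin d → ℤ) → E d → E d} {C s : ℝ}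

/-- The correlation at distance `l` of a family of fields attached to the lattice points. -/
noncomputable def correlation (Φ : (Fin d → ℤ) → E d → E d) (l k : Fin d → ℤ) : ℝ :=
  ∫ y, inner ℝ (Φ k y) (Φ (k + l) y)

theorem integrable_wt_mul_wt (hs : (d : ℝ) < s) (a : E d) :
    Integrable fun y => wt s y * wt s (y - a) := by
  have hs0 : 0 ≤ s := (Nat.cast_nonneg d).trans hs.le
  refine (integrable_wt hs).mono' (((continuous_wt s).mul
    ((continuous_wt s).comp (continuous_sub_right a))).aestronglyMeasurable)
    (Eventually.of_forall fun y => ?_)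
  rw [norm_mul, Real.norm_of_nonneg (wt_pos _ _).le, Real.norm_of_nonneg (wt_pos _ _).le]
  exact mul_le_of_le_one_right (wt_pos _ _).le (wt_le_one hs0 _)

/-- Summing in `l` under the integral leaves the lattice sum of weights at `y`, bounded uniformly in
`y`, against an integrable weight. -/
theorem summable_integral_wt_mul_wt (hs : (d : ℝ) < s) :
    Summable fun l : Fin d → ℤ => ∫ y : E d, wt s y * wt s (y - lat l) := by
  obtain ⟨A, hA, hsum⟩ := exists_tsum_wt_le hs
  refine summable_of_sum_le (c := ∫ y : E d, wt s y * A)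
    (fun l => integral_nonneg fun y => mul_nonneg (wt_pos _ _).le (wt_pos _ _).le) fun u => ?_
  rw [← integral_finsetSum _ fun l _ => integrable_wt_mul_wt hs (lat l)]
  refine integral_mono (integrable_finsetSum _ fun l _ => integrable_wt_mul_wt hs (lat l))
    ((integrable_wt hs).mul_const A) fun y => ?_
  simp only [← Finset.mul_sum]
  refine mul_le_mul_of_nonneg_left ?_ (wt_pos _ _).le
  exact ((hsum y).1.sum_le_tsum u fun l _ => (wt_pos _ _).le).trans (hsum y).2

theorem norm_inner_le_wt_mul_wt (hC : 0 ≤ C) (hΦ : ∀ k y, ‖Φ k y‖ ≤ C * wt s (y - lat k))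
    (l k : Fin d → ℤ) (y : E d) : ‖inner ℝ (Φ k y) (Φ (k + l) y)‖ ≤
      C ^ 2 * (wt s (y - lat k) * wt s (y - lat k - lat l)) := by
  have h1 := hΦ (k + l) y
  rw [lat_add, ← sub_sub] at h1
  calc ‖inner ℝ (Φ k y) (Φ (k + l) y)‖ ≤ ‖Φ k y‖ * ‖Φ (k + l) y‖ := norm_inner_le_norm _ _
    _ ≤ (C * wt s (y - lat k)) * (C * wt s (y - lat k - lat l)) := by
        refine mul_le_mul (hΦ k y) h1 (norm_nonneg _) ?_
        exact mul_nonneg hC (wt_pos _ _).le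
    _ = _ := by ring

theorem integral_norm_inner_le (hC : 0 ≤ C) (hs : (d : ℝ) < s)
    (hΦ : ∀ k y, ‖Φ k y‖ ≤ C * wt s (y - lat k)) (l k : Fin d → ℤ) :
    ∫ y, ‖inner ℝ (Φ k y) (Φ (k + l) y)‖ ≤ C ^ 2 * ∫ y, wt s y * wt s (y - lat l) := by
  rw [← integral_const_mul, ← integral_sub_right_eq_self
    (fun y => C ^ 2 * (wt s y * wt s (y - lat l))) (lat k)]
  refine integral_mono_of_nonneg (Eventually.of_forall fun _ => norm_nonneg _)
    (((integrable_wt_mul_wt hs (lat l)).const_mul _).comp_sub_right (lat k))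
    (Eventually.of_forall fun y => norm_inner_le_wt_mul_wt hC hΦ l k y)

theorem integrable_inner_of_le_wt (hC : 0 ≤ C) (hs : (d : ℝ) < s) (hc : ∀ k, Continuous (Φ k))
    (hΦ : ∀ k y, ‖Φ k y‖ ≤ C * wt s (y - lat k)) (l k : Fin d → ℤ) :
    Integrable fun y => inner ℝ (Φ k y) (Φ (k + l) y) :=
  (((integrable_wt_mul_wt hs (lat l)).const_mul (C ^ 2)).comp_sub_right (lat k)).mono'
    ((hc k).inner (hc (k + l))).aestronglyMeasurable
    (Eventually.of_forall fun y => norm_inner_le_wt_mul_wt hC hΦ l k y)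

/-- Identifies the mass carried by the `k`-th piece of the squared norm. Sum and integral commute by
the summability of the weight correlations, and `m = k + l` reindexes the sum. -/
theorem tsum_correlation (hC : 0 ≤ C) (hs : (d : ℝ) < s) (hc : ∀ k, Continuous (Φ k))
    (hΦ : ∀ k y, ‖Φ k y‖ ≤ C * wt s (y - lat k)) (k : Fin d → ℤ) :
    ∑' l, correlation Φ l k = ∫ y, inner ℝ (Φ k y) (∑' m, Φ m y) := by
  have h1 := hasSum_integral_of_summable_integral_norm (μ := (volume : Measure (E d)))
    (F := fun l y => inner ℝ (Φ k y) (Φ (k + l) y))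
    (fun l => integrable_inner_of_le_wt hC hs hc hΦ l k)
    (((summable_integral_wt_mul_wt hs).mul_left (C ^ 2)).of_nonneg_of_le
      (fun l => integral_nonneg fun y => norm_nonneg _)
      fun l => integral_norm_inner_le hC hs hΦ l k)
  refine h1.tsum_eq.trans (integral_congr_ae (Eventually.of_forall fun y => ?_))
  have hsum : Summable fun m => Φ m y :=
    ((normallyConvergent_of_le_wt hC hs hΦ).summable_norm y).of_norm
  have h2 : ∑' m, Φ m y = ∑' l, Φ (k + l) y := ((Equiv.addLeft k).tsum_eq fun m => Φ m y).symm
  have h3 : Summable fun l => Φ (k + l) y := (Equiv.addLeft k).summable_iff.2 hsum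
  simp only [h2]
  exact ((innerSL ℝ (Φ k y)).map_tsum h3).symm

/-- If the correlations have averages then the squared norm of the rescaled sum of the fields tends
weakly-* to a constant. -/
theorem exists_tendstoWeakStar_norm_sq (hC : 0 < C) (hs : (d : ℝ) < s)
    (hc : ∀ k, Continuous (Φ k)) (hΦ : ∀ k y, ‖Φ k y‖ ≤ C * wt s (y - lat k))
    (hav : ∀ l, ∃ a, HasBallAverages (correlation Φ l) a) :
    ∃ M₂ : ℝ, TendstoWeakStar (fun ε (x : E d) => ‖∑' k, Φ k (ε⁻¹ • x)‖ ^ 2) fun _ => M₂ := by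
  choose a ha using hav
  have hN := normallyConvergent_of_le_wt hC.le hs hΦ
  have hVc : Continuous fun y => ∑' k, Φ k y := hN.continuous_tsum hc
  obtain ⟨M, hM, hMb⟩ := exists_norm_tsum_le_of_le_wt hC.le hs hΦ
  have hV : ∀ y, ‖∑' k, Φ k y‖ ≤ M := fun y =>
    (norm_tsum_le_tsum_norm (hN.summable_norm y)).trans (hMb y)
  refine ⟨∑' l, a l, tendstoWeakStar_of_contDiff (M := max (M ^ 2) |∑' l, a l|) (fun ε _ => ?_)
    (fun ε _ x => ?_) aestronglyMeasurable_const (fun x => le_max_right _ _) fun ψ hψ hψc => ?_⟩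
  · exact ((hVc.comp (continuous_const_smul ε⁻¹)).norm.pow 2).aestronglyMeasurable
  · rw [norm_pow, norm_norm]
    exact (by gcongr; exact hV _ : _ ≤ M ^ 2).trans (le_max_left _ _)
  obtain ⟨r, hr, hsupp⟩ := exists_tsupport_subset_closedBall hψc
  have hρ : ∀ x, (r + 2) - 1 ≤ ‖x‖ → ψ x = 0 := fun x hx => by
    refine image_eq_zero_of_notMem_tsupport fun hmem => ?_
    have := mem_closedBall_zero_iff.1 (hsupp hmem)
    linarith
  -- The squared norm is split in one factor only: the other factor, the full sum, is bounded, so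
  -- each piece keeps the concentration of `Φ k`.
  have hQ : ∀ k y, |inner ℝ (Φ k y) (∑' m, Φ m y)| ≤ (C * M) * wt s (y - lat k) := fun k y => by
    calc |inner ℝ (Φ k y) (∑' m, Φ m y)| ≤ ‖Φ k y‖ * ‖∑' m, Φ m y‖ := abs_real_inner_le_norm _ _
      _ ≤ (C * wt s (y - lat k)) * M := by
          refine mul_le_mul (hΦ k y) (hV y) (norm_nonneg _) ?_
          exact mul_nonneg hC.le (wt_pos _ _).le
      _ = _ := by ring
  have t1 := tendsto_integral_tsum_sub_sum (by positivity) hs (fun k => (hc k).inner hVc) hQ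
    hψ.continuous hψc (by positivity) hρ
  have t2 := tendsto_sum_mul_tsum_of_hasBallAverages (c := correlation Φ)
    ((summable_integral_wt_mul_wt hs).mul_left (C ^ 2))
    (fun l k => (norm_integral_le_integral_norm _).trans (integral_norm_inner_le hC.le hs hΦ l k))
    ha hψ.continuous hψc (by positivity) hρ
  have t3 := t1.add t2
  simp only [tsum_correlation hC.le hs hc hΦ, sub_add_cancel, zero_add] at t3
  have hlim : (∑' l, a l) * ∫ x, ψ x = ∫ x, ψ x • ∑' l, a l := by
    simp only [smul_eq_mul]
    rw [integral_mul_const, mul_comm]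
  rw [hlim] at t3
  refine t3.congr fun ε => integral_congr_ae (Eventually.of_forall fun x => ?_)
  simp only [smul_eq_mul]
  congr 1
  rw [← real_inner_self_eq_norm_sq]
  have hsum : Summable fun m => Φ m (ε⁻¹ • x) := (hN.summable_norm _).of_norm
  have := (innerSL ℝ (∑' m, Φ m (ε⁻¹ • x))).map_tsum hsum
  simp only [innerSL_apply_apply] at this
  rw [this]
  exact tsum_congr fun k => real_inner_comm _ _

end Correlations

/-! ### The contribution of one lattice point as a function of its displacement -/

/-- `∑_{i,j} zⱼ zᵢ ∫₀¹ (1-t) W_{i,j}(y - t z) dt`. -/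
noncomputable def quadAvg {F : Type*} [NormedAddCommGroup F] [NormedSpace ℝ F]
    (W : Fin d → Fin d → E d → F) (z y : E d) : F :=
  ∑ i, ∑ j, (z j * z i) • rayAvg (W i j) z y

section QuadAvg

variable {F : Type*} [NormedAddCommGroup F] [NormedSpace ℝ F] {W : Fin d → Fin d → E d → F}

theorem continuous_quadAvg (hW : ∀ i j, Continuous (W i j)) :
    Continuous fun p : E d × E d => quadAvg W p.1 p.2 := by
  unfold quadAvg
  refine continuous_finsetSum _ fun i _ => continuous_finsetSum _ fun j _ => ?_
  exact Continuous.smul (by fun_prop) (continuous_rayAvg (hW i j))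

theorem abs_apply_mul_apply_le {z : E d} {ρ : ℝ} (hz : ‖z‖ ≤ ρ) (i j : Fin d) :
    ‖z j * z i‖ ≤ ρ * ρ := by
  rw [norm_mul]
  exact mul_le_mul ((PiLp.norm_apply_le z j).trans hz) ((PiLp.norm_apply_le z i).trans hz)
    (norm_nonneg _) ((norm_nonneg z).trans hz)

theorem norm_smul_rayAvg_le {w : E d → F} {C s ρ : ℝ} (hC : 0 ≤ C) (hs : 0 ≤ s)
    (hw : ∀ y, ‖w y‖ ≤ C * wt s y) {z : E d} (hz : ‖z‖ ≤ ρ) (i j : Fin d) (y : E d) :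
    ‖(z j * z i) • rayAvg w z y‖ ≤ ρ * ρ * (C * (1 + ρ) ^ s) * wt s y := by
  have hρ : 0 ≤ ρ := (norm_nonneg z).trans hz
  rw [norm_smul, mul_assoc]
  exact mul_le_mul (abs_apply_mul_apply_le hz i j) (norm_rayAvg_le hC hs hw hz y)
    (norm_nonneg _) (by positivity)

/-- Uniformity over `‖z‖ ≤ ρ` serves twice: for the bounded sequence `Z`, and for domination in the
continuity of the correlations in `z`. -/
theorem exists_norm_quadAvg_le {s : ℝ} (hs : 0 ≤ s)
    (hW : ∀ i j, ∃ C, 0 < C ∧ ∀ y, ‖W i j y‖ ≤ C * wt s y) (ρ : ℝ) :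
    ∃ C, 0 < C ∧ ∀ z : E d, ‖z‖ ≤ ρ → ∀ y, ‖quadAvg W z y‖ ≤ C * wt s y := by
  choose C hC hb using hW
  refine ⟨|∑ i, ∑ j, ρ * ρ * (C i j * (1 + ρ) ^ s)| + 1, by positivity, fun z hz y => ?_⟩
  calc ‖quadAvg W z y‖ ≤ ∑ i, ∑ j, ρ * ρ * (C i j * (1 + ρ) ^ s) * wt s y := by
        refine (norm_sum_le _ _).trans (Finset.sum_le_sum fun i _ => ?_)
        refine (norm_sum_le _ _).trans (Finset.sum_le_sum fun j _ => ?_)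
        exact norm_smul_rayAvg_le (hC i j).le hs (hb i j) hz i j y
    _ = (∑ i, ∑ j, ρ * ρ * (C i j * (1 + ρ) ^ s)) * wt s y := by
        simp only [Finset.sum_mul]
    _ ≤ _ := by
        have := (wt_pos s y).le
        gcongr
        linarith [le_abs_self (∑ i, ∑ j, ρ * ρ * (C i j * (1 + ρ) ^ s))]

end QuadAvg

theorem hasGradientAt_quadAvg {u : Fin d → Fin d → E d → ℝ} (hu : ∀ i j, ContDiff ℝ 1 (u i j))
    {M : Fin d → Fin d → ℝ} (hM : ∀ i j x, ‖∇ (u i j) x‖ ≤ M i j) (z y : E d) :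
    HasGradientAt (quadAvg u z) (quadAvg (fun i j => ∇ (u i j)) z y) y := by
  rw [hasGradientAt_iff_hasFDerivAt]
  unfold quadAvg
  have h : HasFDerivAt (fun y => ∑ i, ∑ j, (z j * z i) • rayAvg (u i j) z y)
      (∑ i, ∑ j, (z j * z i) • InnerProductSpace.toDual ℝ (E d) (rayAvg (∇ (u i j)) z y)) y := by
    refine HasFDerivAt.fun_sum fun i _ => HasFDerivAt.fun_sum fun j _ => ?_
    exact (hasGradientAt_rayAvg (hu i j) (hM i j) z y).hasFDerivAt.const_smul (z j * z i)
  refine h.congr_fderiv ?_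
  simp only [map_sum]
  refine Finset.sum_congr rfl fun i _ => Finset.sum_congr rfl fun j _ => ?_
  simp

theorem hasGradientAt_comp_sub_right {w : E d → ℝ} {g a x : E d} (h : HasGradientAt w g (x - a)) :
    HasGradientAt (fun y => w (y - a)) g x := by
  rw [hasGradientAt_iff_hasFDerivAt] at h ⊢
  refine (h.comp x ((hasFDerivAt_id x).sub_const a)).congr_fderiv ?_
  ext; simp

theorem hess_self_eq_sum (φ : E d → ℝ) (x z : E d) :
    hess φ x z z = ∑ i, ∑ j, (z j * z i) * partial₂ φ i j x := by
  have h : ∀ v w : E d, hess φ x v w = fderiv ℝ (fderiv ℝ φ) x v w := by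
    intro v w
    simp [hess, iteratedFDeriv_two_apply]
  have hz : z = ∑ i, z i • coordVec i := by
    conv_lhs => rw [← (EuclideanSpace.basisFun (Fin d) ℝ).sum_repr z]
    simp
  conv_lhs => rw [h, hz]
  simp only [map_sum, map_smul, sum_apply, smul_apply, smul_eq_mul, partial₂, h, Finset.mul_sum]
  rw [Finset.sum_comm]
  refine Finset.sum_congr rfl fun i _ => ?_
  exact Finset.sum_congr rfl fun j _ => by ring

theorem rayAvg_hess_eq_quadAvg {φ : E d → ℝ} (hφ : ContDiff ℝ ∞ φ) (z y : E d) :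
    ∫ t in (0 : ℝ)..1, (1 - t) * hess φ (y - t • z) z z = quadAvg (partial₂ φ) z y := by
  have hc : ∀ i j, Continuous fun t : ℝ => (1 - t) * ((z j * z i) * partial₂ φ i j (y - t • z)) := by
    intro i j
    have := (contDiff_partial₂ hφ i j).continuous
    fun_prop
  simp only [hess_self_eq_sum, Finset.mul_sum, quadAvg, rayAvg]
  rw [intervalIntegral.integral_finsetSum fun i _ =>
    (continuous_finsetSum _ fun j _ => hc i j).intervalIntegrable _ _]
  refine Finset.sum_congr rfl fun i _ => ?_
  rw [intervalIntegral.integral_finsetSum fun j _ => (hc i j).intervalIntegrable _ _]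
  refine Finset.sum_congr rfl fun j _ => ?_
  rw [smul_eq_mul, ← intervalIntegral.integral_const_mul]
  refine intervalIntegral.integral_congr fun t _ => ?_
  simp only [smul_eq_mul]
  ring

theorem integral_quadAvg_uPot_mul_laplacian (hd : 2 ≤ d) {φ ψ : E d → ℝ} (hφ : ContDiff ℝ ∞ φ)
    (hφc : HasCompactSupport φ) (hψ : ContDiff ℝ ∞ ψ) (hψc : HasCompactSupport ψ) (z a : E d) :
    ∫ x, quadAvg (uPot φ) z (x - a) * Δ ψ x = ∫ x, quadAvg (partial₂ φ) z (x - a) * ψ x := by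
  have hray : ∀ {w χ : E d → ℝ}, Continuous w → Continuous χ → HasCompactSupport χ →
      ∀ c : ℝ, Integrable fun x => c • rayAvg w z (x - a) * χ x := by
    intro w χ hw hχ hχc c
    refine Continuous.integrable_of_hasCompactSupport (Continuous.mul ?_ hχ) hχc.mul_left
    exact ((continuous_rayAvg hw).comp (continuous_const.prodMk (continuous_sub_right a))).const_smul c
  have hu := fun i j => (contDiff_uPot hd hφ hφc i j).continuous
  have hp := fun i j => (contDiff_partial₂ hφ i j).continuous
  have hL := continuous_laplacian hψ
  have hLc := hasCompactSupport_laplacian hψ hψc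
  simp only [quadAvg, Finset.sum_mul]
  rw [integral_finsetSum _ fun i _ => integrable_finsetSum _ fun j _ => hray (hu i j) hL hLc _,
    integral_finsetSum _ fun i _ =>
      integrable_finsetSum _ fun j _ => hray (hp i j) hψ.continuous hψc _]
  refine Finset.sum_congr rfl fun i _ => ?_
  rw [integral_finsetSum _ fun j _ => hray (hu i j) hL hLc _,
    integral_finsetSum _ fun j _ => hray (hp i j) hψ.continuous hψc _]
  refine Finset.sum_congr rfl fun j _ => ?_
  simp only [smul_eq_mul, mul_assoc, integral_const_mul,
    integral_rayAvg_uPot_mul_laplacian hd hφ hφc hψ hψc]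

/-! ### The corrector -/

section Corrector

variable {φ : E d → ℝ} {Z : (Fin d → ℤ) → E d}

theorem taylorRemainder_eq (hφ : ContDiff ℝ ∞ φ) :
    taylorRemainder φ Z = fun x => ∑' k, quadAvg (partial₂ φ) (Z k) (x - lat k) := by
  funext x
  exact tsum_congr fun k => rayAvg_hess_eq_quadAvg hφ (Z k) (x - lat k)

theorem normallyConvergent_gradTerm (hd : 2 ≤ d) (hφ : ContDiff ℝ ∞ φ) (hφc : HasCompactSupport φ)
    {ρ : ℝ} (hZ : ∀ k, ‖Z k‖ ≤ ρ) (i j : Fin d) : NormallyConvergent (gradTerm φ Z i j) := by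
  obtain ⟨C, hC, hb⟩ := exists_norm_gradient_uPot_le hd hφ hφc i j
  have hρ : 0 ≤ ρ := (norm_nonneg _).trans (hZ 0)
  refine normallyConvergent_of_le_wt (s := d + 1) (C := ρ * ρ * (C * (1 + ρ) ^ ((d : ℝ) + 1)))
    (by positivity) (by linarith) fun k x => ?_
  exact norm_smul_rayAvg_le hC.le (by positivity) hb (hZ k) i j _

theorem gradField_eq (hd : 2 ≤ d) (hφ : ContDiff ℝ ∞ φ) (hφc : HasCompactSupport φ)
    {ρ : ℝ} (hZ : ∀ k, ‖Z k‖ ≤ ρ) : gradField φ Z = fun x =>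
      ∑' k, quadAvg (fun i j => ∇ (uPot φ i j)) (Z k) (x - lat k) := by
  funext x
  have hs : ∀ i j, Summable fun k => gradTerm φ Z i j k x := fun i j =>
    ((normallyConvergent_gradTerm hd hφ hφc hZ i j).summable_norm x).of_norm
  have h1 : ∀ i, ∑ j, ∑' k, gradTerm φ Z i j k x = ∑' k, ∑ j, gradTerm φ Z i j k x := fun i =>
    (Summable.tsum_finsetSum fun j _ => hs i j).symm
  simp only [gradField, h1]
  exact (Summable.tsum_finsetSum fun i _ => summable_sum fun j _ => hs i j).symm

theorem exists_isDecayingFamily (hd : 2 ≤ d) (hφ : ContDiff ℝ ∞ φ) (hφc : HasCompactSupport φ)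
    {ρ : ℝ} (hZ : ∀ k, ‖Z k‖ ≤ ρ) :
    ∃ C, IsDecayingFamily (fun k x => quadAvg (uPot φ) (Z k) (x - lat k))
      (fun k x => quadAvg (fun i j => ∇ (uPot φ i j)) (Z k) (x - lat k)) C := by
  obtain ⟨C₁, hC₁, h₁⟩ := exists_norm_quadAvg_le (W := uPot φ) (s := d) (by positivity)
    (fun i j => exists_abs_uPot_le hd hφ hφc i j) ρ
  obtain ⟨C₂, hC₂, h₂⟩ := exists_norm_quadAvg_le (s := d + 1) (by positivity)
    (fun i j => exists_norm_gradient_uPot_le hd hφ hφc i j) ρ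
  have hgb : ∀ i j, ∃ M, ∀ x, ‖∇ (uPot φ i j) x‖ ≤ M := fun i j => by
    obtain ⟨C, hC, h⟩ := exists_norm_gradient_uPot_le hd hφ hφc i j
    exact ⟨C, fun x => (h x).trans (mul_le_of_le_one_right hC.le (wt_le_one (by positivity) x))⟩
  choose M hM using hgb
  refine ⟨max C₁ C₂, lt_max_of_lt_left hC₁, fun k x => ?_, fun k => ?_, fun k x => ?_, fun k x => ?_⟩
  · exact hasGradientAt_comp_sub_right (hasGradientAt_quadAvg
      (fun i j => contDiff_uPot hd hφ hφc i j) hM (Z k) (x - lat k))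
  · exact (continuous_quadAvg fun i j => continuous_gradient (contDiff_uPot hd hφ hφc i j)).comp
      (continuous_const.prodMk (continuous_sub_right (lat k)))
  · refine (h₁ (Z k) (hZ k) _).trans ?_
    have := (wt_pos (d : ℝ) (x - lat k)).le
    gcongr
    exact le_max_left _ _
  · refine (h₂ (Z k) (hZ k) _).trans ?_
    have := (wt_pos ((d : ℝ) + 1) (x - lat k)).le
    gcongr
    exact le_max_right _ _

theorem isDistribSolution_renormSum (hd : 2 ≤ d) (hφ : ContDiff ℝ ∞ φ) (hφc : HasCompactSupport φ)
    {ρ : ℝ} (hZ : ∀ k, ‖Z k‖ ≤ ρ) :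
    IsDistribSolution (renormSum fun k x => quadAvg (uPot φ) (Z k) (x - lat k))
      (taylorRemainder φ Z) := by
  obtain ⟨C, hC⟩ := exists_isDecayingFamily hd hφ hφc hZ
  -- A continuous compactly supported function has every rate of decay; `d + 1` is merely one above
  -- `d`. The locally finite sum is thus treated as a normally convergent one.
  have hp : ∀ i j, ∃ C, 0 < C ∧ ∀ y, ‖partial₂ φ i j y‖ ≤ C * wt (d + 1) y := by
    intro i j
    obtain ⟨r, hr, hs⟩ := exists_tsupport_subset_closedBall (hasCompactSupport_partial₂ hφ hφc i j)
    refine exists_le_wt_of_continuous (contDiff_partial₂ hφ i j).continuous (R := r + 1) (C := 0)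
      (by positivity) fun x hx => ?_
    have h0 : partial₂ φ i j x = 0 := image_eq_zero_of_notMem_tsupport fun h => by
      have := mem_closedBall_zero_iff.1 (hs h)
      linarith
    simp [h0]
  obtain ⟨C', hC', hb⟩ := exists_norm_quadAvg_le (s := d + 1) (by positivity) hp ρ
  rw [taylorRemainder_eq hφ]
  refine hC.isDistribSolution (normallyConvergent_of_le_wt hC'.le (by linarith) fun k x =>
    hb (Z k) (hZ k) _) (fun k => ?_) fun k ψ hψ hψc =>
      integral_quadAvg_uPot_mul_laplacian hd hφ hφc hψ hψc (Z k) (lat k)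
  exact (continuous_quadAvg fun i j => (contDiff_partial₂ hφ i j).continuous).comp
    (continuous_const.prodMk (continuous_sub_right (lat k)))

/-- The correlation integral `∫ P(a, y) · P(b, y - l) dy`, as a function of `(a, b)`. -/
noncomputable def pairing (P : E d → E d → E d) (l : E d) (p : E d × E d) : ℝ :=
  ∫ y, inner ℝ (P p.1 y) (P p.2 (y - l))

/-- Needed because (A3) concerns continuous `F`. Dominated convergence applies, since the decay of
`P` is uniform for parameters in the unit ball about `p₀`. -/
theorem continuous_pairing {P : E d → E d → E d} (hP : Continuous fun p : E d × E d => P p.1 p.2)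
    {s : ℝ} (hs : (d : ℝ) < s)
    (hb : ∀ ρ : ℝ, ∃ C, 0 < C ∧ ∀ z : E d, ‖z‖ ≤ ρ → ∀ y, ‖P z y‖ ≤ C * wt s y) (l : E d) :
    Continuous (pairing P l) := by
  rw [continuous_iff_continuousAt]
  intro p₀
  obtain ⟨C, hC, h⟩ := hb (‖p₀‖ + 1)
  refine continuousAt_of_dominated (bound := fun y => C ^ 2 * (wt s y * wt s (y - l)))
    (Eventually.of_forall fun p => ?_) ?_ ((integrable_wt_mul_wt hs l).const_mul _)
    (Eventually.of_forall fun y => ?_)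
  · exact ((hP.comp (continuous_const.prodMk continuous_id)).inner
      (hP.comp (continuous_const.prodMk (continuous_sub_right l)))).aestronglyMeasurable
  · filter_upwards [Metric.ball_mem_nhds p₀ one_pos] with p hp
    have hp' : ‖p‖ ≤ ‖p₀‖ + 1 := by
      rw [mem_ball_iff_norm] at hp
      linarith [norm_sub_norm_le p p₀]
    refine Eventually.of_forall fun y => ?_
    calc ‖inner ℝ (P p.1 y) (P p.2 (y - l))‖ ≤ ‖P p.1 y‖ * ‖P p.2 (y - l)‖ := norm_inner_le_norm _ _
      _ ≤ (C * wt s y) * (C * wt s (y - l)) := by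
          refine mul_le_mul (h _ ((norm_fst_le p).trans hp') y) (h _ ((norm_snd_le p).trans hp') _)
            (norm_nonneg _) ?_
          exact mul_nonneg hC.le (wt_pos _ _).le
      _ = _ := by ring
  · exact ((hP.comp (continuous_fst.prodMk continuous_const)).inner
      (hP.comp (continuous_snd.prodMk continuous_const))).continuousAt

/-- Translation by `k` removes the explicit dependence on the lattice point, leaving a function of
`(Z k, Z (k + l))` as in (A3). -/
theorem correlation_eq_pairing (P : E d → E d → E d) (l k : Fin d → ℤ) :
    correlation (fun k x => P (Z k) (x - lat k)) l k = pairing P (lat l) (Z k, Z (k + l)) := by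
  unfold correlation pairing
  rw [← integral_sub_right_eq_self
    (fun y => (inner ℝ (P (Z k) y) (P (Z (k + l)) (y - lat l)) : ℝ)) (lat k)]
  simp only [lat_add, sub_sub]

/-- The convergence properties of the sum of a decaying family whose gradients have averaged
correlations. -/
theorem IsDecayingFamily.homogenization {Ψ : (Fin d → ℤ) → E d → ℝ}
    {Φ : (Fin d → ℤ) → E d → E d} {C : ℝ} (h : IsDecayingFamily Ψ Φ C)
    (hav : ∀ l, ∃ a, HasBallAverages (correlation Φ l) a)
    {V : E d → E d} (hV : V = fun x => ∑' k, Φ k x) :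
    HasWeakGradient (renormSum Ψ) V ∧ MemLp V ∞ volume ∧
      TendstoWeakStar (fun ε x => V (ε⁻¹ • x)) (fun _ => 0) ∧
      TendstoZeroLocUnif (fun ε x => ε * renormSum Ψ (ε⁻¹ • x)) ∧
      ∃ M₂ : ℝ, TendstoWeakStar (fun ε x => ‖V (ε⁻¹ • x)‖ ^ 2) (fun _ => M₂) := by
  obtain ⟨C', hC', hw⟩ := h.exists_abs_renormSum_le
  obtain ⟨M, hM, hb⟩ := h.exists_norm_tsum_le
  subst hV
  exact ⟨hasWeakGradient_of_hasGradientAt h.hasGradientAt_renormSum h.continuous_tsum,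
    memLp_top_of_bound h.continuous_tsum.aestronglyMeasurable M (Eventually.of_forall hb),
    tendstoWeakStar_gradient_zero hC'.le h.hasGradientAt_renormSum h.continuous_tsum hb hw,
    tendstoZeroLocUnif_of_abs_le hC'.le hw,
    exists_tendstoWeakStar_norm_sq h.pos (by linarith) h.continuous h.norm_le hav⟩

theorem exists_hasBallAverages_correlation (hd : 2 ≤ d) (hφ : ContDiff ℝ ∞ φ)
    (hφc : HasCompactSupport φ) (hA3 : HasCorrelationAverages Z) (l : Fin d → ℤ) :
    ∃ a, HasBallAverages (correlation
      (fun k x => quadAvg (fun i j => ∇ (uPot φ i j)) (Z k) (x - lat k)) l) a := by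
  have hF : Continuous (pairing (quadAvg fun i j => ∇ (uPot φ i j)) (lat l)) :=
    continuous_pairing
      (continuous_quadAvg fun i j => continuous_gradient (contDiff_uPot hd hφ hφc i j))
      (s := d + 1) (by linarith) (exists_norm_quadAvg_le (by positivity)
        fun i j => exists_norm_gradient_uPot_le hd hφ hφc i j) _
  obtain ⟨a, ha⟩ := hA3 _ hF l
  refine ⟨a, fun R hR x₀ => ?_⟩
  simp only [correlation_eq_pairing]
  exact ha R hR x₀

end Corrector

end NonlinearCorrector

theorem mainTheorem8 (d : ℕ) (hd : 2 ≤ d) (φ : NonlinearCorrector.E d → ℝ)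
    (hφ : ContDiff ℝ ∞ φ) (hφc : HasCompactSupport φ)
    (Z : (Fin d → ℤ) → NonlinearCorrector.E d) (hZ : Memℓp Z ∞)
    (hA3 : NonlinearCorrector.HasCorrelationAverages Z) :
    ∃ w₂ : NonlinearCorrector.E d → ℝ,
      NonlinearCorrector.IsDistribSolution w₂ (NonlinearCorrector.taylorRemainder φ Z) ∧
      (∀ i j : Fin d,
        NonlinearCorrector.NormallyConvergent (NonlinearCorrector.gradTerm φ Z i j)) ∧
      NonlinearCorrector.HasWeakGradient w₂ (NonlinearCorrector.gradField φ Z) ∧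
      MemLp (NonlinearCorrector.gradField φ Z) ∞ volume ∧
      NonlinearCorrector.TendstoWeakStar
        (fun ε x => NonlinearCorrector.gradField φ Z (ε⁻¹ • x)) (fun _ => 0) ∧
      NonlinearCorrector.TendstoZeroLocUnif (fun ε x => ε * w₂ (ε⁻¹ • x)) ∧
      ∃ M₂ : ℝ, NonlinearCorrector.TendstoWeakStar
        (fun ε x => ‖NonlinearCorrector.gradField φ Z (ε⁻¹ • x)‖ ^ 2) (fun _ => M₂) := by
  open NonlinearCorrector in
  obtain ⟨ρ, hρ⟩ := memℓp_infty_iff.1 hZ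
  have hZρ : ∀ k, ‖Z k‖ ≤ ρ := fun k => hρ ⟨k, rfl⟩
  obtain ⟨C, hC⟩ := exists_isDecayingFamily hd hφ hφc hZρ
  have h := hC.homogenization (exists_hasBallAverages_correlation hd hφ hφc hA3)
    (gradField_eq hd hφ hφc hZρ)
  exact ⟨_, isDistribSolution_renormSum hd hφ hφc hZρ, normallyConvergent_gradTerm hd hφ hφc hZρ, h⟩
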